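/- Fix $d\ge 1$. A dyadic cube is a set $2^{-k}([0,1)^d+m)\subset\mathbb{R}^d$ with $k\in\mathbb{Z}$, $m\in\mathbb{Z}^d$. For a Borel measure $\mu$ on $\mathbb{R}^d$ write $\langle f\rangle_Q^\mu=\frac1{\mu(Q)}\int_Q f\,d\mu$. For a Banach lattice $E$, a finite collection $\mathcal{D}$ of dyadic cubes and a locally integrable $f:\mathbb{R}^d\to E$, the lattice maximal function is $$\widetilde M^\mu_{\mathcal D}f(x)=\sup_{Q\in\mathcal D}\langle |f|\rangle^\mu_Q\,1_Q(x),$$ with the absolute value and the supremum taken in the lattice $E$; for $q\in[1,\infty)$, a finite collection $\mathcal{S}$ of dyadic cubes and a locally integrable $g:\mathbb{R}^d\to\mathbb{R}$, put $$\mathcal A^\mu_{q,\mathcal S}g(x)=\Big(\sum_{S\in\mathcal S}\big(\langle|g|\rangle^\mu_S\big)^q1_S(x)\Big)^{1/q}.$$ The collection $\mathcal{S}$ is called sparse if there are pairwise disjoint measurable sets $E_S\subseteq S$, $S\in\mathcal S$, with $\mu(E_S)\ge\frac12\mu(S)$. The lattice $E$ has the Hardy–Littlewood property if, for some $p\in(1,\infty)$,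 the operators $\widetilde M_{\mathcal D}$ taken with respect to Lebesgue measure are bounded on $L^p(\mathbb{R}^d;E)$ uniformly over all finite collections $\mathcal D$ of dyadic cubes. It is $q$-convex, $q\in[1,\infty)$, if there is a constant $C$ such that for all $n$ and all $e_1,\dots,e_n\in E$ $$\Big\|\Big(\sum_{k=1}^n|e_k|^q\Big)^{1/q}\Big\|_E\le C\Big(\sum_{k=1}^n\|e_k\|_E^q\Big)^{1/q},$$ where the vector on the left is defined by the Krivine functional calculus. Sparse domination with exponent $q\in[1,\infty)$ and constant $C$ holds for $(E,\mu)$ if for every finite collection $\mathcal D$ of dyadic cubes and every locally integrable $f:\mathbb{R}^d\to E$ there is a sparse subcollection $\mathcal S\subseteq\mathcal D$ such that $$\big\|\widetilde M^\mu_{\mathcal D}f\big\|_E\le C\,\mathcal A^\mu_{q,\mathcal S}(\|f\|_E)\qquad\mu\text{-almost everywhere.}$$ Theorem. Let $E$ be a Banach lattice with the Hardy–Littlewood property on $\mathbb{R}^d$, and set $q^*=\sup\{q\in(1,\infty): E\text{ is }q\text{-convex}\}\in[-\infty,\infty]$. Then: (i) for every $q\in[1,q^*)$ there is a constant $C$ such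 that, for every locally finite Borel measure $\mu$ on $\mathbb{R}^d$ with $\mu(\mathbb{R}^d)=\infty$, sparse domination with exponent $q$ and constant $C$ holds for $(E,\mu)$; (ii) for every $q\in[1,\infty)$ with $q>q^*$ and every locally finite Borel measure $\mu$ on $\mathbb{R}^d$ with $\mu(\mathbb{R}^d)=\infty$, there is no constant $C$ for which sparse domination with exponent $q$ and constant $C$ holds for $(E,\mu)$. -/

import Mathlib

open MeasureTheory

noncomputable section

namespace SparseLattice

/-! ### Krivine calculus and `q`-convexity -/

/-- The vector lattice of all continuous functions `f : ℝⁿ → ℝ` that are homogeneous of degree one,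
i.e. `f (c t) = c f t` for all `c ≥ 0`. -/
def homogeneousFunctions (n : ℕ) : Submodule ℝ C(Fin n → ℝ, ℝ) where
  carrier := {f | ∀ c : ℝ, 0 ≤ c → ∀ t : Fin n → ℝ, f (c • t) = c * f t}
  add_mem' := by
    intro f g hf hg c hc t
    simp only [ContinuousMap.add_apply, hf c hc t, hg c hc t]
    ring
  zero_mem' := by
    intro c _ t
    simp
  smul_mem' := by
    intro a f hf c hc t
    simp only [ContinuousMap.smul_apply, hf c hc t, smul_eq_mul]
    ring

/-- The coordinate function `t ↦ t i`. -/
def homogeneousCoord {n : ℕ} (i : Fin n) : homogeneousFunctions n :=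
  ⟨⟨fun t => t i, continuous_apply i⟩, fun _ _ _ => rfl⟩

/-- The pointwise supremum of two homogeneous functions. -/
def homogeneousSup {n : ℕ} (f g : homogeneousFunctions n) : homogeneousFunctions n :=
  ⟨f.1 ⊔ g.1, by
    intro c hc t
    rw [ContinuousMap.sup_apply, ContinuousMap.sup_apply, f.2 c hc t, g.2 c hc t]
    exact (mul_max_of_nonneg _ _ hc).symm⟩

/-- The function `t ↦ (∑ₖ |tₖ|^q)^(1/q)`. -/
def homogeneousPowerSum (n : ℕ) (q : ℝ) (hq : 0 < q) : homogeneousFunctions n :=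
  ⟨⟨fun t => (∑ k, |t k| ^ q) ^ (1 / q), by
      have h : (0 : ℝ) ≤ 1 / q := by positivity
      refine Continuous.rpow_const ?_ (fun _ => Or.inr h)
      refine continuous_finsetSum _ fun k _ => ?_
      exact ((continuous_apply k).abs).rpow_const (fun _ => Or.inr hq.le)⟩, by
    intro c hc t
    have h1 : ∑ k, |(c • t) k| ^ q = c ^ q * ∑ k, |t k| ^ q := by
      rw [Finset.mul_sum]
      refine Finset.sum_congr rfl fun k _ => ?_
      rw [Pi.smul_apply, smul_eq_mul, abs_mul, abs_of_nonneg hc,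
        Real.mul_rpow hc (abs_nonneg _)]
    have h2 : (0 : ℝ) ≤ ∑ k, |t k| ^ q :=
      Finset.sum_nonneg fun k _ => Real.rpow_nonneg (abs_nonneg _) _
    change (∑ k, |(c • t) k| ^ q) ^ (1 / q) = c * (∑ k, |t k| ^ q) ^ (1 / q)
    rw [h1, Real.mul_rpow (Real.rpow_nonneg hc _) h2, ← Real.rpow_mul hc,
      mul_one_div_cancel hq.ne', Real.rpow_one]⟩

section Lattice

variable {E : Type*} [NormedAddCommGroup E] [NormedSpace ℝ E] [Lattice E]

/-- `τ` is the Krivine functional calculus of the vectors `e₁, …, eₙ` of the Banach lattice `E`: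
the (unique) linear lattice homomorphism from the continuous homogeneous functions on `ℝⁿ` to `E`
that maps the `i`-th coordinate function to `eᵢ`. The vector `τ f` is what is written
`f(e₁, …, eₙ)`. -/
structure IsKrivineCalculus {n : ℕ} (e : Fin n → E) (τ : homogeneousFunctions n →ₗ[ℝ] E) :
    Prop where
  map_coord : ∀ i, τ (homogeneousCoord i) = e i
  map_sup : ∀ f g, τ (homogeneousSup f g) = τ f ⊔ τ g

variable (E) in
/-- `q`-convexity, `q ∈ [1, ∞)`: for some constant `C`,
`‖(∑ₖ |eₖ|^q)^(1/q)‖ ≤ C (∑ₖ ‖eₖ‖^q)^(1/q)` for all `e₁, …, eₙ ∈ E`,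
where `(∑ₖ |eₖ|^q)^(1/q)` is given by the Krivine calculus. -/
def IsQConvex (q : ℝ) : Prop :=
  ∃ hq : 1 ≤ q, ∃ C : ℝ, ∀ (n : ℕ) (e : Fin n → E),
    ∃ τ : homogeneousFunctions n →ₗ[ℝ] E, IsKrivineCalculus e τ ∧
      ‖τ (homogeneousPowerSum n q (one_pos.trans_le hq))‖ ≤ C * (∑ k, ‖e k‖ ^ q) ^ (1 / q)

variable (E) in
/-- The critical exponent `q* = sup {q ∈ (1, ∞) : E is q-convex}`, an extended real number. -/
def criticalExponent : EReal :=
  sSup ((fun q : ℝ => (q : EReal)) '' {q : ℝ | 1 < q ∧ IsQConvex E q})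

end Lattice

/-! ### Dyadic cubes, the lattice maximal operator, sparse operators -/

/-- Dyadic cubes `2⁻ᵏ([0,1)ᵈ + m)` of `ℝᵈ`, with `k ∈ ℤ` and `m ∈ ℤᵈ`. -/
def IsDyadicCube {d : ℕ} (Q : Set (Fin d → ℝ)) : Prop :=
  ∃ (k : ℤ) (m : Fin d → ℤ),
    Q = {x | ∀ i, (2 : ℝ) ^ (-k) * m i ≤ x i ∧ x i < (2 : ℝ) ^ (-k) * (m i + 1)}

open scoped Classical in
/-- The dyadic lattice Hardy–Littlewood maximal function
`x ↦ sup_{Q ∈ D} ⟨|f|⟩_Q 1_Q(x)`, with absolute value and supremum taken in the lattice `E`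
(and with the value `0` for the empty collection). -/
def latticeMaximal {d : ℕ} {E : Type*} [NormedAddCommGroup E] [NormedSpace ℝ E] [Lattice E]
    (μ : Measure (Fin d → ℝ)) (D : Finset (Set (Fin d → ℝ))) (f : (Fin d → ℝ) → E)
    (x : Fin d → ℝ) : E :=
  if h : D.Nonempty then
    D.sup' h fun Q => Q.indicator (fun _ => ⨍ y in Q, |f y| ∂μ) x
  else 0

/-- The sparse operator `A_{q,S} g (x) = (∑_{Q ∈ S} (⟨|g|⟩_Q)^q 1_Q(x))^(1/q)`. -/
def sparseOperator {d : ℕ} (μ : Measure (Fin d → ℝ)) (q : ℝ) (S : Finset (Set (Fin d → ℝ)))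
    (g : (Fin d → ℝ) → ℝ) (x : Fin d → ℝ) : ℝ :=
  (∑ Q ∈ S, Q.indicator (fun _ => (⨍ y in Q, |g y| ∂μ) ^ q) x) ^ (1 / q)

/-- A finite collection `S` of cubes is sparse with respect to `μ` if its members `Q` have pairwise
disjoint (measurable) subsets `F Q ⊆ Q` with `μ (F Q) ≥ μ Q / 2`. -/
def IsSparse {d : ℕ} (μ : Measure (Fin d → ℝ)) (S : Finset (Set (Fin d → ℝ))) : Prop :=
  ∃ F : Set (Fin d → ℝ) → Set (Fin d → ℝ),
    (∀ Q ∈ S, MeasurableSet (F Q) ∧ F Q ⊆ Q ∧ μ Q / 2 ≤ μ (F Q)) ∧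
    (S : Set (Set (Fin d → ℝ))).PairwiseDisjoint F

/-- The Hardy–Littlewood property of `E`: for some `p ∈ (1, ∞)` the dyadic lattice maximal
operators on `L^p(ℝᵈ, dx; E)` are bounded uniformly over all finite collections of dyadic cubes. -/
def HardyLittlewoodProperty (d : ℕ) (E : Type*) [NormedAddCommGroup E] [NormedSpace ℝ E]
    [Lattice E] : Prop :=
  ∃ p : ENNReal, 1 < p ∧ p < ⊤ ∧ ∃ C : NNReal,
    ∀ D : Finset (Set (Fin d → ℝ)), (∀ Q ∈ D, IsDyadicCube Q) →
      ∀ f : (Fin d → ℝ) → E, MemLp f p volume →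
        eLpNorm (latticeMaximal volume D f) p volume ≤ C * eLpNorm f p volume

/-- Sparse domination of the dyadic lattice maximal operator with exponent `q` and constant `C`:
for every finite collection `D` of dyadic cubes and every locally integrable `f : ℝᵈ → E` there is
a sparse subcollection `S ⊆ D` with `‖M_D f‖ ≤ C A_{q,S}(‖f‖)` almost everywhere. -/
def SparseDomination {d : ℕ} (E : Type*) [NormedAddCommGroup E] [NormedSpace ℝ E] [Lattice E]
    (μ : Measure (Fin d → ℝ)) (q C : ℝ) : Prop :=
  ∀ D : Finset (Set (Fin d → ℝ)), (∀ Q ∈ D, IsDyadicCube Q) →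
    ∀ f : (Fin d → ℝ) → E, LocallyIntegrable f μ →
      ∃ S : Finset (Set (Fin d → ℝ)), S ⊆ D ∧ IsSparse μ S ∧
        ∀ᵐ x ∂μ, ‖latticeMaximal μ D f x‖ ≤ C * sparseOperator μ q S (fun y => ‖f y‖) x

end SparseLattice

end

/-! Both halves pass through the upper q-estimate `UpperEstimate`, which bounds the norm of a finite
supremum of positive vectors by the ℓ^q sum of majorants of their norms. A q-convex lattice
satisfies it, since the supremum lies below the Krivine power sum. Conversely, an upper q-estimate
with q > 1 implies r-convexity for every r in (1, q) (`isQConvex_of_upperEstimate`): up to a factor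
3, an ℓ^r sum is an average of maxima of the coordinates multiplied by independent variables with
tail t^(-r). This turns power sums into averages of finite suprema, inside the functional calculus
and hence in E. So q* is also governed by upper estimates.

Positive half. The Hardy–Littlewood property, tested on step functions depending on one coordinate,
gives an L^p maximal inequality on finite binary trees, and stopping the trees turns it into a weak
(1,1) inequality. An arbitrary measure splits cubes in arbitrary proportions, not in halves; the
weak inequality is therefore encoded by a Bellman function, which is midpoint concave because trees
can be glued, and concave because it is also bounded below on segments. Concavity handles arbitrary
proportions and yields weak (1,1) for every measure, with the same constant (`measure_le_bellman`,
`weakType`). Weak (1,1) drives a stopping-time construction that places the maximal function below a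
supremum of positive vectors v_Q, Q ∈ S, with v_Q supported on Q and ‖v_Q‖ at most a multiple of the
average of ‖f‖ over Q (`exists_sparse_family`). An upper estimate applied to that supremum produces
the ℓ^q sum.

Negative half. As μ has infinite mass, there are increasing dyadic cubes Q_k whose measures grow as
fast as desired. For f equal to e_k on the shell Q_k \ Q_(k-1), the average of |f| over Q_k is at
least e_k / 2, while that of ‖f‖ is essentially ‖e_k‖. Sparse domination evaluated at a point of Q_0
then is an upper q-estimate (`upperEstimate_of_sparseDomination`), so q ≤ q* when q > 1. For q = 1
this estimate is void, and one needs q* > 1 instead: complete binary trees show that suprema of 2^L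
positive vectors in the unit ball have norm of order 2^L / L at most, and submultiplicativity
improves this to an upper estimate with some exponent above 1
(`BinTree.MaximalBound.exists_upperEstimate`). -/

noncomputable section

set_option linter.unusedSectionVars false

namespace SparseLattice

/-! ### Finite suprema of nonnegative vectors -/

section PosSup

variable {E ι κ : Type*} [Lattice E] [Zero E]

/-- The supremum of `0` and the finitely many elements `g i`, `i ∈ s`. -/
def posSup (s : Finset ι) (g : ι → E) : E :=
  s.fold (· ⊔ ·) 0 g

@[simp] theorem posSup_empty (g : ι → E) : posSup ∅ g = 0 := rfl

theorem posSup_insert [DecidableEq ι] (s : Finset ι) (g : ι → E) (i : ι) :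
    posSup (insert i s) g = g i ⊔ posSup s g :=
  Finset.fold_insert_idem

theorem posSup_le_iff {s : Finset ι} {g : ι → E} {b : E} :
    posSup s g ≤ b ↔ 0 ≤ b ∧ ∀ i ∈ s, g i ≤ b := by
  classical
  induction s using Finset.induction_on with
  | empty => simp
  | insert i s _ ih =>
    rw [posSup_insert, sup_le_iff, ih, Finset.forall_mem_insert]
    tauto

theorem posSup_nonneg (s : Finset ι) (g : ι → E) : 0 ≤ posSup s g :=
  (posSup_le_iff.1 le_rfl).1

theorem le_posSup {s : Finset ι} (g : ι → E) {i : ι} (hi : i ∈ s) : g i ≤ posSup s g :=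
  (posSup_le_iff.1 le_rfl).2 i hi

theorem posSup_le {s : Finset ι} {g : ι → E} {b : E} (hb : 0 ≤ b) (h : ∀ i ∈ s, g i ≤ b) :
    posSup s g ≤ b :=
  posSup_le_iff.2 ⟨hb, h⟩

theorem posSup_mono {s : Finset ι} {f g : ι → E} (h : ∀ i ∈ s, f i ≤ g i) :
    posSup s f ≤ posSup s g :=
  posSup_le (posSup_nonneg _ _) fun i hi => (h i hi).trans (le_posSup g hi)

theorem posSup_subset {s t : Finset ι} (g : ι → E) (h : s ⊆ t) : posSup s g ≤ posSup t g :=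
  posSup_le (posSup_nonneg _ _) fun _ hi => le_posSup g (h hi)

end PosSup

section Norm

variable {E ι : Type*} [NormedAddCommGroup E] [Lattice E] [IsOrderedAddMonoid E] [HasSolidNorm E]

theorem norm_le_norm_of_nonneg_of_le {a b : E} (ha : 0 ≤ a) (h : a ≤ b) : ‖a‖ ≤ ‖b‖ :=
  norm_le_norm_of_abs_le_abs (by rwa [abs_of_nonneg ha, abs_of_nonneg (ha.trans h)])

theorem norm_le_of_nonneg_of_le {a b : E} {c : ℝ} (ha : 0 ≤ a) (h : a ≤ b) (hb : ‖b‖ ≤ c) :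
    ‖a‖ ≤ c :=
  (norm_le_norm_of_nonneg_of_le ha h).trans hb

theorem posSup_smul_le [NormedSpace ℝ E] [IsOrderedModule ℝ E] (s : Finset ι) (g : ι → E) {c : ℝ}
    (hc : 0 ≤ c) : posSup s (fun i => c • g i) ≤ c • posSup s g :=
  posSup_le (smul_nonneg hc (posSup_nonneg _ _)) fun _ hi =>
    smul_le_smul_of_nonneg_left (le_posSup g hi) hc

end Norm

/-- An upper `q`-estimate for finite suprema of nonnegative vectors. -/
def UpperEstimate (E : Type*) [NormedAddCommGroup E] [Lattice E] (q C : ℝ) : Prop :=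
  ∀ (n : ℕ) (e : Fin n → E) (b : Fin n → ℝ), (∀ k, 0 ≤ e k) → (∀ k, 0 < b k) →
    (∀ k, ‖e k‖ ≤ b k) → ‖posSup Finset.univ e‖ ≤ C * (∑ k, b k ^ q) ^ (1 / q)

/-! ### The lattice maximal function as a supremum of cube averages -/

section Maximal

variable {d : ℕ} {E : Type*} [NormedAddCommGroup E] [NormedSpace ℝ E] [CompleteSpace E]
  [Lattice E] [IsOrderedAddMonoid E] [IsOrderedModule ℝ E] [HasSolidNorm E]

/-- The function `1_Q ⟨|f|⟩_Q`. -/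
def cubeAverage (μ : Measure (Fin d → ℝ)) (f : (Fin d → ℝ) → E) (x : Fin d → ℝ)
    (Q : Set (Fin d → ℝ)) : E :=
  Q.indicator (fun _ => ⨍ y in Q, |f y| ∂μ) x

theorem average_abs_nonneg (μ : Measure (Fin d → ℝ)) (f : (Fin d → ℝ) → E)
    (Q : Set (Fin d → ℝ)) : 0 ≤ ⨍ y in Q, |f y| ∂μ := by
  rw [average]
  exact integral_nonneg fun y => abs_nonneg (f y)

theorem cubeAverage_nonneg (μ : Measure (Fin d → ℝ)) (f : (Fin d → ℝ) → E) (x : Fin d → ℝ)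
    (Q : Set (Fin d → ℝ)) : 0 ≤ cubeAverage μ f x Q :=
  Set.indicator_apply_nonneg fun _ => average_abs_nonneg μ f Q

/-- All averages of |f| are nonnegative, so adjoining 0 to the supremum changes nothing, and it
supplies the right value for the empty collection. -/
theorem latticeMaximal_eq_posSup (μ : Measure (Fin d → ℝ)) (D : Finset (Set (Fin d → ℝ)))
    (f : (Fin d → ℝ) → E) (x : Fin d → ℝ) :
    latticeMaximal μ D f x = posSup D (cubeAverage μ f x) := by
  rw [latticeMaximal]
  split_ifs with h
  · refine le_antisymm (Finset.sup'_le _ _ fun Q hQ => le_posSup (cubeAverage μ f x) hQ)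
      (posSup_le ?_ fun Q hQ => Finset.le_sup' (cubeAverage μ f x) hQ)
    obtain ⟨Q, hQ⟩ := h
    exact (cubeAverage_nonneg μ f x Q).trans (Finset.le_sup' (cubeAverage μ f x) hQ)
  · rw [Finset.not_nonempty_iff_eq_empty.1 h, posSup_empty]

end Maximal

/-! ### Existence of the Krivine calculus -/

section SupLin

open scoped Pointwise Classical

variable {n : ℕ} {F : Type*} [AddCommGroup F] [Module ℝ F] [Lattice F] [IsOrderedAddMonoid F]
  [IsOrderedModule ℝ F]

/-- The supremum of the linear combinations `∑ᵢ aᵢ eᵢ` with `a` in a finite set `A`. -/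
def supLin (e : Fin n → F) (A : Finset (Fin n → ℝ)) (hA : A.Nonempty) : F :=
  A.sup' hA (Fintype.linearCombination ℝ e)

variable (e : Fin n → F) {A B : Finset (Fin n → ℝ)} (hA : A.Nonempty) (hB : B.Nonempty)

theorem supLin_singleton (a : Fin n → ℝ) :
    supLin e {a} (Finset.singleton_nonempty a) = Fintype.linearCombination ℝ e a :=
  Finset.sup'_singleton _

theorem supLin_union : supLin e (A ∪ B) (hA.mono Finset.subset_union_left) =
    supLin e A hA ⊔ supLin e B hB :=
  Finset.sup'_union hA hB _

theorem supLin_add : supLin e (A + B) (hA.add hB) = supLin e A hA + supLin e B hB := by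
  refine le_antisymm (Finset.sup'_le _ _ fun c hc => ?_) ?_
  · obtain ⟨a, ha, b, hb, rfl⟩ := Finset.mem_add.1 hc
    rw [map_add]
    exact add_le_add (Finset.le_sup' _ ha) (Finset.le_sup' _ hb)
  · rw [← le_sub_iff_add_le]
    refine Finset.sup'_le _ _ fun a ha => ?_
    rw [le_sub_comm]
    refine Finset.sup'_le _ _ fun b hb => ?_
    rw [le_sub_iff_add_le', ← map_add]
    exact Finset.le_sup' (Fintype.linearCombination ℝ e) (Finset.add_mem_add ha hb)

theorem supLin_smul {c : ℝ} (hc : 0 < c) :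
    supLin e (c • A) hA.smul_finset = c • supLin e A hA := by
  refine le_antisymm (Finset.sup'_le _ _ fun x hx => ?_) ?_
  · obtain ⟨a, ha, rfl⟩ := Finset.mem_smul_finset.1 hx
    rw [map_smul]
    exact smul_le_smul_of_nonneg_left (Finset.le_sup' _ ha) hc.le
  · rw [← le_inv_smul_iff_of_pos hc]
    refine Finset.sup'_le _ _ fun a ha => ?_
    rw [le_inv_smul_iff_of_pos hc, ← map_smul]
    exact Finset.le_sup' (Fintype.linearCombination ℝ e) (Finset.smul_mem_smul_finset ha)

theorem supLin_smul_vector {c : ℝ} (hc : 0 ≤ c) (t : Fin n → ℝ) :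
    supLin (c • t) A hA = c * supLin t A hA := by
  have h : ∀ a, Fintype.linearCombination ℝ (c • t) a = c * Fintype.linearCombination ℝ t a := by
    intro a
    simp only [Fintype.linearCombination_apply, Pi.smul_apply, smul_eq_mul, Finset.mul_sum]
    exact Finset.sum_congr rfl fun i _ => by ring
  rw [supLin, supLin, Finset.mul₀_sup' hc]
  exact Finset.sup'_congr hA rfl fun a _ => h a

/-- Inequalities between suprema of linear forms that hold in `ℝ` hold in every vector lattice. -/
theorem supLin_le_supLin (h : ∀ t : Fin n → ℝ, supLin t A hA ≤ supLin t B hB) :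
    supLin e A hA ≤ supLin e B hB := by
  refine Finset.sup'_le _ _ fun a ha => ?_
  -- `supLin t` of a set is its support function at t. If a were outside the convex hull of B, a
  -- separating functional would be a vector t at which the support function of A exceeds that of B.
  have hmem : a ∈ convexHull ℝ (B : Set (Fin n → ℝ)) := by
    by_contra hnot
    obtain ⟨f, u, hu, hfa⟩ := geometric_hahn_banach_closed_point (convex_convexHull ℝ _)
      (B.finite_toSet.isClosed_convexHull ℝ) hnot
    have hf : ∀ b, Fintype.linearCombination ℝ (fun i => f (Pi.single i 1)) b = f b := by
      intro b
      conv_rhs => rw [pi_eq_sum_univ' b]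
      simp [Fintype.linearCombination_apply]
    have h1 := h fun i => f (Pi.single i 1)
    have h2 : supLin (fun i => f (Pi.single i 1)) B hB ≤ u :=
      Finset.sup'_le _ _ fun b hb => by
        rw [hf]
        exact (hu b (subset_convexHull ℝ _ hb)).le
    have h3 := Finset.le_sup' (Fintype.linearCombination ℝ fun i => f (Pi.single i 1)) ha
    rw [hf] at h3
    exact absurd (h3.trans (h1.trans h2)) (not_le.2 hfa)
  have hconv : Convex ℝ {x | Fintype.linearCombination ℝ e x ≤ supLin e B hB} := by
    intro x hx y hy s t hs ht hst
    simp only [Set.mem_ofPred_eq, map_add, map_smul] at hx hy ⊢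
    calc _ ≤ s • supLin e B hB + t • supLin e B hB :=
          add_le_add (smul_le_smul_of_nonneg_left hx hs) (smul_le_smul_of_nonneg_left hy ht)
      _ = supLin e B hB := by rw [← add_smul, hst, one_smul]
  exact convexHull_min (fun b hb => Finset.le_sup' (Fintype.linearCombination ℝ e) hb) hconv hmem

theorem supLin_le_supLin_of_sphere
    (h : ∀ t ∈ Metric.sphere (0 : Fin n → ℝ) 1, supLin t A hA ≤ supLin t B hB) :
    supLin e A hA ≤ supLin e B hB := by
  refine supLin_le_supLin e hA hB fun t => ?_
  rcases eq_or_ne t 0 with rfl | ht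
  · have := supLin_smul_vector hA le_rfl (0 : Fin n → ℝ)
    have := supLin_smul_vector hB le_rfl (0 : Fin n → ℝ)
    simp_all
  · have hn : 0 < ‖t‖ := norm_pos_iff.2 ht
    have h1 := h (‖t‖⁻¹ • t) (by simp [norm_smul, hn.ne'])
    rw [supLin_smul_vector hA (inv_nonneg.2 hn.le), supLin_smul_vector hB (inv_nonneg.2 hn.le)] at h1
    exact le_of_mul_le_mul_left h1 (inv_pos.2 hn)

variable (n) in
/-- The finite set whose support function is the maximum norm. -/
def unitVectors : Finset (Fin n → ℝ) :=
  insert 0 (Finset.univ.image (fun i => Pi.single i 1) ∪ Finset.univ.image fun i => Pi.single i (-1))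

variable (n) in
theorem unitVectors_nonempty : (unitVectors n).Nonempty := Finset.insert_nonempty _ _

theorem supLin_unitVectors (t : Fin n → ℝ) :
    supLin t (unitVectors n) (unitVectors_nonempty n) = ‖t‖ := by
  refine le_antisymm (Finset.sup'_le _ _ fun a ha => ?_) ?_
  · simp only [unitVectors, Finset.mem_insert, Finset.mem_union, Finset.mem_image,
      Finset.mem_univ, true_and] at ha
    rcases ha with rfl | ⟨i, rfl⟩ | ⟨i, rfl⟩
    · simp
    · simpa [Fintype.linearCombination_apply_single] using (le_abs_self _).trans (norm_le_pi_norm t i)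
    · simpa [Fintype.linearCombination_apply_single] using (neg_le_abs _).trans (norm_le_pi_norm t i)
  · have key : ∀ a ∈ unitVectors n, Fintype.linearCombination ℝ t a ≤
        supLin t (unitVectors n) (unitVectors_nonempty n) := fun a ha => Finset.le_sup' _ ha
    refine (pi_norm_le_iff_of_nonneg ?_).2 fun i => abs_le'.2 ⟨?_, ?_⟩
    · simpa using key 0 (by simp [unitVectors])
    · simpa [Fintype.linearCombination_apply_single] using
        key (Pi.single i 1) (by simp [unitVectors])
    · simpa [Fintype.linearCombination_apply_single] using
        key (Pi.single i (-1)) (by simp [unitVectors])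

theorem supLin_unitVectors_nonneg : 0 ≤ supLin e (unitVectors n) (unitVectors_nonempty n) := by
  have h : (0 : Fin n → ℝ) ∈ unitVectors n := by simp [unitVectors]
  have := Finset.le_sup' (Fintype.linearCombination ℝ e) h
  rwa [map_zero] at this

/-- The identity that keeps differences of suprema of linear forms closed under ⊔; it is used both
for functions and for their values in E. -/
theorem sub_sup_sub_eq (a b a' b' : F) : (a - b) ⊔ (a' - b') = ((a + b') ⊔ (a' + b)) - (b + b') := by
  rw [sup_sub]
  congr 1 <;> abel

end SupLin

/-! ### Krivine calculus: piecewise linear functions and extension by density -/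

section Krivine

open scoped Pointwise Classical

variable {n : ℕ}

/-- The differences of finite suprema of linear forms, as functions on the unit sphere of `ℝⁿ`. -/
def piecewiseLinear (n : ℕ) : Submodule ℝ C(Metric.sphere (0 : Fin n → ℝ) 1, ℝ) where
  carrier := {g | ∃ (A B : Finset (Fin n → ℝ)) (hA : A.Nonempty) (hB : B.Nonempty),
    ∀ t, g t = supLin t.1 A hA - supLin t.1 B hB}
  add_mem' := by
    rintro f g ⟨A, B, hA, hB, hf⟩ ⟨A', B', hA', hB', hg⟩
    refine ⟨A + A', B + B', hA.add hA', hB.add hB', fun t => ?_⟩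
    rw [supLin_add _ hA hA', supLin_add _ hB hB', ContinuousMap.add_apply, hf, hg]
    ring
  zero_mem' := ⟨{0}, {0}, Finset.singleton_nonempty _, Finset.singleton_nonempty _, fun t => by simp⟩
  smul_mem' := by
    rintro c f ⟨A, B, hA, hB, hf⟩
    rcases lt_trichotomy c 0 with hc | rfl | hc
    · refine ⟨(-c) • B, (-c) • A, hB.smul_finset, hA.smul_finset, fun t => ?_⟩
      rw [supLin_smul _ hA (neg_pos.2 hc), supLin_smul _ hB (neg_pos.2 hc), ContinuousMap.smul_apply,
        hf]
      simp only [smul_eq_mul]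
      ring
    · exact ⟨{0}, {0}, Finset.singleton_nonempty _, Finset.singleton_nonempty _, fun t => by simp⟩
    · refine ⟨c • A, c • B, hA.smul_finset, hB.smul_finset, fun t => ?_⟩
      rw [supLin_smul _ hA hc, supLin_smul _ hB hc, ContinuousMap.smul_apply, hf]
      simp only [smul_eq_mul]
      ring

theorem one_mem_piecewiseLinear : (1 : C(Metric.sphere (0 : Fin n → ℝ) 1, ℝ)) ∈ piecewiseLinear n := by
  refine ⟨unitVectors n, {0}, unitVectors_nonempty n, Finset.singleton_nonempty _, fun t => ?_⟩
  have : ‖t.1‖ = 1 := mem_sphere_zero_iff_norm.1 t.2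
  simp [supLin_unitVectors, supLin_singleton, this]

theorem coord_mem_piecewiseLinear (i : Fin n) :
    (⟨fun t => t.1 i, (continuous_apply i).comp continuous_subtype_val⟩ : C(Metric.sphere (0 : Fin n → ℝ) 1, ℝ)) ∈ piecewiseLinear n :=
  ⟨{Pi.single i 1}, {0}, Finset.singleton_nonempty _, Finset.singleton_nonempty _, fun t => by
    simp [supLin_singleton, Fintype.linearCombination_apply_single]⟩

theorem sup_mem_piecewiseLinear {f g : C(Metric.sphere (0 : Fin n → ℝ) 1, ℝ)}
    (hf : f ∈ piecewiseLinear n) (hg : g ∈ piecewiseLinear n) : f ⊔ g ∈ piecewiseLinear n := by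
  obtain ⟨A, B, hA, hB, hf⟩ := hf
  obtain ⟨A', B', hA', hB', hg⟩ := hg
  refine ⟨(A + B') ∪ (A' + B), B + B', (hA.add hB').mono Finset.subset_union_left, hB.add hB',
    fun t => ?_⟩
  rw [supLin_union _ (hA.add hB') (hA'.add hB), supLin_add _ hA hB', supLin_add _ hA' hB,
    supLin_add _ hB hB', ContinuousMap.sup_apply, hf, hg, sub_sup_sub_eq]

/-- Lattice form of Stone–Weierstrass. Two distinct points of the sphere differ in some coordinate,
so an affine expression in that coordinate interpolates any two values; the constant 1 is available
because the maximum norm is a supremum of linear forms. -/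
theorem closure_piecewiseLinear :
    closure (piecewiseLinear n : Set C(Metric.sphere (0 : Fin n → ℝ) 1, ℝ)) = ⊤ := by
  refine ContinuousMap.sublattice_closure_eq_top _ ⟨0, zero_mem _⟩ (fun f hf g hg => ?_)
    (fun f hf g hg => sup_mem_piecewiseLinear hf hg) ?_
  · have h := neg_mem (sup_mem_piecewiseLinear (neg_mem hf) (neg_mem hg))
    have : f ⊓ g = -(-f ⊔ -g) := by
      ext t
      simp [max_neg_neg]
    rwa [this]
  · intro v x y
    by_cases hxy : x = y
    · subst hxy
      exact ⟨v x • 1, (piecewiseLinear n).smul_mem _ one_mem_piecewiseLinear, by simp⟩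
    · obtain ⟨i, hi⟩ : ∃ i, x.1 i ≠ y.1 i := by
        by_contra! h
        exact hxy (Subtype.ext (funext h))
      have hi' : x.1 i - y.1 i ≠ 0 := sub_ne_zero.2 hi
      refine ⟨((v x - v y) / (x.1 i - y.1 i)) • (⟨fun t => t.1 i, (continuous_apply i).comp continuous_subtype_val⟩ :
        C(Metric.sphere (0 : Fin n → ℝ) 1, ℝ)) +
        (v y - (v x - v y) / (x.1 i - y.1 i) * y.1 i) • 1, (piecewiseLinear n).add_mem
          ((piecewiseLinear n).smul_mem _ (coord_mem_piecewiseLinear i))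
          ((piecewiseLinear n).smul_mem _ one_mem_piecewiseLinear), ?_, ?_⟩
      · simp
        field_simp
        ring
      · simp

variable {E : Type*} [NormedAddCommGroup E] [NormedSpace ℝ E]
  [Lattice E] [IsOrderedAddMonoid E] [IsOrderedModule ℝ E] [HasSolidNorm E]

/-- The value in `E` of a difference of finite suprema of linear forms. -/
def piecewiseLinearValue (e : Fin n → E) (g : piecewiseLinear n) : E :=
  supLin e g.2.choose g.2.choose_spec.choose_spec.choose -
    supLin e g.2.choose_spec.choose g.2.choose_spec.choose_spec.choose_spec.choose

/-- Moving the subtracted terms across reduces to suprema over Minkowski sums, for which scalar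
inequalities transfer to E. Applied in both directions, it shows that the value in E does not depend
on the chosen representation. -/
theorem value_le_of_le (e : Fin n → E) {A B A' B' : Finset (Fin n → ℝ)} (hA : A.Nonempty)
    (hB : B.Nonempty) (hA' : A'.Nonempty) (hB' : B'.Nonempty)
    (h : ∀ t ∈ Metric.sphere (0 : Fin n → ℝ) 1,
      supLin t A hA - supLin t B hB ≤ supLin t A' hA' - supLin t B' hB') :
    supLin e A hA - supLin e B hB ≤ supLin e A' hA' - supLin e B' hB' := by
  rw [sub_le_sub_iff, ← supLin_add, ← supLin_add]
  refine supLin_le_supLin_of_sphere _ _ _ fun t ht => ?_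
  rw [supLin_add, supLin_add, ← sub_le_sub_iff]
  exact h t ht

theorem piecewiseLinearValue_eq (e : Fin n → E) (g : piecewiseLinear n)
    {A B : Finset (Fin n → ℝ)} (hA : A.Nonempty) (hB : B.Nonempty)
    (h : ∀ t, g.1 t = supLin t.1 A hA - supLin t.1 B hB) :
    piecewiseLinearValue e g = supLin e A hA - supLin e B hB := by
  have h' := g.2.choose_spec.choose_spec.choose_spec.choose_spec
  exact le_antisymm (value_le_of_le e _ _ _ _ fun t ht => ((h' ⟨t, ht⟩).symm.trans (h ⟨t, ht⟩)).le)
    (value_le_of_le e _ _ _ _ fun t ht => ((h' ⟨t, ht⟩).symm.trans (h ⟨t, ht⟩)).ge)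

/-- `piecewiseLinearValue` as a linear map. -/
def piecewiseLinearMap (e : Fin n → E) : piecewiseLinear n →ₗ[ℝ] E where
  toFun := piecewiseLinearValue e
  map_add' := by
    rintro ⟨f, A, B, hA, hB, hf⟩ ⟨g, A', B', hA', hB', hg⟩
    rw [piecewiseLinearValue_eq e ⟨f, A, B, hA, hB, hf⟩ hA hB hf, piecewiseLinearValue_eq e ⟨g, A', B', hA', hB', hg⟩ hA' hB' hg,
      piecewiseLinearValue_eq e _ (hA.add hA') (hB.add hB'),
      supLin_add _ hA hA', supLin_add _ hB hB']
    · abel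
    · intro t
      rw [supLin_add _ hA hA', supLin_add _ hB hB']
      change f t + g t = _
      rw [hf, hg]
      ring
  map_smul' := by
    rintro c ⟨f, A, B, hA, hB, hf⟩
    rw [piecewiseLinearValue_eq e ⟨f, A, B, hA, hB, hf⟩ hA hB hf, RingHom.id_apply]
    rcases lt_trichotomy c 0 with hc | rfl | hc
    · rw [piecewiseLinearValue_eq e _ (hB.smul_finset (a := -c)) (hA.smul_finset (a := -c)),
        supLin_smul _ hA (neg_pos.2 hc), supLin_smul _ hB (neg_pos.2 hc)]
      · module
      · intro t
        rw [supLin_smul _ hA (neg_pos.2 hc), supLin_smul _ hB (neg_pos.2 hc)]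
        change c * f t = _
        rw [hf]
        simp only [smul_eq_mul]
        ring
    · rw [piecewiseLinearValue_eq e _ (Finset.singleton_nonempty 0) (Finset.singleton_nonempty 0)]
      · simp
      · intro t
        simp
    · rw [piecewiseLinearValue_eq e _ (hA.smul_finset (a := c)) (hB.smul_finset (a := c)),
        supLin_smul _ hA hc, supLin_smul _ hB hc]
      · module
      · intro t
        rw [supLin_smul _ hA hc, supLin_smul _ hB hc]
        change c * f t = _
        rw [hf]
        simp only [smul_eq_mul]
        ring

/-- On the sphere |g| ≤ c is an inequality between piecewise linear functions, because c is c times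
the maximum norm. It transfers to E as |value| ≤ c • u, with u the supremum of 0 and all ±eᵢ. -/
theorem norm_piecewiseLinearMap_le (e : Fin n → E) (g : piecewiseLinear n) :
    ‖piecewiseLinearMap e g‖ ≤ ‖supLin e (unitVectors n) (unitVectors_nonempty n)‖ * ‖g‖ := by
  obtain ⟨f, A, B, hA, hB, hf⟩ := g
  have hval : piecewiseLinearMap e ⟨f, A, B, hA, hB, hf⟩ = supLin e A hA - supLin e B hB :=
    piecewiseLinearValue_eq e ⟨f, A, B, hA, hB, hf⟩ hA hB hf
  set u := supLin e (unitVectors n) (unitVectors_nonempty n)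
  have hu : 0 ≤ u := supLin_unitVectors_nonneg e
  have hbound : ∀ c : ℝ, 0 < c → ‖f‖ ≤ c → |supLin e A hA - supLin e B hB| ≤ c • u := by
    intro c hc hfc
    have hc' : (c • unitVectors n).Nonempty := (unitVectors_nonempty n).smul_finset
    have hab : ∀ t ∈ Metric.sphere (0 : Fin n → ℝ) 1, |supLin t A hA - supLin t B hB| ≤
        supLin t (c • unitVectors n) (unitVectors_nonempty n).smul_finset := by
      intro t ht
      rw [supLin_smul _ (unitVectors_nonempty n) hc, supLin_unitVectors, ← hf ⟨t, ht⟩, mem_sphere_zero_iff_norm.1 ht,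
        smul_eq_mul, mul_one]
      exact (f.norm_coe_le_norm _).trans hfc
    rw [abs_le', ← supLin_smul _ (unitVectors_nonempty n) hc]
    constructor
    · rw [sub_le_iff_le_add, ← supLin_add _ hc' hB]
      refine supLin_le_supLin_of_sphere _ _ _ fun t ht => ?_
      rw [supLin_add _ hc' hB, ← sub_le_iff_le_add]
      exact (le_abs_self _).trans (hab t ht)
    · rw [neg_sub, sub_le_iff_le_add, ← supLin_add _ hc' hA]
      refine supLin_le_supLin_of_sphere _ _ _ fun t ht => ?_
      rw [supLin_add _ hc' hA, ← sub_le_iff_le_add, ← neg_sub]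
      exact (neg_le_abs _).trans (hab t ht)
  rw [hval]
  refine le_of_forall_pos_le_add fun ε hε => ?_
  -- `hbound` requires c > 0, whereas ‖f‖ may vanish; this slack costs at most ε after
  -- multiplication by ‖u‖.
  have hpos : 0 < ε / (‖u‖ + 1) := by positivity
  have h1 := hbound (‖f‖ + ε / (‖u‖ + 1)) (by positivity) (by linarith)
  have h2 : ‖supLin e A hA - supLin e B hB‖ ≤ ‖(‖f‖ + ε / (‖u‖ + 1)) • u‖ :=
    norm_le_norm_of_abs_le_abs (h1.trans (le_abs_self _))
  refine h2.trans ?_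
  rw [norm_smul, Real.norm_of_nonneg (by positivity)]
  have h3 : ε / (‖u‖ + 1) * ‖u‖ ≤ ε := by
    rw [div_mul_eq_mul_div, div_le_iff₀ (by positivity)]
    nlinarith [norm_nonneg u]
  change _ ≤ ‖u‖ * ‖f‖ + ε
  linarith

/-- The restriction of homogeneous functions to the unit sphere. -/
def homogeneousRestrict (n : ℕ) :
    homogeneousFunctions n →ₗ[ℝ] C(Metric.sphere (0 : Fin n → ℝ) 1, ℝ) where
  toFun f := f.1.restrict _
  map_add' _ _ := rfl
  map_smul' _ _ := rfl

/-- Makes ⊔ continuous on C(X, ℝ), as needed to extend the lattice homomorphism property by density.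
-/
instance hasSolidNorm_continuousMap (X : Type*) [TopologicalSpace X] [CompactSpace X] :
    HasSolidNorm C(X, ℝ) where
  solid f g h := (ContinuousMap.norm_le _ (norm_nonneg g)).2 fun x => by
    have h1 : |f x| ≤ |g x| := h x
    exact h1.trans (g.norm_coe_le_norm x)

/-- The bounded linear map on piecewise linear functions extends to all continuous functions on the
sphere. Preservation of ⊔ is a closed condition, so it survives the extension; composing with
restriction to the sphere gives τ. -/
theorem exists_isKrivineCalculus [CompleteSpace E] (e : Fin n → E) :
    ∃ τ : homogeneousFunctions n →ₗ[ℝ] E, IsKrivineCalculus e τ := by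
  set φ : piecewiseLinear n →L[ℝ] E := (piecewiseLinearMap e).mkContinuous
    ‖supLin e (unitVectors n) (unitVectors_nonempty n)‖ (norm_piecewiseLinearMap_le e) with hφ
  have hdense : DenseRange (piecewiseLinear n).subtypeL := by
    rw [DenseRange, dense_iff_closure_eq]
    simpa using closure_piecewiseLinear (n := n)
  have hind : IsUniformInducing (piecewiseLinear n).subtypeL :=
    isUniformEmbedding_subtype_val.isUniformInducing
  set ψ := φ.extend (piecewiseLinear n).subtypeL
  have hψc : Continuous ψ := ψ.continuous
  have hψ : ∀ g : piecewiseLinear n, ψ g.1 = piecewiseLinearValue e g := fun g =>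
    φ.extend_eq hdense hind g
  have hsup : ∀ f g, ψ (f ⊔ g) = ψ f ⊔ ψ g := by
    intro f g
    refine hdense.induction_on₂ (p := fun f g => ψ (f ⊔ g) = ψ f ⊔ ψ g)
      (isClosed_eq (hψc.comp continuous_sup)
        ((hψc.comp continuous_fst).sup (hψc.comp continuous_snd))) ?_ f g
    rintro ⟨f, A, B, hA, hB, hf⟩ ⟨g, A', B', hA', hB', hg⟩
    have h := hψ ⟨f ⊔ g, sup_mem_piecewiseLinear ⟨A, B, hA, hB, hf⟩ ⟨A', B', hA', hB', hg⟩⟩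
    change ψ (f ⊔ g) = ψ f ⊔ ψ g
    rw [h, hψ ⟨f, A, B, hA, hB, hf⟩, hψ ⟨g, A', B', hA', hB', hg⟩,
      piecewiseLinearValue_eq e ⟨f, A, B, hA, hB, hf⟩ hA hB hf, piecewiseLinearValue_eq e ⟨g, A', B', hA', hB', hg⟩ hA' hB' hg, sub_sup_sub_eq,
      piecewiseLinearValue_eq e _ ((hA.add hB').mono Finset.subset_union_left) (hB.add hB'),
      supLin_union _ (hA.add hB') (hA'.add hB), supLin_add _ hA hB', supLin_add _ hA' hB,
      supLin_add _ hB hB']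
    intro t
    rw [supLin_union _ (hA.add hB') (hA'.add hB), supLin_add _ hA hB', supLin_add _ hA' hB,
      supLin_add _ hB hB', ContinuousMap.sup_apply, hf, hg, sub_sup_sub_eq]
  refine ⟨ψ.toLinearMap ∘ₗ homogeneousRestrict n, fun i => ?_, fun f g =>
    hsup (homogeneousRestrict n f) (homogeneousRestrict n g)⟩
  have h := hψ ⟨_, coord_mem_piecewiseLinear i⟩
  rw [piecewiseLinearValue_eq e _ (Finset.singleton_nonempty (Pi.single i 1))
    (Finset.singleton_nonempty 0)] at h
  · refine Eq.trans ?_ (h.trans ?_)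
    · rfl
    · simp [supLin_singleton, Fintype.linearCombination_apply_single]
  · intro t
    simp [supLin_singleton, Fintype.linearCombination_apply_single]

end Krivine

/-! ### Power sums as averages of maxima -/

/-- Independence of the coordinates of a uniformly distributed ω in Fin n → Fin N. -/
theorem average_prod (n N : ℕ) (G : Fin n → Fin N → ℝ) :
    ((N : ℝ) ^ n)⁻¹ * ∑ ω : Fin n → Fin N, ∏ k, G k (ω k) = ∏ k, ((N : ℝ)⁻¹ * ∑ i, G k i) := by
  rw [Finset.prod_mul_distrib, Finset.prod_const, Finset.card_univ, Fintype.card_fin, inv_pow,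
    Finset.prod_univ_sum, Fintype.piFinset_univ]

theorem average_marginal {n N : ℕ} (hN : N ≠ 0) (k : Fin n) (F : Fin N → ℝ) :
    ((N : ℝ) ^ n)⁻¹ * ∑ ω : Fin n → Fin N, F (ω k) = (N : ℝ)⁻¹ * ∑ i, F i := by
  have h := average_prod n N fun j i => if j = k then F i else 1
  have h1 : ∀ ω : Fin n → Fin N, ∏ j, (if j = k then F (ω j) else 1) = F (ω k) := fun ω => by simp
  have h2 : ∀ j : Fin n, (N : ℝ)⁻¹ * ∑ i, (if j = k then F i else 1) =
      if j = k then (N : ℝ)⁻¹ * ∑ i, F i else 1 := by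
    intro j
    split_ifs
    · rfl
    · simp [hN]
  simp only [h1, h2, Finset.prod_ite_eq', Finset.mem_univ, if_true] at h
  exact h

/-- The values of a discretised Fréchet distribution with exponent `r`. -/
def frechetValue (r : ℝ) {N : ℕ} (i : Fin N) : ℝ :=
  ((N : ℝ) / ((i : ℕ) + 1)) ^ (1 / r)

theorem frechetValue_nonneg (r : ℝ) {N : ℕ} (i : Fin N) : 0 ≤ frechetValue r i := by
  unfold frechetValue
  positivity

theorem card_filter_add_one_le {N : ℕ} {y : ℝ} (hy : y ≤ N) :
    y - 1 ≤ ((Finset.univ.filter fun i : Fin N => ((i : ℕ) : ℝ) + 1 ≤ y).card : ℝ) := by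
  have h1 : (Finset.univ.filter fun i : Fin N => (i : ℕ) < ⌊y⌋₊) ⊆
      Finset.univ.filter fun i : Fin N => ((i : ℕ) : ℝ) + 1 ≤ y := by
    intro i hi
    simp only [Finset.mem_filter, Finset.mem_univ, true_and] at hi ⊢
    have h2 : ((i : ℕ) + 1) ≤ ⌊y⌋₊ := hi
    have h3 := (Nat.le_floor_iff' (Nat.succ_ne_zero _)).1 h2
    exact_mod_cast h3
  have h2 : (Finset.univ.filter fun i : Fin N => (i : ℕ) < ⌊y⌋₊).card = ⌊y⌋₊ := by
    have : ⌊y⌋₊ ≤ N := Nat.floor_le_of_le hy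
    rw [Fin.card_filter_val_lt]
    omega
  have h3 : (⌊y⌋₊ : ℝ) ≤ ((Finset.univ.filter fun i : Fin N => ((i : ℕ) : ℝ) + 1 ≤ y).card : ℝ) := by
    rw [← h2]
    exact_mod_cast Finset.card_le_card h1
  linarith [Nat.lt_floor_add_one y]

/-- Let s be the ℓ^r norm of a. The event that the k-th weighted coordinate reaches s has
probability at least a_k^r / s^r - 1/N. By independence all coordinates stay below s with
probability at most exp(n/N - 1) ≤ 2/3, so the maximum has mean at least s/3. Any majorant H of the
maximum serves. -/
theorem powerSum_le_average {n N : ℕ} (hN : 2 * n + 1 = N) {r : ℝ} (hr : 1 < r) (a : Fin n → ℝ)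
    (ha : ∀ k, 0 ≤ a k) (H : (Fin n → Fin N) → ℝ) (hH0 : ∀ ω, 0 ≤ H ω)
    (hH : ∀ ω k, frechetValue r (ω k) * a k ≤ H ω) :
    (∑ k, a k ^ r) ^ (1 / r) ≤ 3 * (((N : ℝ) ^ n)⁻¹ * ∑ ω, H ω) := by
  have hr0 : 0 < r := by linarith
  have hN0 : (0 : ℝ) < N := by
    rw [← hN]
    positivity
  set T := ∑ k, a k ^ r with hT
  have hT0 : 0 ≤ T := Finset.sum_nonneg fun k _ => Real.rpow_nonneg (ha k) _
  set s := T ^ (1 / r) with hs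
  have hs0 : 0 ≤ s := Real.rpow_nonneg hT0 _
  have hsr : s ^ r = T := by
    rw [hs, ← Real.rpow_mul hT0, one_div_mul_cancel hr0.ne', Real.rpow_one]
  have havg : 0 ≤ ((N : ℝ) ^ n)⁻¹ := by positivity
  rcases hs0.eq_or_lt with h0 | hspos
  · rw [← h0]
    exact mul_nonneg (by norm_num) (mul_nonneg havg (Finset.sum_nonneg fun ω _ => hH0 ω))
  have hTpos : 0 < T := by
    rw [← hsr]
    positivity
  -- For the index i, frechetValue r i * a k ≥ s amounts to i + 1 ≤ y k; G k is the indicator that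
  -- this fails.
  set y : Fin n → ℝ := fun k => N * a k ^ r / T with hy
  have hyN : ∀ k, y k ≤ N := by
    intro k
    rw [hy]
    simp only
    rw [div_le_iff₀ hTpos]
    exact mul_le_mul_of_nonneg_left (Finset.single_le_sum (f := fun k => a k ^ r)
      (fun k _ => Real.rpow_nonneg (ha k) _) (Finset.mem_univ k)) hN0.le
  set G : Fin n → Fin N → ℝ := fun k i => if ((i : ℕ) : ℝ) + 1 ≤ y k then 0 else 1 with hG
  have hG0 : ∀ k i, 0 ≤ G k i := by
    intro k i
    simp only [hG]
    split_ifs <;> norm_num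
  have hlow : ∀ ω, s * (1 - ∏ k, G k (ω k)) ≤ H ω := by
    intro ω
    by_cases hex : ∃ k, G k (ω k) = 0
    · obtain ⟨k, hk⟩ := hex
      rw [Finset.prod_eq_zero (Finset.mem_univ k) hk, sub_zero, mul_one]
      refine le_trans ?_ (hH ω k)
      have hk' : (((ω k : ℕ) : ℝ) + 1) ≤ N * a k ^ r / T := by
        by_contra hnot
        simp only [hG] at hk
        rw [if_neg hnot] at hk
        exact one_ne_zero hk
      rw [le_div_iff₀ hTpos] at hk'
      have h1 : T ≤ (N : ℝ) / ((ω k : ℕ) + 1) * a k ^ r := by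
        rw [div_mul_eq_mul_div, le_div_iff₀ (by positivity)]
        linarith
      have h2 := Real.rpow_le_rpow hT0 h1 (by positivity : 0 ≤ 1 / r)
      rwa [Real.mul_rpow (by positivity) (Real.rpow_nonneg (ha k) _), ← Real.rpow_mul (ha k),
        mul_one_div_cancel hr0.ne', Real.rpow_one] at h2
    · push Not at hex
      have : ∏ k, G k (ω k) = 1 := Finset.prod_eq_one fun k _ => by
        have := hex k
        simp only [hG] at this ⊢
        split_ifs with h
        · exact absurd (if_pos h) this
        · rfl
      rw [this, sub_self, mul_zero]
      exact hH0 ω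
  have hprod : ((N : ℝ) ^ n)⁻¹ * ∑ ω : Fin n → Fin N, ∏ k, G k (ω k) ≤ 2 / 3 := by
    rw [average_prod]
    have h1 : ∀ k, (N : ℝ)⁻¹ * ∑ i, G k i ≤ Real.exp (1 / N - a k ^ r / T) := by
      intro k
      have h2 : ∑ i, G k i = N -
          ((Finset.univ.filter fun i : Fin N => ((i : ℕ) : ℝ) + 1 ≤ y k).card : ℝ) := by
        have h3 : ∀ i, G k i = 1 - if ((i : ℕ) : ℝ) + 1 ≤ y k then (1 : ℝ) else 0 := by
          intro i
          simp only [hG]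
          split_ifs <;> norm_num
        simp only [h3, Finset.sum_sub_distrib, Finset.sum_boole]
        simp
      have h3 := card_filter_add_one_le (hyN k)
      have h4 : (N : ℝ)⁻¹ * ∑ i, G k i ≤ 1 / N - a k ^ r / T + 1 := by
        rw [h2, inv_mul_le_iff₀ hN0]
        have h5 : (N : ℝ) * (1 / N - a k ^ r / T + 1) = 1 - y k + N := by
          simp only [hy]
          field_simp
        rw [h5]
        linarith
      exact h4.trans (Real.add_one_le_exp _)
    refine (Finset.prod_le_prod (fun k _ => mul_nonneg (by positivity)
      (Finset.sum_nonneg fun i _ => hG0 k i)) fun k _ => h1 k).trans ?_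
    have h5 : ∑ k, a k ^ r / T = 1 := by rw [← Finset.sum_div, ← hT, div_self hTpos.ne']
    rw [← Real.exp_sum, Finset.sum_sub_distrib, h5]
    -- The total rounding error n/N is what dictates the choice N = 2n + 1.
    have h6 : ∑ _k : Fin n, (1 / N : ℝ) ≤ 1 / 2 := by
      rw [Finset.sum_const, Finset.card_univ, Fintype.card_fin, nsmul_eq_mul, mul_one_div,
        div_le_iff₀ hN0, ← hN]
      push_cast
      linarith
    have h7 : Real.exp (∑ _k : Fin n, (1 / N : ℝ) - 1) ≤ Real.exp (-(1 / 2)) :=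
      Real.exp_le_exp.2 (by linarith)
    refine h7.trans ?_
    rw [Real.exp_neg, inv_le_comm₀ (Real.exp_pos _) (by norm_num)]
    have := Real.add_one_le_exp (1 / 2 : ℝ)
    linarith
  have hsum : ((N : ℝ) ^ n)⁻¹ * ∑ ω : Fin n → Fin N, s * (1 - ∏ k, G k (ω k)) =
      s * (1 - ((N : ℝ) ^ n)⁻¹ * ∑ ω : Fin n → Fin N, ∏ k, G k (ω k)) := by
    rw [← Finset.mul_sum, Finset.sum_sub_distrib]
    simp only [Finset.sum_const, Finset.card_univ, Fintype.card_pi, Fintype.card_fin,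
      Finset.prod_const, nsmul_eq_mul, mul_one, Nat.cast_pow]
    have : (N : ℝ) ^ n ≠ 0 := by positivity
    field_simp
  have h8 : ((N : ℝ) ^ n)⁻¹ * ∑ ω : Fin n → Fin N, s * (1 - ∏ k, G k (ω k)) ≤
      ((N : ℝ) ^ n)⁻¹ * ∑ ω, H ω :=
    mul_le_mul_of_nonneg_left (Finset.sum_le_sum fun ω _ => hlow ω) havg
  rw [hsum] at h8
  nlinarith

/-! ### Truncated moments of the discretised Fréchet distribution -/

theorem sum_range_rpow_neg_le {s : ℝ} (hs0 : 0 < s) (hs : s < 1) (m : ℕ) :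
    ∑ i ∈ Finset.range m, ((i : ℝ) + 1) ^ (-s) ≤ (m : ℝ) ^ (1 - s) / (1 - s) := by
  have hs' : 0 < 1 - s := by linarith
  induction m with
  | zero => simp [Real.zero_rpow hs'.ne']
  | succ m ih =>
    rw [Finset.sum_range_succ]
    push_cast
    have hm : (0 : ℝ) < (m : ℝ) + 1 := by positivity
    have h1 : (-1 : ℝ) ≤ -(1 / ((m : ℝ) + 1)) := by
      rw [neg_le_neg_iff, div_le_one hm]
      linarith [(Nat.cast_nonneg m : (0 : ℝ) ≤ m)]
    have h2 := rpow_one_add_le_one_add_mul_self h1 hs'.le (by linarith : 1 - s ≤ 1)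
    have h3 : (m : ℝ) ^ (1 - s) ≤ ((m : ℝ) + 1) ^ (1 - s) - (1 - s) * ((m : ℝ) + 1) ^ (-s) := by
      have h4 : (m : ℝ) = ((m : ℝ) + 1) * (1 + -(1 / ((m : ℝ) + 1))) := by
        field_simp
        ring
      have h5 : ((m : ℝ) + 1) ^ (-s) = ((m : ℝ) + 1) ^ (1 - s) / ((m : ℝ) + 1) := by
        rw [show -s = (1 - s) - 1 by ring, Real.rpow_sub_one hm.ne']
      conv_lhs => rw [h4]
      rw [Real.mul_rpow hm.le (by linarith), h5]
      refine (mul_le_mul_of_nonneg_left h2 (Real.rpow_nonneg hm.le _)).trans (le_of_eq ?_)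
      field_simp
      ring
    have h6 : (m : ℝ) ^ (1 - s) / (1 - s) ≤
        ((m : ℝ) + 1) ^ (1 - s) / (1 - s) - ((m : ℝ) + 1) ^ (-s) := by
      rw [div_le_iff₀ hs', sub_mul, div_mul_cancel₀ _ hs'.ne']
      linarith
    linarith

/-- Telescoping: each term is compared with a difference of consecutive values of z^(-u). The factor
2^(u+1) pays for replacing z + 1 by z, using z ≥ 1. -/
theorem sum_Ico_rpow_neg_le {u : ℝ} (hu : 0 < u) (m N : ℕ) :
    ∑ i ∈ Finset.Ico m N, ((i : ℝ) + 1) ^ (-(u + 1)) ≤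
      2 ^ (u + 1) / u * ((m : ℝ) + 1) ^ (-u) := by
  have hstep : ∀ i : ℕ, ((i : ℝ) + 1) ^ (-(u + 1)) ≤
      2 ^ (u + 1) / u * (((i : ℝ) + 1) ^ (-u) - (((i + 1 : ℕ) : ℝ) + 1) ^ (-u)) := by
    intro i
    set z : ℝ := (i : ℝ) + 1 with hz
    have hz1 : 1 ≤ z := by
      rw [hz]
      linarith [(Nat.cast_nonneg i : (0 : ℝ) ≤ i)]
    have hz0 : 0 < z := by linarith
    have hcast : (((i + 1 : ℕ) : ℝ) + 1) = z + 1 := by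
      rw [hz]
      push_cast
      ring
    rw [hcast]
    have h1 : 1 + u / (z + 1) ≤ (z / (z + 1)) ^ (-u) := by
      have hpos : 0 < z / (z + 1) := by positivity
      rw [Real.rpow_def_of_pos hpos]
      refine le_trans ?_ (Real.add_one_le_exp _)
      have h2 := Real.log_le_sub_one_of_pos hpos
      have h3 : z / (z + 1) - 1 = -(1 / (z + 1)) := by
        field_simp
        ring
      rw [h3] at h2
      have h4 : u / (z + 1) = u * (1 / (z + 1)) := by ring
      rw [h4]
      nlinarith
    have h2 : (z + 1) ^ (-u) * (1 + u / (z + 1)) ≤ z ^ (-u) := by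
      rw [Real.div_rpow hz0.le (by positivity), le_div_iff₀ (by positivity)] at h1
      linarith
    have h3 : u * (z + 1) ^ (-(u + 1)) ≤ z ^ (-u) - (z + 1) ^ (-u) := by
      rw [show -(u + 1) = -u - 1 by ring, Real.rpow_sub_one (by positivity)]
      have : (z + 1) ^ (-u) * (1 + u / (z + 1)) =
        (z + 1) ^ (-u) + u * ((z + 1) ^ (-u) / (z + 1)) := by ring
      linarith
    have h4 : z ^ (-(u + 1)) ≤ 2 ^ (u + 1) * (z + 1) ^ (-(u + 1)) := by
      have h5 : (2 * z) ^ (-(u + 1)) ≤ (z + 1) ^ (-(u + 1)) :=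
        Real.rpow_le_rpow_of_nonpos (by positivity) (by linarith) (by linarith)
      rw [Real.mul_rpow (by norm_num) hz0.le, Real.rpow_neg (by norm_num),
        inv_mul_le_iff₀ (by positivity)] at h5
      exact h5
    have h6 : 2 ^ (u + 1) / u * (u * (z + 1) ^ (-(u + 1))) ≤
        2 ^ (u + 1) / u * (z ^ (-u) - (z + 1) ^ (-u)) :=
      mul_le_mul_of_nonneg_left h3 (by positivity)
    refine h4.trans (le_trans (le_of_eq ?_) h6)
    field_simp
  rcases le_total N m with h | h
  · rw [Finset.Ico_eq_empty_of_le h, Finset.sum_empty]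
    positivity
  · refine (Finset.sum_le_sum fun i _ => hstep i).trans ?_
    have hsum : ∑ i ∈ Finset.Ico m N, (((i : ℝ) + 1) ^ (-u) - (((i + 1 : ℕ) : ℝ) + 1) ^ (-u)) =
        ((m : ℝ) + 1) ^ (-u) - ((N : ℝ) + 1) ^ (-u) := by
      have := Finset.sum_Ico_sub (fun i : ℕ => -((i : ℝ) + 1) ^ (-u)) h
      simp only [sub_neg_eq_add, neg_add_eq_sub] at this
      exact this
    rw [← Finset.mul_sum, hsum]
    refine mul_le_mul_of_nonneg_left ?_ (by positivity)
    have : (0 : ℝ) ≤ ((N : ℝ) + 1) ^ (-u) := by positivity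
    linarith

theorem frechetValue_mul {r : ℝ} (hr : 0 < r) {N : ℕ} (i : Fin N) {b : ℝ} (hb : 0 ≤ b) :
    frechetValue r i * b = (N * b ^ r / ((i : ℕ) + 1)) ^ (1 / r) := by
  have h1 : (b ^ r) ^ (1 / r) = b := by
    rw [← Real.rpow_mul hb, mul_one_div_cancel hr.ne', Real.rpow_one]
  rw [mul_div_right_comm, Real.mul_rpow (by positivity) (Real.rpow_nonneg hb _), h1, frechetValue]

theorem frechetValue_mul_le_one_iff {r : ℝ} (hr : 0 < r) {N : ℕ} (i : Fin N) {b : ℝ}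
    (hb : 0 ≤ b) : frechetValue r i * b ≤ 1 ↔ N * b ^ r ≤ (i : ℕ) + 1 := by
  have h0 : (0 : ℝ) ≤ N * b ^ r / ((i : ℕ) + 1) := by positivity
  have h1 := Real.rpow_le_rpow_iff h0 zero_le_one (by positivity : 0 < 1 / r)
  rw [Real.one_rpow, div_le_one (by positivity)] at h1
  rw [frechetValue_mul hr i hb, h1]

/-- The product exceeds 1 exactly for i + 1 < x = N b^r, so the sum is at most x^(1/r) times a
partial sum of (i+1)^(-1/r). That partial sum is of order x^(1 - 1/r) because r > 1. -/
theorem average_large_frechetValue_le {r : ℝ} (hr : 1 < r) {N : ℕ} (hN : 0 < N) {b : ℝ}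
    (hb : 0 ≤ b) :
    (N : ℝ)⁻¹ * ∑ i : Fin N, (if frechetValue r i * b ≤ 1 then 0 else frechetValue r i * b) ≤
      1 / (1 - 1 / r) * b ^ r := by
  have hr0 : 0 < r := by linarith
  have hs0 : 0 < 1 / r := by positivity
  have hs1 : 1 / r < 1 := by rwa [div_lt_one hr0]
  have hNr : (0 : ℝ) < N := by exact_mod_cast hN
  set x : ℝ := N * b ^ r with hx
  have hx0 : 0 ≤ x := by positivity
  have hterm : ∀ i : Fin N, (if frechetValue r i * b ≤ 1 then 0 else frechetValue r i * b) ≤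
      (fun j : ℕ => if j < ⌊x⌋₊ then x ^ (1 / r) * ((j : ℝ) + 1) ^ (-(1 / r)) else 0) i := by
    intro i
    simp only [frechetValue_mul_le_one_iff hr0 i hb]
    by_cases h : N * b ^ r ≤ (i : ℕ) + 1
    · rw [if_pos h]
      split_ifs
      · positivity
      · exact le_rfl
    · have h' : (i : ℕ) < ⌊x⌋₊ := by
        rw [← Nat.succ_le_iff, Nat.le_floor_iff hx0]
        push_cast
        linarith
      rw [if_neg h, if_pos h', frechetValue_mul hr0 i hb, Real.div_rpow hx0 (by positivity),
        Real.rpow_neg (by positivity), div_eq_mul_inv]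
  have hsum : ∑ i : Fin N, (if frechetValue r i * b ≤ 1 then 0 else frechetValue r i * b) ≤
      1 / (1 - 1 / r) * x := by
    refine (Finset.sum_le_sum fun i _ => hterm i).trans ?_
    rw [Fin.sum_univ_eq_sum_range
      (fun j : ℕ => if j < ⌊x⌋₊ then x ^ (1 / r) * ((j : ℝ) + 1) ^ (-(1 / r)) else 0),
      ← Finset.sum_filter]
    have hsub : (Finset.range N).filter (fun j => j < ⌊x⌋₊) ⊆ Finset.range ⌊x⌋₊ := by
      intro j hj
      exact Finset.mem_range.2 (Finset.mem_filter.1 hj).2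
    refine (Finset.sum_le_sum_of_subset_of_nonneg hsub fun j _ _ => by positivity).trans ?_
    rw [← Finset.mul_sum]
    have h1 := sum_range_rpow_neg_le hs0 hs1 ⌊x⌋₊
    have h2 : (⌊x⌋₊ : ℝ) ^ (1 - 1 / r) ≤ x ^ (1 - 1 / r) :=
      Real.rpow_le_rpow (by positivity) (Nat.floor_le hx0) (by linarith)
    have h3 : x ^ (1 / r) * x ^ (1 - 1 / r) = x := by
      rw [← Real.rpow_add' hx0 (by simp), add_sub_cancel, Real.rpow_one]
    calc _ ≤ x ^ (1 / r) * (x ^ (1 - 1 / r) / (1 - 1 / r)) := by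
          refine mul_le_mul_of_nonneg_left (h1.trans ?_) (by positivity)
          exact div_le_div_of_nonneg_right h2 (by linarith)
      _ = 1 / (1 - 1 / r) * (x ^ (1 / r) * x ^ (1 - 1 / r)) := by ring
      _ = _ := by rw [h3]
  rw [inv_mul_le_iff₀ hNr]
  refine hsum.trans (le_of_eq ?_)
  rw [hx]
  ring

/-- Complementary range i + 1 ≥ x, where the q-th powers form the tail of a series with exponent q/r
> 1. The strict inequality r < q makes it converge. -/
theorem average_small_frechetValue_le {r q : ℝ} (hr : 0 < r) (hrq : r < q) {N : ℕ} (hN : 0 < N)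
    {b : ℝ} (hb : 0 ≤ b) :
    (N : ℝ)⁻¹ * ∑ i : Fin N,
        (if frechetValue r i * b ≤ 1 then (frechetValue r i * b) ^ q else 0) ≤
      2 ^ (q / r) / (q / r - 1) * b ^ r := by
  have hu : 0 < q / r - 1 := by
    rw [sub_pos, one_lt_div hr]
    exact hrq
  have hNr : (0 : ℝ) < N := by exact_mod_cast hN
  set u := q / r - 1 with hudef
  have hqr : q / r = u + 1 := by rw [hudef]; ring
  set x : ℝ := N * b ^ r with hx
  have hx0 : 0 ≤ x := by positivity
  have hpow : ∀ i : Fin N, (frechetValue r i * b) ^ q =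
      x ^ (u + 1) * (((i : ℕ) : ℝ) + 1) ^ (-(u + 1)) := by
    intro i
    rw [frechetValue_mul hr i hb, ← Real.rpow_mul (by positivity), one_div_mul_eq_div, hqr,
      Real.div_rpow hx0 (by positivity), Real.rpow_neg (by positivity), div_eq_mul_inv]
  have hsum : ∑ i : Fin N, (if frechetValue r i * b ≤ 1 then (frechetValue r i * b) ^ q else 0) ≤
      2 ^ (q / r) / u * x := by
    simp only [frechetValue_mul_le_one_iff hr _ hb, hpow]
    rcases hx0.eq_or_lt with h0 | hxpos
    · rw [← h0, Real.zero_rpow (by linarith)]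
      simp
    rw [Fin.sum_univ_eq_sum_range (fun j : ℕ => if (N : ℝ) * b ^ r ≤ (j : ℝ) + 1 then
      x ^ (u + 1) * ((j : ℝ) + 1) ^ (-(u + 1)) else 0), ← Finset.sum_filter]
    have hceil : 1 ≤ ⌈x⌉₊ := Nat.one_le_iff_ne_zero.2 (Nat.ceil_pos.2 hxpos).ne'
    have hsub : (Finset.range N).filter (fun j : ℕ => (N : ℝ) * b ^ r ≤ (j : ℝ) + 1) ⊆
        Finset.Ico (⌈x⌉₊ - 1) N := by
      intro j hj
      rw [Finset.mem_filter, Finset.mem_range] at hj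
      have h1 : ⌈x⌉₊ ≤ j + 1 := Nat.ceil_le.2 (by push_cast; exact hj.2)
      rw [Finset.mem_Ico]
      exact ⟨by omega, hj.1⟩
    refine (Finset.sum_le_sum_of_subset_of_nonneg hsub fun j _ _ => by positivity).trans ?_
    rw [← Finset.mul_sum]
    have h1 := sum_Ico_rpow_neg_le hu (⌈x⌉₊ - 1) N
    have h2 : (((⌈x⌉₊ - 1 : ℕ) : ℝ) + 1) ^ (-u) ≤ x ^ (-u) := by
      refine Real.rpow_le_rpow_of_nonpos hxpos ?_ (by linarith)
      rw [Nat.cast_sub hceil]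
      simpa using Nat.le_ceil x
    have h3 : x ^ (u + 1) * x ^ (-u) = x := by
      rw [← Real.rpow_add hxpos, add_neg_cancel_comm, Real.rpow_one]
    calc _ ≤ x ^ (u + 1) * (2 ^ (u + 1) / u * x ^ (-u)) := by
          refine mul_le_mul_of_nonneg_left (h1.trans ?_) (by positivity)
          exact mul_le_mul_of_nonneg_left h2 (by positivity)
      _ = 2 ^ (u + 1) / u * (x ^ (u + 1) * x ^ (-u)) := by ring
      _ = _ := by rw [h3, hqr]
  rw [inv_mul_le_iff₀ hNr]
  refine hsum.trans (le_of_eq ?_)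
  rw [hx]
  ring

/-! ### From upper estimates to convexity -/

section Convexity

variable {E : Type*} [NormedAddCommGroup E] [NormedSpace ℝ E]
  [Lattice E] [IsOrderedAddMonoid E] [IsOrderedModule ℝ E] [HasSolidNorm E]

theorem posSup_equiv {ι κ : Type*} (s : Finset ι) (t : Finset κ) (g : ι → E) (f : κ → ι)
    (h : ∀ i, i ∈ s ↔ ∃ k ∈ t, f k = i) : posSup s g = posSup t fun k => g (f k) := by
  refine le_antisymm (posSup_le (posSup_nonneg _ _) fun i hi => ?_)
    (posSup_le (posSup_nonneg _ _) fun k hk => le_posSup g ((h _).2 ⟨k, hk, rfl⟩))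
  obtain ⟨k, hk, rfl⟩ := (h i).1 hi
  exact le_posSup (fun k => g (f k)) hk

/-- The estimate is stated with strictly positive majorants; ‖g i‖ + ε is admissible, and ε tends to
0. -/
theorem UpperEstimate.norm_posSup_le {q C : ℝ} (h : UpperEstimate E q C) (hq : 0 < q)
    {ι : Type*} (s : Finset ι) (g : ι → E) (hg : ∀ i ∈ s, 0 ≤ g i) :
    ‖posSup s g‖ ≤ C * (∑ i ∈ s, ‖g i‖ ^ q) ^ (1 / q) := by
  have hε : ∀ ε : ℝ, 0 < ε → ‖posSup s g‖ ≤ C * (∑ i ∈ s, (‖g i‖ + ε) ^ q) ^ (1 / q) := by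
    intro ε hε
    set f : Fin s.card → ι := fun k => (s.equivFin.symm k : ι) with hf
    have h1 := h s.card (fun k => g (f k)) (fun k => ‖g (f k)‖ + ε)
      (fun k => hg _ (s.equivFin.symm k).2) (fun k => by positivity)
      (fun k => by linarith)
    rw [← posSup_equiv s Finset.univ g f] at h1
    · have h2 : ∑ k, (‖g (f k)‖ + ε) ^ q = ∑ i ∈ s, (‖g i‖ + ε) ^ q := by
        rw [← Finset.sum_coe_sort s]
        exact s.equivFin.symm.sum_comp fun i : s => (‖g i‖ + ε) ^ q
      rwa [h2] at h1
    · intro i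
      constructor
      · intro hi
        exact ⟨s.equivFin ⟨i, hi⟩, Finset.mem_univ _, by simp [hf]⟩
      · rintro ⟨k, -, rfl⟩
        exact (s.equivFin.symm k).2
  have hcont : Continuous fun ε : ℝ => C * (∑ i ∈ s, |‖g i‖ + ε| ^ q) ^ (1 / q) := by
    refine continuous_const.mul (Continuous.rpow_const ?_ fun _ => Or.inr (by positivity))
    refine continuous_finsetSum _ fun i _ => ?_
    exact Continuous.rpow_const (by fun_prop) fun _ => Or.inr hq.le
  have hlim := (hcont.tendsto 0).mono_left (nhdsWithin_le_nhds (s := Set.Ioi 0))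
  simp only [add_zero, abs_norm] at hlim
  refine ge_of_tendsto hlim ?_
  filter_upwards [self_mem_nhdsWithin] with ε hεpos
  refine (hε ε hεpos).trans (le_of_eq ?_)
  congr 3 with i
  rw [abs_of_nonneg (add_nonneg (norm_nonneg _) (le_of_lt hεpos))]

namespace IsKrivineCalculus

variable {n : ℕ} {e : Fin n → E} {τ : homogeneousFunctions n →ₗ[ℝ] E}

theorem monotone (h : IsKrivineCalculus e τ) {f g : homogeneousFunctions n}
    (hfg : ∀ t, f.1 t ≤ g.1 t) : τ f ≤ τ g := by
  have h1 : homogeneousSup f g = g := by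
    ext t
    exact max_eq_right (hfg t)
  rw [← h1, h.map_sup]
  exact le_sup_left

theorem map_abs_coord (h : IsKrivineCalculus e τ) (i : Fin n) :
    τ (homogeneousSup (homogeneousCoord i) (-homogeneousCoord i)) = |e i| := by
  rw [h.map_sup, map_neg, h.map_coord]
  rfl

/-- Finite suprema in E of values of τ come from homogeneous functions, so pointwise scalar
inequalities involving maxima can be transported to E. -/
theorem exists_posSup (h : IsKrivineCalculus e τ) {ι : Type*} (s : Finset ι)
    (g : ι → homogeneousFunctions n) : ∃ f : homogeneousFunctions n, (∀ t, 0 ≤ f.1 t) ∧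
      (∀ i ∈ s, ∀ t, (g i).1 t ≤ f.1 t) ∧ τ f = posSup s fun i => τ (g i) := by
  classical
  induction s using Finset.induction_on with
  | empty => exact ⟨0, fun t => le_rfl, by simp, by simp⟩
  | insert i s hi ih =>
    obtain ⟨f, hf0, hf, hτ⟩ := ih
    refine ⟨homogeneousSup (g i) f, fun t => (hf0 t).trans (le_max_right _ _), ?_, ?_⟩
    · intro j hj t
      rcases Finset.mem_insert.1 hj with rfl | hj
      · exact le_max_left _ _
      · exact (hf j hj t).trans (le_max_right _ _)
    · rw [h.map_sup, posSup_insert, hτ]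

end IsKrivineCalculus

theorem homogeneousFunctions_sum_apply {n : ℕ} {ι : Type*} (s : Finset ι)
    (g : ι → homogeneousFunctions n) (t : Fin n → ℝ) :
    (∑ i ∈ s, g i).1 t = ∑ i ∈ s, (g i).1 t := by
  classical
  induction s using Finset.induction_on with
  | empty => simp
  | insert i s hi ih =>
    rw [Finset.sum_insert hi, Finset.sum_insert hi, ← ih]
    rfl

/-- Truncation at the level S = (∑ ‖e k‖^r)^(1/r): the vectors of norm at most S are controlled by
the upper q-estimate, the others by the triangle inequality. After averaging, each part is bounded
by a truncated moment, and the moments sum up because ∑ (‖e k‖/S)^r ≤ 1. -/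
theorem average_norm_posSup_le {q C r : ℝ} (hC : 0 ≤ C) (h : UpperEstimate E q C) (hr : 1 < r)
    (hrq : r < q) {n N : ℕ} (hN : 0 < N) (e : Fin n → E) (he : ∀ k, 0 ≤ e k) :
    ((N : ℝ) ^ n)⁻¹ * ∑ ω : Fin n → Fin N,
        ‖posSup Finset.univ fun k => frechetValue r (ω k) • e k‖ ≤
      (C * (1 + 2 ^ (q / r) / (q / r - 1)) + 1 / (1 - 1 / r)) *
        (∑ k, ‖e k‖ ^ r) ^ (1 / r) := by
  have hr0 : 0 < r := by linarith
  have hq0 : 0 < q := by linarith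
  set T := ∑ k, ‖e k‖ ^ r with hT
  have hT0 : 0 ≤ T := Finset.sum_nonneg fun k _ => Real.rpow_nonneg (norm_nonneg _) _
  set S := T ^ (1 / r) with hS
  have hS0 : 0 ≤ S := Real.rpow_nonneg hT0 _
  have hSr : S ^ r = T := by
    rw [hS, ← Real.rpow_mul hT0, one_div_mul_cancel hr0.ne', Real.rpow_one]
  set b : Fin n → ℝ := fun k => ‖e k‖ / S with hb
  have hb0 : ∀ k, 0 ≤ b k := fun k => by positivity
  have heb : ∀ k, ‖e k‖ = S * b k := by
    intro k
    -- If S = 0, all e k vanish and b k is 0 through division by zero; this is also why the sum of b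
    -- k ^ r is only claimed to be ≤ 1.
    rcases hS0.eq_or_lt with h0 | hpos
    · have h1 : ‖e k‖ ^ r ≤ 0 := by
        have : T = 0 := by rw [← hSr, ← h0, Real.zero_rpow hr0.ne']
        rw [← this]
        exact Finset.single_le_sum (f := fun k => ‖e k‖ ^ r)
          (fun k _ => Real.rpow_nonneg (norm_nonneg _) _) (Finset.mem_univ k)
      rw [← h0, zero_mul]
      by_contra hne
      have : 0 < ‖e k‖ := lt_of_le_of_ne (norm_nonneg _) (Ne.symm hne)
      exact absurd h1 (not_le.2 (Real.rpow_pos_of_pos this r))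
    · rw [hb]
      field_simp
  have hbsum : ∑ k, b k ^ r ≤ 1 := by
    simp only [hb, Real.div_rpow (norm_nonneg _) hS0]
    rw [← Finset.sum_div, hSr]
    exact div_self_le_one _
  have hpt : ∀ ω : Fin n → Fin N, ‖posSup Finset.univ fun k => frechetValue r (ω k) • e k‖ ≤
      S * (C * (1 + ∑ k, if frechetValue r (ω k) * b k ≤ 1 then
          (frechetValue r (ω k) * b k) ^ q else 0) +
        ∑ k, if frechetValue r (ω k) * b k ≤ 1 then 0 else frechetValue r (ω k) * b k) := by
    intro ω
    set g : Fin n → E := fun k => frechetValue r (ω k) • e k with hg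
    have hg0 : ∀ k, 0 ≤ g k := fun k => smul_nonneg (frechetValue_nonneg _ _) (he k)
    have hgn : ∀ k, ‖g k‖ = S * (frechetValue r (ω k) * b k) := by
      intro k
      rw [hg, norm_smul, Real.norm_of_nonneg (frechetValue_nonneg _ _), heb]
      ring
    set s := Finset.univ.filter fun k => frechetValue r (ω k) * b k ≤ 1 with hs
    set s' := Finset.univ.filter fun k => ¬ frechetValue r (ω k) * b k ≤ 1 with hs'
    have hle : posSup Finset.univ g ≤ posSup s g + ∑ k ∈ s', g k := by
      have h2 : 0 ≤ ∑ k ∈ s', g k := Finset.sum_nonneg fun k _ => hg0 k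
      refine posSup_le (add_nonneg (posSup_nonneg _ _) h2) fun k _ => ?_
      by_cases hk : frechetValue r (ω k) * b k ≤ 1
      · exact le_add_of_le_of_nonneg (le_posSup g (Finset.mem_filter.2 ⟨Finset.mem_univ k, hk⟩)) h2
      · exact le_add_of_nonneg_of_le (posSup_nonneg _ _) (Finset.single_le_sum
          (fun k _ => hg0 k) (Finset.mem_filter.2 ⟨Finset.mem_univ k, hk⟩))
    have h1 : ‖posSup s g‖ ≤ S * (C * (1 + ∑ k ∈ s, (frechetValue r (ω k) * b k) ^ q)) := by
      refine (h.norm_posSup_le hq0 s g fun k _ => hg0 k).trans ?_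
      have h3 : ∑ k ∈ s, ‖g k‖ ^ q = S ^ q * ∑ k ∈ s, (frechetValue r (ω k) * b k) ^ q := by
        rw [Finset.mul_sum]
        refine Finset.sum_congr rfl fun k _ => ?_
        rw [hgn, Real.mul_rpow hS0 (mul_nonneg (frechetValue_nonneg _ _) (hb0 k))]
      set X := ∑ k ∈ s, (frechetValue r (ω k) * b k) ^ q
      have hX : 0 ≤ X := Finset.sum_nonneg fun k _ =>
        Real.rpow_nonneg (mul_nonneg (frechetValue_nonneg _ _) (hb0 k)) _
      rw [h3, Real.mul_rpow (by positivity) hX, ← Real.rpow_mul hS0, mul_one_div_cancel hq0.ne',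
        Real.rpow_one]
      -- Removing the root leaves a sum of functions of single coordinates, whose average can be
      -- computed marginally.
      have h4 : X ^ (1 / q) ≤ 1 + X := by
        calc X ^ (1 / q) ≤ (1 + X) ^ (1 / q) :=
              Real.rpow_le_rpow hX (by linarith) (by positivity)
          _ ≤ (1 + X) ^ (1 : ℝ) := by
              refine Real.rpow_le_rpow_of_exponent_le (by linarith) ?_
              rw [div_le_one hq0]
              linarith
          _ = 1 + X := Real.rpow_one _
      calc C * (S * X ^ (1 / q)) = S * (C * X ^ (1 / q)) := by ring
        _ ≤ _ := by gcongr
    have h2 : ‖∑ k ∈ s', g k‖ ≤ S * ∑ k ∈ s', frechetValue r (ω k) * b k := by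
      refine (norm_sum_le _ _).trans (le_of_eq ?_)
      rw [Finset.mul_sum]
      exact Finset.sum_congr rfl fun k _ => hgn k
    refine (norm_le_norm_of_nonneg_of_le (posSup_nonneg _ _) hle).trans
      ((norm_add_le _ _).trans ((add_le_add h1 h2).trans (le_of_eq ?_)))
    rw [← mul_add, hs, hs', Finset.sum_filter, Finset.sum_filter]
    simp only [ite_not]
  have havg : 0 ≤ ((N : ℝ) ^ n)⁻¹ := by positivity
  refine (mul_le_mul_of_nonneg_left (Finset.sum_le_sum fun ω _ => hpt ω) havg).trans ?_
  have hone : ((N : ℝ) ^ n)⁻¹ * ∑ _ω : Fin n → Fin N, (1 : ℝ) = 1 := by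
    have : (N : ℝ) ≠ 0 := by positivity
    simp [this]
  have hswap : ∀ F : Fin n → Fin N → ℝ, ((N : ℝ) ^ n)⁻¹ * ∑ ω : Fin n → Fin N, ∑ k, F k (ω k) =
      ∑ k, (N : ℝ)⁻¹ * ∑ i, F k i := by
    intro F
    rw [Finset.sum_comm, Finset.mul_sum]
    exact Finset.sum_congr rfl fun k _ => average_marginal hN.ne' k (F k)
  have hsmall := hswap fun k i => if frechetValue r i * b k ≤ 1 then
    (frechetValue r i * b k) ^ q else 0
  have hlarge := hswap fun k i => if frechetValue r i * b k ≤ 1 then 0 else frechetValue r i * b k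
  have hsmall' : ∑ k, (N : ℝ)⁻¹ * ∑ i : Fin N, (if frechetValue r i * b k ≤ 1 then
      (frechetValue r i * b k) ^ q else 0) ≤ 2 ^ (q / r) / (q / r - 1) := by
    refine (Finset.sum_le_sum fun k _ => average_small_frechetValue_le hr0 hrq hN (hb0 k)).trans ?_
    rw [← Finset.mul_sum]
    have : 0 ≤ 2 ^ (q / r) / (q / r - 1) := by
      have : 1 < q / r := (one_lt_div hr0).2 hrq
      exact div_nonneg (by positivity) (by linarith)
    exact mul_le_of_le_one_right this hbsum
  have hlarge' : ∑ k, (N : ℝ)⁻¹ * ∑ i : Fin N, (if frechetValue r i * b k ≤ 1 then 0 else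
      frechetValue r i * b k) ≤ 1 / (1 - 1 / r) := by
    refine (Finset.sum_le_sum fun k _ => average_large_frechetValue_le hr hN (hb0 k)).trans ?_
    rw [← Finset.mul_sum]
    have : 0 ≤ 1 / (1 - 1 / r) := by
      have : 1 / r < 1 := by rwa [div_lt_one hr0]
      exact div_nonneg zero_le_one (by linarith)
    exact mul_le_of_le_one_right this hbsum
  have hsplit : ∀ U V : (Fin n → Fin N) → ℝ, ((N : ℝ) ^ n)⁻¹ * ∑ ω, S * (C * (1 + U ω) + V ω) =
      S * (C * (1 + ((N : ℝ) ^ n)⁻¹ * ∑ ω, U ω) + ((N : ℝ) ^ n)⁻¹ * ∑ ω, V ω) := by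
    intro U V
    rw [← Finset.mul_sum, Finset.sum_add_distrib, ← Finset.mul_sum, Finset.sum_add_distrib]
    linear_combination S * C * hone
  rw [hsplit, hsmall, hlarge, mul_comm _ S]
  gcongr

/-- The scalar bound of the power sum by an average of maxima is an inequality between homogeneous
functions, so τ carries it to E. The triangle inequality and the averaged norm bound then finish. -/
theorem isQConvex_of_upperEstimate [CompleteSpace E] {q C r : ℝ} (hC : 0 ≤ C)
    (h : UpperEstimate E q C) (hr : 1 < r) (hrq : r < q) : IsQConvex E r := by
  have hr0 : 0 < r := by linarith
  refine ⟨hr.le, 3 * (C * (1 + 2 ^ (q / r) / (q / r - 1)) + 1 / (1 - 1 / r)), fun n e => ?_⟩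
  obtain ⟨τ, hτ⟩ := exists_isKrivineCalculus e
  refine ⟨τ, hτ, ?_⟩
  set N := 2 * n + 1 with hN
  have hex : ∀ ω : Fin n → Fin N, ∃ f : homogeneousFunctions n, (∀ t, 0 ≤ f.1 t) ∧
      (∀ k t, frechetValue r (ω k) * |t k| ≤ f.1 t) ∧
      τ f = posSup Finset.univ fun k => frechetValue r (ω k) • |e k| := by
    intro ω
    obtain ⟨f, hf0, hf, hτf⟩ := hτ.exists_posSup Finset.univ fun k => frechetValue r (ω k) •
      homogeneousSup (homogeneousCoord k) (-homogeneousCoord k)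
    refine ⟨f, hf0, fun k t => hf k (Finset.mem_univ k) t, ?_⟩
    simp only [hτf, map_smul, hτ.map_abs_coord]
  choose H hH0 hH hτH using hex
  have hps0 : 0 ≤ τ (homogeneousPowerSum n r hr0) := by
    rw [← map_zero τ]
    refine hτ.monotone fun t => ?_
    exact Real.rpow_nonneg (Finset.sum_nonneg fun k _ => Real.rpow_nonneg (abs_nonneg _) _) _
  have hle : τ (homogeneousPowerSum n r hr0) ≤
      τ ((3 * ((N : ℝ) ^ n)⁻¹) • ∑ ω, H ω) := by
    refine hτ.monotone fun t => ?_
    have h1 := powerSum_le_average hN.symm hr (fun k => |t k|) (fun k => abs_nonneg _)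
      (fun ω => (H ω).1 t) (fun ω => hH0 ω t) fun ω k => hH ω k t
    rw [← mul_assoc] at h1
    refine h1.trans (le_of_eq ?_)
    rw [← homogeneousFunctions_sum_apply]
    rfl
  rw [map_smul, map_sum] at hle
  refine (norm_le_norm_of_nonneg_of_le hps0 hle).trans ?_
  rw [norm_smul, Real.norm_of_nonneg (by positivity), mul_assoc, mul_assoc]
  refine mul_le_mul_of_nonneg_left ?_ (by norm_num)
  have h2 := average_norm_posSup_le hC h hr hrq (Nat.succ_pos (2 * n)) (fun k => |e k|)
    fun k => abs_nonneg _
  simp only [norm_abs_eq_norm] at h2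
  refine le_trans (mul_le_mul_of_nonneg_left (norm_sum_le _ _) (by positivity)) ?_
  simp only [hτH]
  exact h2

theorem upperEstimate_of_isQConvex {q : ℝ} (h : IsQConvex E q) :
    ∃ C, 0 ≤ C ∧ UpperEstimate E q C := by
  obtain ⟨hq, C, hC⟩ := h
  have hq0 : 0 < q := one_pos.trans_le hq
  refine ⟨max C 0, le_max_right _ _, fun n e b he hb heb => ?_⟩
  obtain ⟨τ, hτ, hn⟩ := hC n e
  have h1 : posSup Finset.univ e ≤ τ (homogeneousPowerSum n q hq0) := by
    refine posSup_le ?_ fun k _ => ?_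
    · rw [← map_zero τ]
      refine hτ.monotone fun t => ?_
      exact Real.rpow_nonneg (Finset.sum_nonneg fun k _ => Real.rpow_nonneg (abs_nonneg _) _) _
    · rw [← hτ.map_coord]
      refine hτ.monotone fun t => ?_
      change t k ≤ (∑ k, |t k| ^ q) ^ (1 / q)
      calc t k ≤ |t k| := le_abs_self _
        _ = (|t k| ^ q) ^ (1 / q) := by
          rw [← Real.rpow_mul (abs_nonneg _), mul_one_div_cancel hq0.ne', Real.rpow_one]
        _ ≤ _ := Real.rpow_le_rpow (Real.rpow_nonneg (abs_nonneg _) _)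
          (Finset.single_le_sum (f := fun k => |t k| ^ q)
            (fun k _ => Real.rpow_nonneg (abs_nonneg _) _) (Finset.mem_univ k)) (by positivity)
  refine (norm_le_norm_of_nonneg_of_le (posSup_nonneg _ _) h1).trans (hn.trans ?_)
  have h2 : (∑ k, ‖e k‖ ^ q) ^ (1 / q) ≤ (∑ k, b k ^ q) ^ (1 / q) :=
    Real.rpow_le_rpow (Finset.sum_nonneg fun k _ => Real.rpow_nonneg (norm_nonneg _) _)
      (Finset.sum_le_sum fun k _ => Real.rpow_le_rpow (norm_nonneg _) (heb k) hq0.le)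
      (by positivity)
  exact mul_le_mul (le_max_left _ _) h2 (Real.rpow_nonneg (Finset.sum_nonneg fun k _ =>
    Real.rpow_nonneg (norm_nonneg _) _) _) (le_max_right _ _)

end Convexity

/-! ### Maximal functions on finite binary trees -/

/-- Finite binary trees with values at the leaves: simple dyadic functions on `[0, 1)`. -/
inductive BinTree (E : Type*) where
  | leaf (e : E) : BinTree E
  | node (l r : BinTree E) : BinTree E

namespace BinTree

variable {E : Type*} [NormedAddCommGroup E] [NormedSpace ℝ E]
  [Lattice E] [IsOrderedAddMonoid E] [IsOrderedModule ℝ E] [HasSolidNorm E]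

/-- The average of the values of the leaves. -/
def avg : BinTree E → E
  | leaf e => e
  | node l r => (1 / 2 : ℝ) • (avg l + avg r)

/-- The average of `G` over the leaves. -/
def mean (G : E → ℝ) : BinTree E → ℝ
  | leaf e => G e
  | node l r => (mean G l + mean G r) / 2

/-- The average over the leaves of `φ` applied to the supremum of `w` and all the averages along
the path leading to the leaf. -/
def pathMean (φ : E → ℝ) : E → BinTree E → ℝ
  | w, leaf e => φ (w ⊔ e)
  | w, node l r =>
    (pathMean φ (w ⊔ (1 / 2 : ℝ) • (avg l + avg r)) l +
      pathMean φ (w ⊔ (1 / 2 : ℝ) • (avg l + avg r)) r) / 2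

/-- The indicator function of the complement of the unit ball. -/
def outside (x : E) : ℝ :=
  open scoped Classical in if 1 < ‖x‖ then 1 else 0

theorem outside_nonneg (x : E) : 0 ≤ outside x := by
  unfold outside
  split_ifs <;> norm_num

theorem outside_le_one (x : E) : outside x ≤ 1 := by
  unfold outside
  split_ifs <;> norm_num

theorem outside_mono {x y : E} (hx : 0 ≤ x) (hxy : x ≤ y) : outside x ≤ outside y := by
  have h := norm_le_norm_of_nonneg_of_le hx hxy
  unfold outside
  split_ifs with h1 h2
  · exact le_rfl
  · exact absurd (h1.trans_le h) h2
  · exact zero_le_one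
  · exact le_rfl

theorem pathMean_nonneg {φ : E → ℝ} (hφ : ∀ x, 0 ≤ φ x) (t : BinTree E) (w : E) :
    0 ≤ pathMean φ w t := by
  induction t generalizing w with
  | leaf e => exact hφ _
  | node l r hl hr =>
    simp only [pathMean]
    linarith [hl (w ⊔ (1 / 2 : ℝ) • (avg l + avg r)), hr (w ⊔ (1 / 2 : ℝ) • (avg l + avg r))]

theorem pathMean_mono {φ ψ : E → ℝ} (hφ : ∀ x, φ x ≤ ψ x) (t : BinTree E) (w : E) :
    pathMean φ w t ≤ pathMean ψ w t := by
  induction t generalizing w with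
  | leaf e => exact hφ _
  | node l r hl hr =>
    simp only [pathMean]
    linarith [hl (w ⊔ (1 / 2 : ℝ) • (avg l + avg r)), hr (w ⊔ (1 / 2 : ℝ) • (avg l + avg r))]

theorem pathMean_const (c : ℝ) (t : BinTree E) (w : E) : pathMean (fun _ => c) w t = c := by
  induction t generalizing w with
  | leaf e => rfl
  | node l r hl hr =>
    simp only [pathMean, hl, hr]
    ring

theorem pathMean_outside_le_one (t : BinTree E) (w : E) : pathMean outside w t ≤ 1 :=
  (pathMean_mono outside_le_one t w).trans (pathMean_const 1 t w).le

theorem pathMean_outside_mono (t : BinTree E) {w w' : E} (hw : 0 ≤ w) (h : w ≤ w') :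
    pathMean outside w t ≤ pathMean outside w' t := by
  induction t generalizing w w' with
  | leaf e => exact outside_mono (hw.trans le_sup_left) (sup_le_sup_right h e)
  | node l r hl hr =>
    simp only [pathMean]
    have h' := sup_le_sup_right h ((1 / 2 : ℝ) • (avg l + avg r))
    have hw' : 0 ≤ w ⊔ (1 / 2 : ℝ) • (avg l + avg r) := hw.trans le_sup_left
    linarith [hl hw' h', hr hw' h']

/-- Every path starts at the root, so the root average already belongs to each path supremum. -/
theorem pathMean_sup_avg (φ : E → ℝ) (t : BinTree E) (w : E) :
    pathMean φ (w ⊔ avg t) t = pathMean φ w t := by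
  cases t with
  | leaf e => simp only [pathMean, avg, sup_assoc, sup_idem]
  | node l r => simp only [pathMean, avg, sup_assoc, sup_idem]

theorem mean_nonneg {G : E → ℝ} (hG : ∀ x, 0 ≤ G x) (t : BinTree E) : 0 ≤ mean G t := by
  induction t with
  | leaf e => exact hG e
  | node l r hl hr =>
    simp only [mean]
    linarith

theorem norm_avg_le (t : BinTree E) : ‖avg t‖ ≤ mean norm t := by
  induction t with
  | leaf e => exact le_rfl
  | node l r hl hr =>
    simp only [mean, avg]
    rw [norm_smul, Real.norm_of_nonneg (by norm_num)]
    linarith [norm_add_le (avg l) (avg r)]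

open scoped Classical in
/-- The tree obtained by stopping at the first nodes where the average norm exceeds `1`. -/
def stopTree : BinTree E → BinTree E
  | leaf e => leaf e
  | node l r => if 1 < mean norm (node l r) then leaf (avg (node l r))
      else node (stopTree l) (stopTree r)

open scoped Classical in
/-- The fraction of the tree above which one stops. -/
def stopFraction : BinTree E → ℝ
  | leaf _ => 0
  | node l r => if 1 < mean norm (node l r) then 1 else (stopFraction l + stopFraction r) / 2

theorem avg_stopTree (t : BinTree E) : avg (stopTree t) = avg t := by
  induction t with
  | leaf e => rfl
  | node l r hl hr =>
    simp only [stopTree]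
    split_ifs
    · rfl
    · simp only [avg, hl, hr]

theorem mean_norm_stopTree_le (t : BinTree E) : mean norm (stopTree t) ≤ mean norm t := by
  induction t with
  | leaf e => exact le_rfl
  | node l r hl hr =>
    simp only [stopTree]
    split_ifs
    · exact norm_avg_le (node l r)
    · simp only [mean]
      linarith

theorem stopFraction_le (t : BinTree E) : stopFraction t ≤ mean norm t := by
  induction t with
  | leaf e => exact norm_nonneg e
  | node l r hl hr =>
    simp only [stopFraction]
    split_ifs with h
    · exact h.le
    · simp only [mean]
      linarith

/-- Stopping preserves averages, so nothing changes on unstopped paths; the stopped part contributes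
at most its fraction because `outside` is at most 1. -/
theorem pathMean_outside_le_stopTree (t : BinTree E) (w : E) :
    pathMean outside w t ≤ pathMean outside w (stopTree t) + stopFraction t := by
  induction t generalizing w with
  | leaf e => simp [stopTree, stopFraction]
  | node l r hl hr =>
    simp only [stopTree, stopFraction]
    split_ifs
    · linarith [pathMean_outside_le_one (node l r) w,
        pathMean_nonneg outside_nonneg (leaf (avg (node l r))) w]
    · simp only [pathMean, avg_stopTree]
      linarith [hl (w ⊔ (1 / 2 : ℝ) • (avg l + avg r)), hr (w ⊔ (1 / 2 : ℝ) • (avg l + avg r))]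

theorem rpow_le_two_rpow_mul {x p : ℝ} (hp : 1 < p) (hx0 : 0 ≤ x) (hx : x ≤ 2) :
    x ^ p ≤ 2 ^ (p - 1) * x := by
  have h : x ^ p = x ^ (p - 1) * x := by
    rw [← Real.rpow_add_one' hx0 (by linarith), sub_add_cancel]
  rw [h]
  exact mul_le_mul_of_nonneg_right (Real.rpow_le_rpow hx0 hx (by linarith)) hx0

/-- A child of an unstopped node has mean norm at most twice that of its parent, hence at most 2.
All leaves of the stopped tree thus have norm at most 2, where x^p is dominated by a multiple of x.
-/
theorem mean_rpow_stopTree_le {p : ℝ} (hp : 1 < p) (t : BinTree E) (ht : mean norm t ≤ 2) :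
    mean (fun x => ‖x‖ ^ p) (stopTree t) ≤ 2 ^ (p - 1) * mean norm (stopTree t) := by
  induction t with
  | leaf e => exact rpow_le_two_rpow_mul hp (norm_nonneg _) ht
  | node l r hl hr =>
    simp only [stopTree]
    split_ifs with h
    · exact rpow_le_two_rpow_mul hp (norm_nonneg _) ((norm_avg_le _).trans ht)
    · simp only [mean] at h ⊢
      have h1 := mean_nonneg (G := norm) norm_nonneg l
      have h2 := mean_nonneg (G := norm) norm_nonneg r
      have := hl (by linarith)
      have := hr (by linarith)
      linarith

/-- The `L^p` bound for the maximal function of trees. -/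
def MaximalBound (E : Type*) [NormedAddCommGroup E] [NormedSpace ℝ E] [Lattice E] (p K : ℝ) :
    Prop :=
  ∀ t : BinTree E, pathMean (fun x => ‖x‖ ^ p) 0 t ≤ K * mean (fun x => ‖x‖ ^ p) t

/-- Calderón–Zygmund passage from L^p to weak (1,1): Chebyshev and the L^p bound on the stopped
tree, plus the stopped fraction. If the mean norm exceeds 2, the bound holds since the left side is
at most 1. -/
theorem MaximalBound.pathMean_outside_le {p K : ℝ} (hp : 1 < p) (hK : 0 ≤ K)
    (h : MaximalBound E p K) (t : BinTree E) :
    pathMean outside 0 t ≤ (K * 2 ^ (p - 1) + 1) * mean norm t := by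
  have hn := mean_nonneg (G := norm) norm_nonneg t
  have hK' : 0 ≤ K * 2 ^ (p - 1) := by positivity
  rcases le_or_gt (mean norm t) 2 with h2 | h2
  · have h1 : pathMean outside 0 (stopTree t) ≤ pathMean (fun x => ‖x‖ ^ p) 0 (stopTree t) := by
      refine pathMean_mono (fun x => ?_) _ _
      unfold outside
      split_ifs with hx
      · exact Real.one_le_rpow hx.le (by linarith)
      · positivity
    have h3 := h (stopTree t)
    have h4 := mul_le_mul_of_nonneg_left (mean_rpow_stopTree_le hp t h2) hK
    have h5 := mul_le_mul_of_nonneg_left (mean_norm_stopTree_le t) hK'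
    have h6 := pathMean_outside_le_stopTree t 0
    have h7 := stopFraction_le t
    linarith
  · have h1 := pathMean_outside_le_one t 0
    have := mul_nonneg hK' hn
    linarith

/-! ### The Bellman function of the weak-type estimate -/

/-- The Bellman function of the weak-type estimate with constant `A`. -/
def bellman (A : ℝ) (e w : E) : ℝ :=
  ⨆ t : {t : BinTree E // avg t = e}, (pathMean outside w t.1 - A * mean norm t.1)

variable {A : ℝ}

theorem bddAbove_bellman (hA : 0 ≤ A) (e w : E) : BddAbove (Set.range
    fun t : {t : BinTree E // avg t = e} => pathMean outside w t.1 - A * mean norm t.1) := by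
  refine ⟨1, ?_⟩
  rintro _ ⟨t, rfl⟩
  have h1 := pathMean_outside_le_one t.1 w
  have h2 := mul_nonneg hA (mean_nonneg (G := norm) norm_nonneg t.1)
  simp only
  linarith

theorem le_bellman (hA : 0 ≤ A) (w : E) (t : BinTree E) :
    pathMean outside w t - A * mean norm t ≤ bellman A (avg t) w :=
  le_ciSup (f := fun s : {s : BinTree E // avg s = avg t} =>
    pathMean outside w s.1 - A * mean norm s.1) (bddAbove_bellman hA (avg t) w) ⟨t, rfl⟩

theorem bellman_le {e w : E} {c : ℝ}
    (h : ∀ t : BinTree E, avg t = e → pathMean outside w t - A * mean norm t ≤ c) :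
    bellman A e w ≤ c :=
  haveI : Nonempty {t : BinTree E // avg t = e} := ⟨⟨leaf e, rfl⟩⟩
  ciSup_le fun t => h t.1 t.2

theorem outside_sub_le_bellman (hA : 0 ≤ A) (e w : E) :
    outside (w ⊔ e) - A * ‖e‖ ≤ bellman A e w :=
  le_bellman hA w (leaf e)

/-- Allows the average over a cube to be absorbed into the running supremum at no cost. -/
theorem bellman_sup_le (hA : 0 ≤ A) (e w : E) : bellman A e (w ⊔ e) ≤ bellman A e w := by
  refine bellman_le fun t ht => ?_
  subst ht
  rw [pathMean_sup_avg]
  exact le_bellman hA w t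

/-- Trees with averages x and y, glued under a new root, compete at the midpoint; the root average
can only raise the path suprema. -/
theorem bellman_midpoint (hA : 0 ≤ A) (x y : E) {w : E} (hw : 0 ≤ w) :
    bellman A x w + bellman A y w ≤ 2 * bellman A ((1 / 2 : ℝ) • (x + y)) w := by
  rw [← le_sub_iff_add_le]
  refine bellman_le fun s hs => ?_
  rw [le_sub_comm]
  refine bellman_le fun t ht => ?_
  have h := le_bellman hA w (node s t)
  simp only [pathMean, mean, avg, hs, ht] at h
  have h1 := pathMean_outside_mono s hw (le_sup_left (b := (1 / 2 : ℝ) • (x + y)))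
  have h2 := pathMean_outside_mono t hw (le_sup_left (b := (1 / 2 : ℝ) • (x + y)))
  linarith

/-- Midpoint concavity plus the lower bound -A‖e‖ gives concavity. This is the step from halving to
arbitrary proportions, hence from Lebesgue measure to every measure. -/
theorem bellman_concave (hA : 0 ≤ A) (x y : E) {w : E} (hw : 0 ≤ w) {a b : ℝ} (ha : 0 ≤ a)
    (hb : 0 ≤ b) (hab : a + b = 1) :
    a * bellman A x w + b * bellman A y w ≤ bellman A (a • x + b • y) w := by
  set g : ℝ → ℝ := fun θ => (1 - θ) * bellman A x w + θ * bellman A y w -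
    bellman A ((1 - θ) • x + θ • y) w with hg
  have hmid : ∀ θ θ', 2 * g ((θ + θ') / 2) ≤ g θ + g θ' := by
    intro θ θ'
    have h := bellman_midpoint hA ((1 - θ) • x + θ • y) ((1 - θ') • x + θ' • y) hw
    have h1 : (1 / 2 : ℝ) • ((1 - θ) • x + θ • y + ((1 - θ') • x + θ' • y)) =
        (1 - (θ + θ') / 2) • x + ((θ + θ') / 2) • y := by module
    rw [h1] at h
    simp only [hg]
    linarith
  have h0 : g 0 = 0 := by simp [hg]
  have h1 : g 1 = 0 := by simp [hg]
  set M := |bellman A x w| + |bellman A y w| + A * (‖x‖ + ‖y‖) with hM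
  have hM0 : 0 ≤ M := by positivity
  have hbd : ∀ θ, 0 ≤ θ → θ ≤ 1 → g θ ≤ M := by
    intro θ h0 h1
    have h2 := outside_sub_le_bellman hA ((1 - θ) • x + θ • y) w
    have h3 := outside_nonneg (w ⊔ ((1 - θ) • x + θ • y))
    have h4 : ‖(1 - θ) • x + θ • y‖ ≤ ‖x‖ + ‖y‖ := by
      refine (norm_add_le _ _).trans ?_
      rw [norm_smul, norm_smul, Real.norm_of_nonneg h0, Real.norm_of_nonneg (by linarith)]
      exact add_le_add (mul_le_of_le_one_left (norm_nonneg _) (by linarith))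
        (mul_le_of_le_one_left (norm_nonneg _) h1)
    have h5 := mul_le_mul_of_nonneg_left h4 hA
    have h6 : (1 - θ) * bellman A x w ≤ |bellman A x w| := by
      refine (le_abs_self _).trans ?_
      rw [abs_mul, abs_of_nonneg (by linarith : 0 ≤ 1 - θ)]
      exact mul_le_of_le_one_left (abs_nonneg _) (by linarith)
    have h7 : θ * bellman A y w ≤ |bellman A y w| := by
      refine (le_abs_self _).trans ?_
      rw [abs_mul, abs_of_nonneg h0]
      exact mul_le_of_le_one_left (abs_nonneg _) h1
    simp only [hg]
    linarith
  -- Any θ in [0, 1] is the midpoint of an endpoint, where g vanishes, and another point of [0, 1];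
  -- so every upper bound for g can be halved.
  have hiter : ∀ n : ℕ, ∀ θ, 0 ≤ θ → θ ≤ 1 → g θ ≤ M * (1 / 2) ^ n := by
    intro n
    induction n with
    | zero => simpa using hbd
    | succ n ih =>
      intro θ hθ0 hθ1
      rw [pow_succ]
      rcases le_total θ (1 / 2) with h | h
      · have h2 := hmid 0 (2 * θ)
        rw [show (0 + 2 * θ) / 2 = θ by ring, h0] at h2
        linarith [ih (2 * θ) (by linarith) (by linarith)]
      · have h2 := hmid 1 (2 * θ - 1)
        rw [show (1 + (2 * θ - 1)) / 2 = θ by ring, h1] at h2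
        linarith [ih (2 * θ - 1) (by linarith) (by linarith)]
  have hlim : Filter.Tendsto (fun n : ℕ => M * (1 / 2 : ℝ) ^ n) Filter.atTop (nhds 0) := by
    simpa using (tendsto_pow_atTop_nhds_zero_of_lt_one (r := (1 / 2 : ℝ)) (by norm_num)
      (by norm_num)).const_mul M
  have hfin : g b ≤ 0 := ge_of_tendsto' hlim fun n => hiter n b hb (by linarith)
  have ha' : a = 1 - b := by linarith
  simp only [hg] at hfin
  rw [ha']
  linarith

theorem MaximalBound.bellman_zero_le {p K : ℝ} (hp : 1 < p) (hK : 0 ≤ K)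
    (h : MaximalBound E p K) (e : E) : bellman (K * 2 ^ (p - 1) + 1) e 0 ≤ 0 :=
  bellman_le fun t _ => by linarith [h.pathMean_outside_le hp hK t]

end BinTree

/-! ### The maximal bound implies an upper estimate -/

namespace BinTree

variable {E : Type*} [NormedAddCommGroup E] [NormedSpace ℝ E]
  [Lattice E] [IsOrderedAddMonoid E] [IsOrderedModule ℝ E] [HasSolidNorm E]

/-- The average over the leaves of the supremum of `w` and all the averages along the path leading
to the leaf. -/
def pathAvg : E → BinTree E → E
  | w, leaf e => w ⊔ e
  | w, node l r => (1 / 2 : ℝ) • (pathAvg (w ⊔ (1 / 2 : ℝ) • (avg l + avg r)) l +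
      pathAvg (w ⊔ (1 / 2 : ℝ) • (avg l + avg r)) r)

theorem norm_pathAvg_le (t : BinTree E) (w : E) : ‖pathAvg w t‖ ≤ pathMean norm w t := by
  induction t generalizing w with
  | leaf e => exact le_rfl
  | node l r hl hr =>
    simp only [pathAvg, pathMean]
    rw [norm_smul, Real.norm_of_nonneg (by norm_num)]
    set v := w ⊔ (1 / 2 : ℝ) • (avg l + avg r)
    linarith [norm_add_le (pathAvg v l) (pathAvg v r), hl v, hr v]

theorem pathMean_add_one (φ : E → ℝ) (t : BinTree E) (w : E) :
    pathMean (fun x => 1 + φ x) w t = 1 + pathMean φ w t := by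
  induction t generalizing w with
  | leaf e => rfl
  | node l r hl hr =>
    simp only [pathMean, hl, hr]
    ring

theorem pathAvg_mono (t : BinTree E) {w w' : E} (h : w ≤ w') : pathAvg w t ≤ pathAvg w' t := by
  induction t generalizing w w' with
  | leaf e => exact sup_le_sup_right h e
  | node l r hl hr =>
    have h' := sup_le_sup_right h ((1 / 2 : ℝ) • (avg l + avg r))
    exact smul_le_smul_of_nonneg_left (add_le_add (hl h') (hr h')) (by norm_num)

theorem le_pathAvg (t : BinTree E) (w : E) : w ≤ pathAvg w t := by
  induction t generalizing w with
  | leaf e => exact le_sup_left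
  | node l r hl hr =>
    set v := w ⊔ (1 / 2 : ℝ) • (avg l + avg r) with hv
    have h1 : w ≤ v := le_sup_left
    calc w = (1 / 2 : ℝ) • (w + w) := by module
      _ ≤ _ := smul_le_smul_of_nonneg_left (add_le_add (h1.trans (hl v)) (h1.trans (hr v)))
        (by norm_num)

/-- The complete binary tree of depth `L` with leaves `e 0, …, e (2 ^ L - 1)`. -/
def complete : ℕ → (ℕ → E) → BinTree E
  | 0, e => leaf (e 0)
  | L + 1, e => node (complete L e) (complete L fun k => e (k + 2 ^ L))

theorem avg_complete_nonneg (L : ℕ) (e : ℕ → E) (he : ∀ k, 0 ≤ e k) : 0 ≤ avg (complete L e) := by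
  induction L generalizing e with
  | zero => exact he 0
  | succ L ih =>
    exact smul_nonneg (by norm_num) (add_nonneg (ih e he) (ih _ fun k => he _))

theorem le_avg_complete (L : ℕ) (e : ℕ → E) (he : ∀ k, 0 ≤ e k) {k : ℕ} (hk : k < 2 ^ L) :
    ((1 / 2 : ℝ) ^ L) • e k ≤ avg (complete L e) := by
  induction L generalizing e k with
  | zero =>
    obtain rfl : k = 0 := by simpa using hk
    simp [complete, avg]
  | succ L ih =>
    rw [pow_succ', mul_smul]
    refine smul_le_smul_of_nonneg_left ?_ (by norm_num)
    rcases lt_or_ge k (2 ^ L) with h | h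
    · exact le_add_of_le_of_nonneg (ih e he h) (avg_complete_nonneg L _ fun k => he _)
    · have h1 := ih (fun k => e (k + 2 ^ L)) (fun k => he _) (k := k - 2 ^ L)
        (by rw [pow_succ] at hk; omega)
      simp only [Nat.sub_add_cancel h] at h1
      exact le_add_of_nonneg_of_le (avg_complete_nonneg L _ he) h1

/-- The node at depth j above leaf k has average at least 2^(j-L) e k. For j < L, a fraction
2^(-j-1) of the leaves leaves the path exactly there and contributes 2^(-L-1) e k; the leaf itself
contributes twice that. The gain over the plain average is the factor of order L. -/
theorem le_pathAvg_complete (L : ℕ) (e : ℕ → E) (he : ∀ k, 0 ≤ e k) {k : ℕ} (hk : k < 2 ^ L) :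
    ((L + 2) * (1 / 2 : ℝ) ^ (L + 1)) • e k ≤ pathAvg 0 (complete L e) := by
  induction L generalizing e k with
  | zero =>
    obtain rfl : k = 0 := by simpa using hk
    norm_num [complete, pathAvg]
  | succ L ih =>
    set a := (1 / 2 : ℝ) • (avg (complete L e) + avg (complete L fun k => e (k + 2 ^ L))) with ha
    have ha0 : 0 ≤ a := avg_complete_nonneg (L + 1) e he
    have hak : ((1 / 2 : ℝ) ^ (L + 1)) • e k ≤ a := le_avg_complete (L + 1) e he hk
    have hsplit : (((L + 1 : ℕ) + 2 : ℝ) * (1 / 2 : ℝ) ^ (L + 1 + 1)) • e k =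
        (1 / 2 : ℝ) • (((L + 2) * (1 / 2 : ℝ) ^ (L + 1)) • e k + ((1 / 2 : ℝ) ^ (L + 1)) • e k) := by
      rw [← add_smul, smul_smul]
      congr 1
      push_cast
      ring
    rw [hsplit]
    have hsup : 0 ⊔ a = a := sup_of_le_right ha0
    have hpath : pathAvg 0 (complete (L + 1) e) = (1 / 2 : ℝ) • (pathAvg a (complete L e) +
        pathAvg a (complete L fun k => e (k + 2 ^ L))) := by
      simp only [complete, pathAvg]
      rw [← ha, hsup]
    rw [hpath]
    refine smul_le_smul_of_nonneg_left ?_ (by norm_num)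
    rcases lt_or_ge k (2 ^ L) with h | h
    · exact add_le_add ((ih e he h).trans (pathAvg_mono _ ha0)) (hak.trans (le_pathAvg _ _))
    · have h1 := ih (fun k => e (k + 2 ^ L)) (fun k => he _) (k := k - 2 ^ L)
        (by rw [pow_succ] at hk; omega)
      simp only [Nat.sub_add_cancel h] at h1
      rw [add_comm]
      exact add_le_add (hak.trans (le_pathAvg _ _)) (h1.trans (pathAvg_mono _ ha0))

theorem mean_complete_le_one (φ : E → ℝ) (L : ℕ) (e : ℕ → E) (he : ∀ k, φ (e k) ≤ 1) :
    mean φ (complete L e) ≤ 1 := by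
  induction L generalizing e with
  | zero => exact he 0
  | succ L ih =>
    simp only [complete, mean]
    linarith [ih e he, ih (fun k => e (k + 2 ^ L)) fun k => he _]

/-- The averaged path supremum dominates a multiple of every leaf, hence of their supremum, while
its norm is at most 1 + K by x ≤ 1 + x^p and the maximal bound. -/
theorem MaximalBound.norm_posSup_range_le {p K : ℝ} (hp : 1 ≤ p) (hK : 0 ≤ K)
    (h : MaximalBound E p K) (L : ℕ) (e : ℕ → E) (he : ∀ k, 0 ≤ e k) (he1 : ∀ k, ‖e k‖ ≤ 1) :
    (L + 2) * ‖posSup (Finset.range (2 ^ L)) e‖ ≤ 2 ^ (L + 1) * (1 + K) := by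
  have h1 : ‖pathAvg 0 (complete L e)‖ ≤ 1 + K := by
    refine (norm_pathAvg_le _ _).trans ?_
    have h2 : pathMean norm 0 (complete L e) ≤ 1 + pathMean (fun x => ‖x‖ ^ p) 0 (complete L e) := by
      rw [← pathMean_add_one]
      refine pathMean_mono (fun x => ?_) _ _
      rcases le_total ‖x‖ 1 with hx | hx
      · linarith [Real.rpow_nonneg (norm_nonneg x) p]
      · linarith [Real.self_le_rpow_of_one_le hx hp]
    have h3 := mean_complete_le_one (fun x : E => ‖x‖ ^ p) L e fun k =>
      Real.rpow_le_one (norm_nonneg _) (he1 k) (by linarith)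
    have h4 := h (complete L e)
    have h5 := mul_le_mul_of_nonneg_left h3 hK
    linarith
  have hL : (0 : ℝ) < (L + 2) * (1 / 2 : ℝ) ^ (L + 1) := by positivity
  have h2 : ((L + 2) * (1 / 2 : ℝ) ^ (L + 1)) • posSup (Finset.range (2 ^ L)) e ≤
      pathAvg 0 (complete L e) := by
    rw [← le_inv_smul_iff_of_pos hL]
    refine posSup_le ?_ fun k hk => ?_
    · rw [le_inv_smul_iff_of_pos hL, smul_zero]
      exact le_pathAvg _ _
    · rw [le_inv_smul_iff_of_pos hL]
      exact le_pathAvg_complete L e he (Finset.mem_range.1 hk)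
  have h3 := norm_le_of_nonneg_of_le (smul_nonneg hL.le (posSup_nonneg _ _)) h2 h1
  rw [norm_smul, Real.norm_of_nonneg hL.le, mul_right_comm, one_div, inv_pow,
    ← div_eq_mul_inv, div_le_iff₀ (by positivity)] at h3
  linarith

end BinTree

/-! ### From one nontrivial block estimate to an upper estimate -/

section Blocks

variable {E : Type*} [NormedAddCommGroup E] [NormedSpace ℝ E]
  [Lattice E] [IsOrderedAddMonoid E] [IsOrderedModule ℝ E] [HasSolidNorm E]

theorem norm_posSup_range_le_mul {N : ℕ} {β : ℝ}
    (h : ∀ e : ℕ → E, (∀ k, 0 ≤ e k) → (∀ k, ‖e k‖ ≤ 1) → ‖posSup (Finset.range N) e‖ ≤ β)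
    {c : ℝ} (hc : 0 < c) (e : ℕ → E) (he : ∀ k, 0 ≤ e k) (hec : ∀ k, ‖e k‖ ≤ c) :
    ‖posSup (Finset.range N) e‖ ≤ c * β := by
  have h1 := h (fun k => c⁻¹ • e k) (fun k => smul_nonneg (inv_nonneg.2 hc.le) (he k)) fun k => by
    rw [norm_smul, norm_inv, Real.norm_of_nonneg hc.le, inv_mul_le_iff₀ hc, mul_one]
    exact hec k
  have h2 : posSup (Finset.range N) e ≤ c • posSup (Finset.range N) fun k => c⁻¹ • e k := by
    refine posSup_le (smul_nonneg hc.le (posSup_nonneg _ _)) fun k hk => ?_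
    rw [← inv_smul_le_iff_of_pos hc]
    exact le_posSup (fun k => c⁻¹ • e k) hk
  refine (norm_le_norm_of_nonneg_of_le (posSup_nonneg _ _) h2).trans ?_
  rw [norm_smul, Real.norm_of_nonneg hc.le]
  exact mul_le_mul_of_nonneg_left h1 hc.le

/-- Submultiplicativity: a supremum of N^(m+1) vectors is a supremum of N suprema of N^m vectors
each. -/
theorem norm_posSup_range_pow_le {N : ℕ} {β : ℝ} (hβ : 0 < β)
    (h : ∀ e : ℕ → E, (∀ k, 0 ≤ e k) → (∀ k, ‖e k‖ ≤ 1) → ‖posSup (Finset.range N) e‖ ≤ β)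
    (m : ℕ) (e : ℕ → E) (he : ∀ k, 0 ≤ e k) (he1 : ∀ k, ‖e k‖ ≤ 1) :
    ‖posSup (Finset.range (N ^ m)) e‖ ≤ β ^ m := by
  induction m generalizing e with
  | zero =>
    have h1 : posSup (Finset.range (N ^ 0)) e ≤ e 0 :=
      posSup_le (he 0) fun k hk => by
        obtain rfl : k = 0 := by simpa using hk
        exact le_rfl
    simpa using norm_le_of_nonneg_of_le (posSup_nonneg _ _) h1 (he1 0)
  | succ m ih =>
    set v : ℕ → E := fun j => posSup (Finset.range (N ^ m)) fun i => e (i + N ^ m * j) with hv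
    have h1 : posSup (Finset.range (N ^ (m + 1))) e ≤ posSup (Finset.range N) v := by
      refine posSup_le (posSup_nonneg _ _) fun k hk => ?_
      rw [Finset.mem_range, pow_succ] at hk
      have hpos : 0 < N ^ m := Nat.pos_of_ne_zero fun h0 => by simp [h0] at hk
      have hj : k / N ^ m < N := Nat.div_lt_of_lt_mul hk
      have hi : k % N ^ m < N ^ m := Nat.mod_lt _ hpos
      have h2 := le_posSup (fun i => e (i + N ^ m * (k / N ^ m))) (Finset.mem_range.2 hi)
      simp only [Nat.mod_add_div] at h2
      exact h2.trans (le_posSup v (Finset.mem_range.2 hj))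
    have h2 := norm_posSup_range_le_mul h (pow_pos hβ m) v (fun j => posSup_nonneg _ _)
      fun j => ih _ (fun i => he _) fun i => he1 _
    rw [pow_succ]
    exact norm_le_of_nonneg_of_le (posSup_nonneg _ _) h1 h2

theorem norm_posSup_le_of_card_le {N : ℕ} {β : ℝ}
    (h : ∀ e : ℕ → E, (∀ k, 0 ≤ e k) → (∀ k, ‖e k‖ ≤ 1) → ‖posSup (Finset.range N) e‖ ≤ β)
    {c : ℝ} (hc : 0 < c) {ι : Type*} (s : Finset ι) (hs : s.card ≤ N) (g : ι → E)
    (hg : ∀ i ∈ s, 0 ≤ g i) (hgc : ∀ i ∈ s, ‖g i‖ ≤ c) : ‖posSup s g‖ ≤ c * β := by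
  set e : ℕ → E := fun k => if hk : k < s.card then g (s.equivFin.symm ⟨k, hk⟩) else 0 with he
  have h1 : posSup s g ≤ posSup (Finset.range N) e := by
    refine posSup_le (posSup_nonneg _ _) fun i hi => ?_
    have h2 := le_posSup e (Finset.mem_range.2 ((s.equivFin ⟨i, hi⟩).2.trans_le hs))
    simpa [he] using h2
  refine norm_le_of_nonneg_of_le (posSup_nonneg _ _) h1
    (norm_posSup_range_le_mul h hc e (fun k => ?_) fun k => ?_)
  · simp only [he]
    split_ifs
    · exact hg _ (s.equivFin.symm _).2
    · exact le_rfl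
  · simp only [he]
    split_ifs
    · exact hgc _ (s.equivFin.symm _).2
    · simpa using hc.le

/-- Sort the vectors by the size of b k ^ r / T in powers of 1/N. Level j holds at most N^(j+1)
vectors, with norms at most S κ^(-j), so its supremum has norm at most S β (β/κ)^j. The hypothesis β
< κ makes these bounds summable. -/
theorem upperEstimate_of_block {N : ℕ} (hN : 1 < N) {β r : ℝ} (hβ : 0 < β) (hr : 0 < r)
    (hβr : β < (N : ℝ) ^ (1 / r))
    (h : ∀ e : ℕ → E, (∀ k, 0 ≤ e k) → (∀ k, ‖e k‖ ≤ 1) → ‖posSup (Finset.range N) e‖ ≤ β) :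
    ∃ C, 0 ≤ C ∧ UpperEstimate E r C := by
  have hN0 : (0 : ℝ) < N := by positivity
  have hN1 : (1 : ℝ) < N := by exact_mod_cast hN
  set κ : ℝ := (N : ℝ) ^ (1 / r) with hκ
  have hκ0 : 0 < κ := by positivity
  set ρ := β / κ with hρ
  have hρ0 : 0 ≤ ρ := by positivity
  have hρ1 : ρ < 1 := (div_lt_one hκ0).2 hβr
  refine ⟨β / (1 - ρ), div_nonneg hβ.le (by linarith), fun n e b he hb heb => ?_⟩
  rcases Nat.eq_zero_or_pos n with rfl | hn
  · have h0 : posSup (Finset.univ : Finset (Fin 0)) e = 0 := rfl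
    rw [h0, norm_zero]
    exact mul_nonneg (div_nonneg hβ.le (by linarith)) (by positivity)
  set T := ∑ k, b k ^ r with hT
  have hTpos : 0 < T := Finset.sum_pos (fun k _ => Real.rpow_pos_of_pos (hb k) r)
    ⟨⟨0, hn⟩, Finset.mem_univ _⟩
  set S := T ^ (1 / r) with hS
  have hS0 : 0 < S := by positivity
  have hlev : ∀ k, ∃ j : ℕ, (1 / (N : ℝ)) ^ (j + 1) < b k ^ r / T ∧
      b k ^ r / T ≤ (1 / (N : ℝ)) ^ j := by
    intro k
    refine exists_nat_pow_near_of_lt_one (div_pos (Real.rpow_pos_of_pos (hb k) r) hTpos) ?_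
      (by positivity) ((div_lt_one hN0).2 hN1)
    rw [div_le_one hTpos]
    exact Finset.single_le_sum (f := fun k => b k ^ r)
      (fun k _ => (Real.rpow_pos_of_pos (hb k) r).le) (Finset.mem_univ k)
  choose lev hlev1 hlev2 using hlev
  set J := Finset.univ.sup lev + 1 with hJ
  set s : ℕ → Finset (Fin n) := fun j => Finset.univ.filter fun k => lev k = j with hs
  have hle : posSup Finset.univ e ≤ ∑ j ∈ Finset.range J, posSup (s j) e := by
    refine posSup_le (Finset.sum_nonneg fun j _ => posSup_nonneg _ _) fun k _ => ?_
    have h1 : lev k ∈ Finset.range J :=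
      Finset.mem_range.2 (Nat.lt_succ_of_le (Finset.le_sup (Finset.mem_univ k)))
    have h2 : k ∈ s (lev k) := Finset.mem_filter.2 ⟨Finset.mem_univ k, rfl⟩
    exact (le_posSup e h2).trans
      (Finset.single_le_sum (f := fun j => posSup (s j) e) (fun j _ => posSup_nonneg _ _) h1)
  have hgroup : ∀ j, ‖posSup (s j) e‖ ≤ S * β * ρ ^ j := by
    intro j
    have hcard : (s j).card ≤ N ^ (j + 1) := by
      have h1 : ((s j).card : ℝ) * (1 / (N : ℝ)) ^ (j + 1) ≤ 1 := by
        calc ((s j).card : ℝ) * (1 / (N : ℝ)) ^ (j + 1) =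
              ∑ k ∈ s j, (1 / (N : ℝ)) ^ (j + 1) := by rw [Finset.sum_const, nsmul_eq_mul]
          _ ≤ ∑ k ∈ s j, b k ^ r / T := Finset.sum_le_sum fun k hk => by
              rw [← (Finset.mem_filter.1 hk).2]
              exact (hlev1 k).le
          _ ≤ ∑ k, b k ^ r / T := Finset.sum_le_sum_of_subset_of_nonneg (Finset.subset_univ _)
              fun k _ _ => (div_pos (Real.rpow_pos_of_pos (hb k) r) hTpos).le
          _ = 1 := by rw [← Finset.sum_div, ← hT, div_self hTpos.ne']
      rw [one_div, inv_pow, ← div_eq_mul_inv, div_le_one (by positivity)] at h1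
      exact_mod_cast h1
    have hbound : ∀ k ∈ s j, ‖e k‖ ≤ S * (κ⁻¹) ^ j := by
      intro k hk
      have h1 := hlev2 k
      rw [(Finset.mem_filter.1 hk).2, div_le_iff₀ hTpos] at h1
      have h2 := Real.rpow_le_rpow (Real.rpow_pos_of_pos (hb k) r).le h1
        (by positivity : 0 ≤ 1 / r)
      rw [← Real.rpow_mul (hb k).le, mul_one_div_cancel hr.ne', Real.rpow_one,
        Real.mul_rpow (by positivity) hTpos.le, ← Real.rpow_natCast, ← Real.rpow_mul (by positivity),
        mul_comm (j : ℝ), Real.rpow_mul (by positivity), one_div (N : ℝ),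
        Real.inv_rpow hN0.le, Real.rpow_natCast] at h2
      refine (heb k).trans (h2.trans (le_of_eq ?_))
      rw [mul_comm]
    have h1 := norm_posSup_le_of_card_le (norm_posSup_range_pow_le hβ h (j + 1))
      (by positivity : 0 < S * (κ⁻¹) ^ j) (s j) hcard e (fun k _ => he k) hbound
    refine h1.trans (le_of_eq ?_)
    rw [hρ, div_pow, inv_pow, pow_succ]
    field_simp
  calc ‖posSup Finset.univ e‖ ≤ ‖∑ j ∈ Finset.range J, posSup (s j) e‖ :=
        norm_le_norm_of_nonneg_of_le (posSup_nonneg _ _) hle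
    _ ≤ ∑ j ∈ Finset.range J, S * β * ρ ^ j :=
        (norm_sum_le _ _).trans (Finset.sum_le_sum fun j _ => hgroup j)
    _ = S * β * ∑ j ∈ Finset.range J, ρ ^ j := by rw [Finset.mul_sum]
    _ ≤ S * β * (1 / (1 - ρ)) := by
        refine mul_le_mul_of_nonneg_left ?_ (by positivity)
        have h1 := mul_neg_geom_sum ρ J
        rw [le_div_iff₀ (by linarith)]
        have h2 : 0 ≤ ρ ^ J := by positivity
        linarith
    _ = β / (1 - ρ) * S := by ring

theorem BinTree.MaximalBound.exists_upperEstimate {p K : ℝ} (hp : 1 ≤ p) (hK : 0 ≤ K)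
    (h : BinTree.MaximalBound E p K) : ∃ r C, 1 < r ∧ 0 ≤ C ∧ UpperEstimate E r C := by
  -- For such L the tree estimate gives 2^(L-1) as bound for 2^L vectors of the unit ball. With r =
  -- L / (L - 1/2), the critical value (2^L)^(1/r) is 2^(L-1/2), which is strictly larger.
  obtain ⟨L, hL⟩ := exists_nat_gt (4 * (1 + K))
  have hL1 : (1 : ℝ) < L := by linarith
  have hL1' : 1 < L := by exact_mod_cast hL1
  set r : ℝ := L / (L - 1 / 2) with hr
  have hr1 : 1 < r := by
    rw [hr, one_lt_div (by linarith)]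
    linarith
  have hN : 1 < 2 ^ L := Nat.one_lt_two_pow (by omega)
  have hpow : (((2 ^ L : ℕ) : ℝ)) ^ (1 / r) = (2 : ℝ) ^ ((L : ℝ) - 1 / 2) := by
    push_cast
    rw [← Real.rpow_natCast, ← Real.rpow_mul (by norm_num), hr, one_div_div]
    congr 1
    field_simp
  obtain ⟨C, hC0, hC⟩ := upperEstimate_of_block (E := E) (β := 2 ^ ((L : ℝ) - 1)) (r := r) hN
    (by positivity) (by linarith) (by
      rw [hpow]
      exact Real.rpow_lt_rpow_of_exponent_lt (by norm_num) (by linarith)) fun e he he1 => by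
    have h1 := h.norm_posSup_range_le hp hK L e he he1
    have h2 : (2 : ℝ) ^ ((L : ℝ) - 1) * 4 = 2 ^ (L + 1) := by
      rw [Real.rpow_sub_one (by norm_num), Real.rpow_natCast, pow_succ]
      ring
    rw [← h2] at h1
    have h3 : (0 : ℝ) < 2 ^ ((L : ℝ) - 1) := by positivity
    have h4 : (2 : ℝ) ^ ((L : ℝ) - 1) * 4 * (1 + K) ≤ (L + 2) * 2 ^ ((L : ℝ) - 1) := by nlinarith
    exact le_of_mul_le_mul_left (h1.trans h4) (by linarith)
  exact ⟨r, C, hr1, hC0, hC⟩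

end Blocks

/-! ### Dyadic cubes -/

section Cubes

variable {d : ℕ}

/-- The dyadic cube `2⁻ᵏ([0,1)ᵈ + m)`. -/
def dyadicCube (k : ℤ) (m : Fin d → ℤ) : Set (Fin d → ℝ) :=
  {x | ∀ i, (2 : ℝ) ^ (-k) * m i ≤ x i ∧ x i < (2 : ℝ) ^ (-k) * (m i + 1)}

theorem isDyadicCube_dyadicCube (k : ℤ) (m : Fin d → ℤ) : IsDyadicCube (dyadicCube k m) :=
  ⟨k, m, rfl⟩

/-- Reduces nesting and disjointness of cubes to integer arithmetic on floors. -/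
theorem mem_dyadicCube_iff {k : ℤ} {m : Fin d → ℤ} {x : Fin d → ℝ} :
    x ∈ dyadicCube k m ↔ ∀ i, ⌊(2 : ℝ) ^ k * x i⌋ = m i := by
  have hk : (0 : ℝ) < 2 ^ k := by positivity
  refine forall_congr' fun i => ?_
  rw [Int.floor_eq_iff, zpow_neg, inv_mul_le_iff₀ hk, lt_inv_mul_iff₀ hk]

theorem dyadicCube_eq_pi (k : ℤ) (m : Fin d → ℤ) : dyadicCube k m =
    Set.univ.pi fun i => Set.Ico ((2 : ℝ) ^ (-k) * m i) ((2 : ℝ) ^ (-k) * (m i + 1)) := by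
  ext x
  simp [dyadicCube]

theorem measurableSet_dyadicCube (k : ℤ) (m : Fin d → ℤ) : MeasurableSet (dyadicCube k m) := by
  rw [dyadicCube_eq_pi]
  exact MeasurableSet.univ_pi fun i => measurableSet_Ico

theorem volume_dyadicCube (k : ℤ) (m : Fin d → ℤ) :
    volume (dyadicCube k m) = ENNReal.ofReal (((2 : ℝ) ^ (-k)) ^ d) := by
  rw [dyadicCube_eq_pi, Real.volume_pi_Ico, ENNReal.ofReal_pow (by positivity)]
  have h : ∀ i, (2 : ℝ) ^ (-k) * (m i + 1) - (2 : ℝ) ^ (-k) * m i = 2 ^ (-k) := fun i => by ring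
  simp only [h]
  simp

theorem volume_real_dyadicCube (k : ℤ) (m : Fin d → ℤ) :
    volume.real (dyadicCube k m) = ((2 : ℝ) ^ (-k)) ^ d := by
  rw [Measure.real, volume_dyadicCube, ENNReal.toReal_ofReal (by positivity)]

theorem floor_two_mul_ediv (y : ℝ) : ⌊2 * y⌋ / 2 = ⌊y⌋ := by
  have h1 := Int.floor_le y
  have h2 := Int.lt_floor_add_one y
  have h3 : 2 * ⌊y⌋ ≤ ⌊2 * y⌋ := Int.le_floor.2 (by push_cast; linarith)
  have h4 : ⌊2 * y⌋ < 2 * ⌊y⌋ + 2 := Int.floor_lt.2 (by push_cast; linarith)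
  omega

/-- The index of a child of a dyadic cube. -/
def childIndex (m : Fin d → ℤ) (ε : Fin d → Fin 2) (i : Fin d) : ℤ :=
  2 * m i + ((ε i : ℕ) : ℤ)

theorem floor_succ_ediv (k : ℤ) (y : ℝ) : ⌊(2 : ℝ) ^ (k + 1) * y⌋ / 2 = ⌊(2 : ℝ) ^ k * y⌋ := by
  rw [zpow_add_one₀ (by norm_num), mul_comm ((2 : ℝ) ^ k), mul_assoc, floor_two_mul_ediv]

theorem dyadicCube_eq_iUnion (k : ℤ) (m : Fin d → ℤ) :
    dyadicCube k m = ⋃ ε : Fin d → Fin 2, dyadicCube (k + 1) (childIndex m ε) := by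
  ext x
  simp only [Set.mem_iUnion, mem_dyadicCube_iff, childIndex]
  constructor
  · intro h
    have h1 : ∀ i, ∃ b : Fin 2, ⌊(2 : ℝ) ^ (k + 1) * x i⌋ = 2 * m i + ((b : ℕ) : ℤ) := by
      intro i
      have h2 := floor_succ_ediv k (x i)
      rw [h i] at h2
      refine ⟨⟨(⌊(2 : ℝ) ^ (k + 1) * x i⌋ % 2).toNat, by omega⟩, ?_⟩
      simp only
      omega
    choose ε hε using h1
    exact ⟨ε, hε⟩
  · rintro ⟨ε, hε⟩ i
    have h2 := floor_succ_ediv k (x i)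
    rw [hε i] at h2
    have := (ε i).2
    omega

theorem dyadicCube_child_subset (k : ℤ) (m : Fin d → ℤ) (ε : Fin d → Fin 2) :
    dyadicCube (k + 1) (childIndex m ε) ⊆ dyadicCube k m := by
  rw [dyadicCube_eq_iUnion k m]
  exact Set.subset_iUnion (fun ε => dyadicCube (k + 1) (childIndex m ε)) ε

theorem pairwise_disjoint_children (k : ℤ) (m : Fin d → ℤ) :
    Pairwise (Function.onFun Disjoint fun ε : Fin d → Fin 2 =>
      dyadicCube (k + 1) (childIndex m ε)) := by
  intro ε ε' hne
  refine Set.disjoint_left.2 fun x hx hx' => hne ?_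
  rw [mem_dyadicCube_iff] at hx hx'
  ext i
  have := (hx i).symm.trans (hx' i)
  simp only [childIndex] at this
  omega

/-- Half of the 2^d children of a cube lie on each side in the direction i₀, which is why a binary
tree can be realised in any dimension d ≥ 1. -/
theorem sum_apply_eq {M : Type*} [AddCommMonoid M] (i₀ : Fin d) (F : Fin 2 → M) :
    ∃ n : ℕ, 2 * n = 2 ^ d ∧ ∑ ε : Fin d → Fin 2, F (ε i₀) = n • (F 0 + F 1) := by
  refine ⟨Fintype.card ({j // j ≠ i₀} → Fin 2), ?_, ?_⟩
  · have h := Fintype.card_congr (Equiv.funSplitAt i₀ (Fin 2))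
    simpa [Fintype.card_prod] using h.symm
  · rw [Fintype.sum_equiv (Equiv.funSplitAt i₀ (Fin 2)) (fun ε => F (ε i₀)) (fun y => F y.1)
      (fun ε => rfl), Fintype.sum_prod_type]
    simp [Fin.sum_univ_two, smul_add, Finset.card_univ]

theorem two_zpow_neg_pow (k : ℤ) : (2 : ℝ) ^ d * ((2 : ℝ) ^ (-(k + 1))) ^ d = ((2 : ℝ) ^ (-k)) ^ d := by
  rw [← mul_pow, neg_add, zpow_add₀ (by norm_num)]
  congr 1
  norm_num
  ring

end Cubes

/-! ### Realisation of binary trees on dyadic cubes -/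

namespace BinTree

variable {d : ℕ} {E F : Type*}

/-- One of the two subtrees. -/
def select (l r : BinTree E) (b : Fin 2) : BinTree E := if b = 0 then l else r

/-- The dyadic step function realising a tree; the parity of the `i₀`-th coordinate at scale
`2⁻ᵏ⁻¹` decides between the subtrees. -/
def stepFunction (i₀ : Fin d) : BinTree E → ℤ → (Fin d → ℝ) → E
  | leaf e, _, _ => e
  | node l r, k, x => if ⌊(2 : ℝ) ^ (k + 1) * x i₀⌋ % 2 = 0 then stepFunction i₀ l (k + 1) x
      else stepFunction i₀ r (k + 1) x

/-- Apply a function to all the leaves. -/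
def map (φ : E → F) : BinTree E → BinTree F
  | leaf e => leaf (φ e)
  | node l r => node (map φ l) (map φ r)

theorem stepFunction_map (φ : E → F) (i₀ : Fin d) (t : BinTree E) (k : ℤ) (x : Fin d → ℝ) :
    stepFunction i₀ (map φ t) k x = φ (stepFunction i₀ t k x) := by
  induction t generalizing k with
  | leaf e => rfl
  | node l r hl hr =>
    simp only [map, stepFunction, hl, hr]
    split_ifs <;> rfl

theorem stepFunction_node (i₀ : Fin d) (l r : BinTree E) (k : ℤ) (m : Fin d → ℤ)
    (ε : Fin d → Fin 2) {x : Fin d → ℝ} (hx : x ∈ dyadicCube (k + 1) (childIndex m ε)) :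
    stepFunction i₀ (node l r) k x = stepFunction i₀ (select l r (ε i₀)) (k + 1) x := by
  have h := mem_dyadicCube_iff.1 hx i₀
  have h2 := (ε i₀).2
  simp only [stepFunction, select, h, childIndex]
  by_cases h0 : ε i₀ = 0
  · rw [if_pos h0, if_pos (by simp [h0])]
  · rw [if_neg h0, if_neg]
    have : ((ε i₀ : Fin 2) : ℕ) ≠ 0 := fun h => h0 (Fin.ext h)
    omega

open scoped Classical in
/-- The dyadic cubes belonging to the nodes of a tree. -/
def cubes (i₀ : Fin d) : BinTree E → ℤ → (Fin d → ℤ) → Finset (Set (Fin d → ℝ))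
  | leaf _, k, m => {dyadicCube k m}
  | node l r, k, m => insert (dyadicCube k m) (Finset.univ.biUnion fun ε : Fin d → Fin 2 =>
      if ε i₀ = 0 then cubes i₀ l (k + 1) (childIndex m ε)
      else cubes i₀ r (k + 1) (childIndex m ε))

theorem cubes_node_subset (i₀ : Fin d) (l r : BinTree E) (k : ℤ) (m : Fin d → ℤ)
    (ε : Fin d → Fin 2) :
    cubes i₀ (select l r (ε i₀)) (k + 1) (childIndex m ε) ⊆ cubes i₀ (node l r) k m := by
  intro Q hQ
  simp only [cubes, Finset.mem_insert, Finset.mem_biUnion, Finset.mem_univ, true_and]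
  refine Or.inr ⟨ε, ?_⟩
  unfold select at hQ
  split_ifs at hQ ⊢ <;> exact hQ

theorem dyadicCube_mem_cubes (i₀ : Fin d) (t : BinTree E) (k : ℤ) (m : Fin d → ℤ) :
    dyadicCube k m ∈ cubes i₀ t k m := by
  cases t <;> simp [cubes]

theorem isDyadicCube_of_mem_cubes (i₀ : Fin d) (t : BinTree E) (k : ℤ) (m : Fin d → ℤ)
    {Q : Set (Fin d → ℝ)} (hQ : Q ∈ cubes i₀ t k m) : IsDyadicCube Q := by
  induction t generalizing k m with
  | leaf e =>
    rw [cubes, Finset.mem_singleton] at hQ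
    exact hQ ▸ isDyadicCube_dyadicCube k m
  | node l r hl hr =>
    simp only [cubes, Finset.mem_insert, Finset.mem_biUnion, Finset.mem_univ, true_and] at hQ
    rcases hQ with rfl | ⟨ε, hε⟩
    · exact isDyadicCube_dyadicCube k m
    · split_ifs at hε
      · exact hl _ _ hε
      · exact hr _ _ hε

variable [NormedAddCommGroup E] [NormedSpace ℝ E] [CompleteSpace E]

theorem integral_stepFunction (i₀ : Fin d) (t : BinTree E) (k : ℤ) (m : Fin d → ℤ)
    {f : (Fin d → ℝ) → E} (hf : ∀ x ∈ dyadicCube k m, f x = stepFunction i₀ t k x) :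
    IntegrableOn f (dyadicCube k m) volume ∧
      ∫ x in dyadicCube k m, f x = (((2 : ℝ) ^ (-k)) ^ d) • avg t := by
  induction t generalizing k m with
  | leaf e =>
    have hm := measurableSet_dyadicCube k m
    constructor
    · exact (integrableOn_congr_fun hf hm).2 (integrableOn_const (by
        rw [volume_dyadicCube]
        exact ENNReal.ofReal_ne_top))
    · rw [setIntegral_congr_fun hm hf]
      simp only [stepFunction]
      rw [setIntegral_const, volume_real_dyadicCube, avg]
  | node l r hl hr =>
    have hchild : ∀ ε : Fin d → Fin 2, IntegrableOn f (dyadicCube (k + 1) (childIndex m ε)) volume ∧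
        ∫ x in dyadicCube (k + 1) (childIndex m ε), f x =
          (((2 : ℝ) ^ (-(k + 1))) ^ d) • avg (select l r (ε i₀)) := by
      intro ε
      have h1 : ∀ x ∈ dyadicCube (k + 1) (childIndex m ε),
          f x = stepFunction i₀ (select l r (ε i₀)) (k + 1) x := fun x hx =>
        (hf x (dyadicCube_child_subset k m ε hx)).trans (stepFunction_node i₀ l r k m ε hx)
      by_cases h0 : ε i₀ = 0
      · simp only [select, if_pos h0] at h1 ⊢
        exact hl _ _ h1
      · simp only [select, if_neg h0] at h1 ⊢
        exact hr _ _ h1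
    rw [dyadicCube_eq_iUnion]
    refine ⟨integrableOn_finite_iUnion.2 fun ε => (hchild ε).1, ?_⟩
    rw [integral_iUnion_fintype (fun ε => measurableSet_dyadicCube _ _)
      (pairwise_disjoint_children k m) fun ε => (hchild ε).1]
    simp only [fun ε => (hchild ε).2]
    obtain ⟨n, hn, hsum⟩ := sum_apply_eq i₀ fun b => avg (select l r b)
    rw [← Finset.smul_sum, hsum]
    have hn' : (n : ℝ) = 2 ^ d / 2 := by
      have : (2 : ℝ) * n = 2 ^ d := by exact_mod_cast hn
      linarith
    have h01 : select l r 0 = l ∧ select l r 1 = r := by simp [select]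
    rw [h01.1, h01.2, ← Nat.cast_smul_eq_nsmul ℝ, smul_smul, avg, smul_smul, hn',
      ← two_zpow_neg_pow k]
    congr 1
    ring

theorem avg_map (φ : E → ℝ) (t : BinTree E) : avg (map φ t) = mean φ t := by
  induction t with
  | leaf e => rfl
  | node l r hl hr =>
    simp only [map, avg, mean, hl, hr, smul_eq_mul]
    ring

variable [Lattice E] [IsOrderedAddMonoid E] [IsOrderedModule ℝ E] [HasSolidNorm E]

theorem avg_le_cubeAverage (i₀ : Fin d) (t : BinTree E) (k : ℤ) (m : Fin d → ℤ)
    {f : (Fin d → ℝ) → E} (hf : ∀ x ∈ dyadicCube k m, f x = stepFunction i₀ t k x)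
    {x : Fin d → ℝ} (hx : x ∈ dyadicCube k m) :
    avg t ≤ cubeAverage volume f x (dyadicCube k m) := by
  obtain ⟨hint, heq⟩ := integral_stepFunction i₀ t k m hf
  rw [cubeAverage, Set.indicator_of_mem hx, setAverage_eq, volume_real_dyadicCube]
  have hpos : (0 : ℝ) < ((2 : ℝ) ^ (-k)) ^ d := by positivity
  rw [le_inv_smul_iff_of_pos hpos, ← heq]
  exact integral_mono hint (Integrable.abs hint) fun y => le_abs_self _

/-- Induction on the tree with the running supremum w inside the integrand: on its cube a node
average lies below the maximal function, so adding it to w leaves the integrand unchanged. -/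
theorem pathMean_le_lintegral {p : ℝ} (hp : 0 ≤ p) (i₀ : Fin d) (t : BinTree E) (k : ℤ)
    (m : Fin d → ℤ) {f : (Fin d → ℝ) → E}
    (hf : ∀ x ∈ dyadicCube k m, f x = stepFunction i₀ t k x) {D : Finset (Set (Fin d → ℝ))}
    (hD : cubes i₀ t k m ⊆ D) {w : E} (hw : 0 ≤ w) :
    ENNReal.ofReal (((2 : ℝ) ^ (-k)) ^ d * pathMean (fun x => ‖x‖ ^ p) w t) ≤
      ∫⁻ x in dyadicCube k m, ENNReal.ofReal (‖w ⊔ posSup D (cubeAverage volume f x)‖ ^ p) := by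
  have hmax : ∀ x ∈ dyadicCube k m, avg t ≤ posSup D (cubeAverage volume f x) := fun x hx =>
    (avg_le_cubeAverage i₀ t k m hf hx).trans
      (le_posSup (cubeAverage volume f x) (hD (dyadicCube_mem_cubes i₀ t k m)))
  induction t generalizing k m w with
  | leaf e =>
    have hm := measurableSet_dyadicCube k m
    have h1 : ∫⁻ _x in dyadicCube k m, ENNReal.ofReal (‖w ⊔ e‖ ^ p) =
        ENNReal.ofReal (((2 : ℝ) ^ (-k)) ^ d * pathMean (fun x => ‖x‖ ^ p) w (leaf e)) := by
      rw [setLIntegral_const, volume_dyadicCube, ← ENNReal.ofReal_mul (by positivity), mul_comm,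
        pathMean]
    rw [← h1]
    refine setLIntegral_mono' hm fun x hx => ENNReal.ofReal_le_ofReal ?_
    exact Real.rpow_le_rpow (norm_nonneg _) (norm_le_norm_of_nonneg_of_le
      (hw.trans le_sup_left) (sup_le_sup_left (hmax x hx) w)) hp
  | node l r hl hr =>
    set v := w ⊔ (1 / 2 : ℝ) • (avg l + avg r) with hv
    have hv0 : 0 ≤ v := hw.trans le_sup_left
    have hchild : ∀ ε : Fin d → Fin 2,
        ENNReal.ofReal (((2 : ℝ) ^ (-(k + 1))) ^ d *
          pathMean (fun x => ‖x‖ ^ p) v (select l r (ε i₀))) ≤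
        ∫⁻ x in dyadicCube (k + 1) (childIndex m ε),
          ENNReal.ofReal (‖w ⊔ posSup D (cubeAverage volume f x)‖ ^ p) := by
      intro ε
      have hcong : ∫⁻ x in dyadicCube (k + 1) (childIndex m ε),
          ENNReal.ofReal (‖w ⊔ posSup D (cubeAverage volume f x)‖ ^ p) =
          ∫⁻ x in dyadicCube (k + 1) (childIndex m ε),
          ENNReal.ofReal (‖v ⊔ posSup D (cubeAverage volume f x)‖ ^ p) := by
        refine setLIntegral_congr_fun (measurableSet_dyadicCube _ _) fun x hx => ?_
        have h2 := hmax x (dyadicCube_child_subset k m ε hx)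
        have h3 : v ⊔ posSup D (cubeAverage volume f x) = w ⊔ posSup D (cubeAverage volume f x) := by
          rw [hv, sup_assoc]
          exact congrArg (w ⊔ ·) (sup_of_le_right h2)
        simp only [h3]
      rw [hcong]
      have h1 : ∀ x ∈ dyadicCube (k + 1) (childIndex m ε),
          f x = stepFunction i₀ (select l r (ε i₀)) (k + 1) x := fun x hx =>
        (hf x (dyadicCube_child_subset k m ε hx)).trans (stepFunction_node i₀ l r k m ε hx)
      have hD' := (cubes_node_subset i₀ l r k m ε).trans hD
      have h4 : ∀ x ∈ dyadicCube (k + 1) (childIndex m ε),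
          avg (select l r (ε i₀)) ≤ posSup D (cubeAverage volume f x) := fun x hx =>
        (avg_le_cubeAverage i₀ _ _ _ h1 hx).trans
          (le_posSup (cubeAverage volume f x) (hD' (dyadicCube_mem_cubes i₀ _ _ _)))
      by_cases h0 : ε i₀ = 0
      · simp only [select, if_pos h0] at h1 h4 hD' ⊢
        exact hl _ _ h1 hD' hv0 h4
      · simp only [select, if_neg h0] at h1 h4 hD' ⊢
        exact hr _ _ h1 hD' hv0 h4
    have hnn : ∀ (s : BinTree E) (u : E), 0 ≤ pathMean (fun x => ‖x‖ ^ p) u s := fun s u =>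
      pathMean_nonneg (fun x => Real.rpow_nonneg (norm_nonneg x) p) s u
    obtain ⟨n, hn, hsum⟩ := sum_apply_eq i₀ fun b => ((2 : ℝ) ^ (-(k + 1))) ^ d *
          pathMean (fun x => ‖x‖ ^ p) v (select l r b)
    have hn' : (n : ℝ) = 2 ^ d / 2 := by
      have : (2 : ℝ) * n = 2 ^ d := by exact_mod_cast hn
      linarith
    have htot : ((2 : ℝ) ^ (-k)) ^ d * pathMean (fun x => ‖x‖ ^ p) w (node l r) =
        ∑ ε : Fin d → Fin 2, ((2 : ℝ) ^ (-(k + 1))) ^ d *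
          pathMean (fun x => ‖x‖ ^ p) v (select l r (ε i₀)) := by
      have h01 : select l r 0 = l ∧ select l r 1 = r := by simp [select]
      rw [hsum, h01.1, h01.2, nsmul_eq_mul, hn', ← two_zpow_neg_pow k, pathMean, ← hv]
      ring
    rw [htot, ENNReal.ofReal_sum_of_nonneg fun ε _ => mul_nonneg (by positivity) (hnn _ _),
      dyadicCube_eq_iUnion, lintegral_iUnion (fun ε => measurableSet_dyadicCube _ _)
      (pairwise_disjoint_children k m), tsum_fintype]
    exact Finset.sum_le_sum fun ε _ => hchild ε

end BinTree

/-- The tree is realised as a step function on the unit cube, with the cubes of its nodes as the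
collection D. The L^p norm of the function is then the tree mean, and K is the p-th power of the
operator bound. -/
theorem HardyLittlewoodProperty.exists_maximalBound {d : ℕ} (i₀ : Fin d) {E : Type*}
    [NormedAddCommGroup E] [NormedSpace ℝ E] [CompleteSpace E] [Lattice E] [IsOrderedAddMonoid E]
    [IsOrderedModule ℝ E] [HasSolidNorm E] (h : HardyLittlewoodProperty d E) :
    ∃ p K : ℝ, 1 < p ∧ 0 ≤ K ∧ BinTree.MaximalBound E p K := by
  obtain ⟨p, hp1, hptop, C, hC⟩ := h
  have hp0 : p ≠ 0 := (zero_lt_one.trans hp1).ne'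
  have hpr : 1 < p.toReal := by
    rw [← ENNReal.toReal_one]
    exact (ENNReal.toReal_lt_toReal ENNReal.one_ne_top hptop.ne).2 hp1
  have hpr0 : 0 < p.toReal := by linarith
  refine ⟨p.toReal, (C : ℝ) ^ p.toReal, hpr, by positivity, fun t => ?_⟩
  set Q : Set (Fin d → ℝ) := dyadicCube 0 0 with hQ
  have hQm : MeasurableSet Q := measurableSet_dyadicCube _ _
  set g := t.stepFunction i₀ 0 with hg
  set f : (Fin d → ℝ) → E := Q.indicator g with hf
  have hfg : ∀ x ∈ Q, f x = g x := fun x hx => Set.indicator_of_mem hx g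
  set D := t.cubes i₀ 0 0 with hD
  obtain ⟨hgint, -⟩ := BinTree.integral_stepFunction i₀ t 0 0 (f := g) fun x _ => rfl
  obtain ⟨hpint, hpeq⟩ := BinTree.integral_stepFunction i₀ (t.map fun x => ‖x‖ ^ p.toReal) 0 0
    (f := fun x => ‖g x‖ ^ p.toReal)
    fun x _ => (BinTree.stepFunction_map (fun x => ‖x‖ ^ p.toReal) i₀ t 0 x).symm
  rw [BinTree.avg_map] at hpeq
  simp only [neg_zero, zpow_zero, one_pow, one_smul] at hpeq
  have hmem : MemLp f p volume := (memLp_indicator_iff_restrict hQm).2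
    ((integrable_norm_rpow_iff hgint.aestronglyMeasurable hp0 hptop.ne).1 hpint)
  have h1 := hC D (fun Q hQ => BinTree.isDyadicCube_of_mem_cubes i₀ t 0 0 hQ) f hmem
  have h2 : ENNReal.ofReal (BinTree.pathMean (fun x => ‖x‖ ^ p.toReal) 0 t) ≤
      eLpNorm (latticeMaximal volume D f) p volume ^ p.toReal := by
    have h3 := BinTree.pathMean_le_lintegral hpr0.le i₀ t 0 0 hfg (subset_refl D) (le_refl (0 : E))
    simp only [neg_zero, zpow_zero, one_pow, one_mul] at h3
    rw [eLpNorm_eq_lintegral_rpow_enorm_toReal hp0 hptop.ne, ← ENNReal.rpow_mul,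
      one_div_mul_cancel hpr0.ne', ENNReal.rpow_one]
    refine h3.trans ((setLIntegral_le_lintegral _ _).trans (lintegral_mono fun x => ?_))
    simp only
    rw [sup_of_le_right (posSup_nonneg _ _), latticeMaximal_eq_posSup,
      ← ENNReal.ofReal_rpow_of_nonneg (norm_nonneg _) hpr0.le, ofReal_norm]
  have h4 : eLpNorm f p volume ^ p.toReal =
      ENNReal.ofReal (BinTree.mean (fun x => ‖x‖ ^ p.toReal) t) := by
    rw [hf, eLpNorm_indicator_eq_eLpNorm_restrict hQm,
      eLpNorm_eq_lintegral_rpow_enorm_toReal hp0 hptop.ne, ← ENNReal.rpow_mul,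
      one_div_mul_cancel hpr0.ne', ENNReal.rpow_one, ← hpeq,
      ofReal_integral_eq_lintegral_ofReal hpint
        (Filter.Eventually.of_forall fun x => Real.rpow_nonneg (norm_nonneg _) _)]
    refine lintegral_congr fun x => ?_
    rw [← ENNReal.ofReal_rpow_of_nonneg (norm_nonneg _) hpr0.le, ofReal_norm]
  have h5 := h2.trans (ENNReal.rpow_le_rpow h1 hpr0.le)
  have hmean : 0 ≤ BinTree.mean (fun x => ‖x‖ ^ p.toReal) t :=
    BinTree.mean_nonneg (fun x => Real.rpow_nonneg (norm_nonneg x) _) t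
  rw [ENNReal.mul_rpow_of_nonneg _ _ hpr0.le, h4, ← ENNReal.ofReal_coe_nnreal,
    ENNReal.ofReal_rpow_of_nonneg C.coe_nonneg hpr0.le, ← ENNReal.ofReal_mul (by positivity),
    ENNReal.ofReal_le_ofReal_iff (mul_nonneg (by positivity) hmean)] at h5
  exact h5

/-! ### The weak-type estimate for arbitrary measures -/

section WeakType

variable {d : ℕ} {E : Type*} [NormedAddCommGroup E] [NormedSpace ℝ E] [CompleteSpace E]
  [Lattice E] [IsOrderedAddMonoid E] [IsOrderedModule ℝ E] [HasSolidNorm E]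

/-- Any two members of the collection are nested or disjoint. -/
def IsLaminar {X : Type*} (D : Finset (Set X)) : Prop :=
  ∀ P ∈ D, ∀ R ∈ D, P ⊆ R ∨ R ⊆ P ∨ Disjoint P R

theorem IsLaminar.subset {X : Type*} {D D' : Finset (Set X)} (h : IsLaminar D) (hD : D' ⊆ D) :
    IsLaminar D' :=
  fun P hP R hR => h P (hD hP) R (hD hR)

/-- Lets a maximal member be split off: every other member lies inside it or misses it. -/
theorem IsLaminar.disjoint_of_maximal {X : Type*} {D : Finset (Set X)} (h : IsLaminar D)
    {P R : Set X} (hP : P ∈ D) (hmax : ∀ T ∈ D, P ⊆ T → T ⊆ P) (hR : R ∈ D) (hRP : ¬ R ⊆ P) :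
    Disjoint R P := by
  rcases h P hP R hR with h1 | h1 | h1
  · exact absurd (hmax R hR h1) hRP
  · exact absurd h1 hRP
  · exact h1.symm

theorem exists_maximal_set {X : Type*} {D : Finset (Set X)} (hD : D.Nonempty) :
    ∃ P ∈ D, ∀ T ∈ D, P ⊆ T → T ⊆ P := by
  obtain ⟨P, hP⟩ := D.exists_maximal hD
  exact ⟨P, hP.1, fun T hT h => hP.2 hT h⟩

theorem exists_minimal_set {X : Type*} {D : Finset (Set X)} (hD : D.Nonempty) :
    ∃ P ∈ D, ∀ T ∈ D, T ⊆ P → P ⊆ T := by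
  obtain ⟨P, hP⟩ := D.exists_minimal hD
  exact ⟨P, hP.1, fun T hT h => hP.2 hT h⟩

variable {μ : Measure (Fin d → ℝ)} {f : (Fin d → ℝ) → E}

theorem measureReal_smul_average_abs {Q : Set (Fin d → ℝ)} (hQ : μ Q ≠ ⊤) :
    μ.real Q • ⨍ y in Q, |f y| ∂μ = ∫ y in Q, |f y| ∂μ :=
  measure_smul_setAverage _ hQ

theorem measureReal_mul_norm_average_le {Q : Set (Fin d → ℝ)} (hQ : μ Q ≠ ⊤) :
    μ.real Q * ‖⨍ y in Q, |f y| ∂μ‖ ≤ ∫ y in Q, ‖f y‖ ∂μ := by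
  have h := norm_integral_le_integral_norm (μ := μ.restrict Q) fun y => |f y|
  simp only [norm_abs_eq_norm] at h
  rwa [← measureReal_smul_average_abs hQ, norm_smul, Real.norm_of_nonneg measureReal_nonneg] at h

theorem norm_average_abs_le (Q : Set (Fin d → ℝ)) :
    ‖⨍ y in Q, |f y| ∂μ‖ ≤ ⨍ y in Q, ‖f y‖ ∂μ := by
  rw [setAverage_eq, setAverage_eq, norm_smul, norm_inv, Real.norm_of_nonneg measureReal_nonneg,
    smul_eq_mul]
  refine mul_le_mul_of_nonneg_left ?_ (inv_nonneg.2 measureReal_nonneg)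
  simpa only [norm_abs_eq_norm] using
    norm_integral_le_integral_norm (μ := μ.restrict Q) fun y => |f y|

theorem cubeAverage_of_notMem {x : Fin d → ℝ} {Q : Set (Fin d → ℝ)} (h : x ∉ Q) :
    cubeAverage μ f x Q = 0 :=
  Set.indicator_of_notMem h _

theorem cubeAverage_of_mem {x : Fin d → ℝ} {Q : Set (Fin d → ℝ)} (h : x ∈ Q) :
    cubeAverage μ f x Q = ⨍ y in Q, |f y| ∂μ :=
  Set.indicator_of_mem h _

theorem posSup_cubeAverage_le {D D' : Finset (Set (Fin d → ℝ))} {x : Fin d → ℝ}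
    (h : ∀ R ∈ D, x ∈ R → R ∈ D') :
    posSup D (cubeAverage μ f x) ≤ posSup D' (cubeAverage μ f x) := by
  refine posSup_le (posSup_nonneg _ _) fun R hR => ?_
  by_cases hx : x ∈ R
  · exact le_posSup (cubeAverage μ f x) (h R hR hx)
  · rw [cubeAverage_of_notMem hx]
    exact posSup_nonneg _ _

-- The Bellman function dominates the level set minus A times the mass of ‖f‖, by induction on the
-- number of sets. A maximal member is either the whole set, and its average is absorbed into w, or
-- it splits the set in two, and concavity recombines the pieces. Since the complement of a cube is
-- not a cube, Q is an arbitrary measurable set.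
open BinTree in
theorem measure_le_bellman {A : ℝ} (hA : 0 ≤ A) (n : ℕ) (Q : Set (Fin d → ℝ))
    (hQm : MeasurableSet Q) (hQ : μ Q ≠ ⊤) (hf : IntegrableOn f Q μ)
    (D : Finset (Set (Fin d → ℝ))) (hcard : D.card ≤ n) (hD : ∀ R ∈ D, MeasurableSet R ∧ R ⊆ Q)
    (hlam : IsLaminar D) (w : E) (hw : 0 ≤ w) :
    μ.real {x | x ∈ Q ∧ 1 < ‖w ⊔ posSup D (cubeAverage μ f x)‖} - A * ∫ y in Q, ‖f y‖ ∂μ ≤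
      μ.real Q * bellman A (⨍ y in Q, |f y| ∂μ) w := by
  classical
  induction n generalizing Q D w with
  | zero =>
    obtain rfl : D = ∅ := by simpa using hcard
    have h1 : μ.real {x | x ∈ Q ∧ 1 < ‖w ⊔ posSup ∅ (cubeAverage μ f x)‖} ≤
        μ.real Q * outside (w ⊔ ⨍ y in Q, |f y| ∂μ) := by
      simp only [posSup_empty, sup_of_le_left hw]
      have h2 : outside w ≤ outside (w ⊔ ⨍ y in Q, |f y| ∂μ) := outside_mono hw le_sup_left
      refine le_trans ?_ (mul_le_mul_of_nonneg_left h2 measureReal_nonneg)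
      unfold outside
      split_ifs with h
      · simp [h]
      · simp [h]
    have h2 := outside_sub_le_bellman hA (⨍ y in Q, |f y| ∂μ) w
    have h3 := mul_le_mul_of_nonneg_left (measureReal_mul_norm_average_le (f := f) hQ) hA
    have h4 := mul_le_mul_of_nonneg_left h2 (measureReal_nonneg (μ := μ) (s := Q))
    nlinarith
  | succ n ih =>
    -- When the whole set belongs to the collection, removing it lowers the cardinality. Stated for
    -- general P and D because in the splitting case P may still carry all n + 1 members.
    have key : ∀ (P : Set (Fin d → ℝ)) (D : Finset (Set (Fin d → ℝ))), MeasurableSet P →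
        μ P ≠ ⊤ → IntegrableOn f P μ → P ∈ D → D.card ≤ n + 1 →
        (∀ R ∈ D, MeasurableSet R ∧ R ⊆ P) → IsLaminar D →
        μ.real {x | x ∈ P ∧ 1 < ‖w ⊔ posSup D (cubeAverage μ f x)‖} - A * ∫ y in P, ‖f y‖ ∂μ ≤
          μ.real P * bellman A (⨍ y in P, |f y| ∂μ) w := by
      intro P D hPm hP hfP hPD hcard hD hlam
      set a := ⨍ y in P, |f y| ∂μ with ha
      have h1 := ih P hPm hP hfP (D.erase P) (by rw [Finset.card_erase_of_mem hPD]; omega)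
        (fun R hR => hD R (Finset.mem_of_mem_erase hR)) (hlam.subset (Finset.erase_subset _ _))
        (w ⊔ a) (hw.trans le_sup_left)
      have h2 : {x | x ∈ P ∧ 1 < ‖w ⊔ posSup D (cubeAverage μ f x)‖} =
          {x | x ∈ P ∧ 1 < ‖w ⊔ a ⊔ posSup (D.erase P) (cubeAverage μ f x)‖} := by
        ext x
        refine and_congr_right fun hx => ?_
        rw [← Finset.insert_erase hPD, posSup_insert, cubeAverage_of_mem hx, ← sup_assoc,
          Finset.erase_insert_eq_erase, Finset.erase_idem]
      rw [h2]
      exact h1.trans (mul_le_mul_of_nonneg_left (bellman_sup_le hA a w) measureReal_nonneg)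
    by_cases hQD : Q ∈ D
    · exact key Q D hQm hQ hf hQD hcard hD hlam
    rcases D.eq_empty_or_nonempty with rfl | hne
    · exact ih Q hQm hQ hf ∅ (by simp) (by simp) hlam w hw
    obtain ⟨P, hPD, hmax⟩ := exists_maximal_set hne
    have hPQ : P ⊆ Q := (hD P hPD).2
    have hPm := (hD P hPD).1
    have hP : μ P ≠ ⊤ := measure_ne_top_of_subset hPQ hQ
    have hC : μ (Q \ P) ≠ ⊤ := measure_ne_top_of_subset Set.sdiff_subset hQ
    have hfP := hf.mono_set hPQ
    have hfC : IntegrableOn f (Q \ P) μ := hf.mono_set Set.sdiff_subset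
    have hdisj : ∀ R ∈ D, ¬ R ⊆ P → Disjoint R P := fun R hR h =>
      hlam.disjoint_of_maximal hPD hmax hR h
    have h1 := key P (D.filter (· ⊆ P)) hPm hP hfP
      (Finset.mem_filter.2 ⟨hPD, subset_rfl⟩) ((Finset.card_filter_le _ _).trans hcard)
      (fun R hR => ⟨(hD R (Finset.mem_filter.1 hR).1).1, (Finset.mem_filter.1 hR).2⟩)
      (hlam.subset (Finset.filter_subset _ _))
    have hcard' : (D.filter (¬ · ⊆ P)).card ≤ n := by
      have : (D.filter (¬ · ⊆ P)).card < D.card :=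
        Finset.card_lt_card (Finset.filter_ssubset.2 ⟨P, hPD, by simp⟩)
      omega
    have h2 := ih (Q \ P) (hQm.diff hPm) hC hfC (D.filter (¬ · ⊆ P)) hcard'
      (fun R hR => by
        obtain ⟨hR1, hR2⟩ := Finset.mem_filter.1 hR
        exact ⟨(hD R hR1).1, Set.subset_sdiff.2 ⟨(hD R hR1).2, hdisj R hR1 hR2⟩⟩)
      (hlam.subset (Finset.filter_subset _ _)) w hw
    have hsub : {x | x ∈ Q ∧ 1 < ‖w ⊔ posSup D (cubeAverage μ f x)‖} ⊆
        {x | x ∈ P ∧ 1 < ‖w ⊔ posSup (D.filter (· ⊆ P)) (cubeAverage μ f x)‖} ∪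
        {x | x ∈ Q \ P ∧ 1 < ‖w ⊔ posSup (D.filter (¬ · ⊆ P)) (cubeAverage μ f x)‖} := by
      rintro x ⟨hxQ, hx⟩
      by_cases hxP : x ∈ P
      · refine Or.inl ⟨hxP, hx.trans_le (norm_le_norm_of_nonneg_of_le (hw.trans le_sup_left)
          (sup_le_sup_left (posSup_cubeAverage_le fun R hR hxR => ?_) w))⟩
        refine Finset.mem_filter.2 ⟨hR, ?_⟩
        by_contra hRP
        exact Set.disjoint_left.1 (hdisj R hR hRP) hxR hxP
      · refine Or.inr ⟨⟨hxQ, hxP⟩, hx.trans_le (norm_le_norm_of_nonneg_of_le (hw.trans le_sup_left)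
          (sup_le_sup_left (posSup_cubeAverage_le fun R hR hxR => ?_) w))⟩
        exact Finset.mem_filter.2 ⟨hR, fun hRP => hxP (hRP hxR)⟩
    have h3 := (measureReal_mono hsub (measure_union_ne_top
      (measure_ne_top_of_subset (fun x hx => hx.1) hP)
      (measure_ne_top_of_subset (fun x hx => hx.1) hC))).trans (measureReal_union_le _ _)
    have h4 : ∫ y in Q, ‖f y‖ ∂μ = ∫ y in P, ‖f y‖ ∂μ + ∫ y in Q \ P, ‖f y‖ ∂μ := by
      rw [← integral_inter_add_sdiff hPm hf.norm, Set.inter_eq_self_of_subset_right hPQ]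
    have h5 : ∫ y in Q, |f y| ∂μ = ∫ y in P, |f y| ∂μ + ∫ y in Q \ P, |f y| ∂μ := by
      rw [← integral_inter_add_sdiff hPm (Integrable.abs hf), Set.inter_eq_self_of_subset_right hPQ]
    have h6 : μ.real Q = μ.real P + μ.real (Q \ P) := by
      rw [← measureReal_inter_add_sdiff hPm hQ, Set.inter_eq_self_of_subset_right hPQ]
    have h7 : μ.real P * bellman A (⨍ y in P, |f y| ∂μ) w +
        μ.real (Q \ P) * bellman A (⨍ y in Q \ P, |f y| ∂μ) w ≤
        μ.real Q * bellman A (⨍ y in Q, |f y| ∂μ) w := by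
      have hP0 := measureReal_nonneg (μ := μ) (s := P)
      have hC0 := measureReal_nonneg (μ := μ) (s := Q \ P)
      rcases (measureReal_nonneg (μ := μ) (s := Q)).eq_or_lt with h0 | hpos
      · have e1 : μ.real P = 0 := by linarith
        have e2 : μ.real (Q \ P) = 0 := by linarith
        rw [e1, e2, ← h0]
        simp
      have h8 := bellman_concave hA (⨍ y in P, |f y| ∂μ) (⨍ y in Q \ P, |f y| ∂μ) hw
        (div_nonneg hP0 hpos.le) (div_nonneg hC0 hpos.le)
        (by rw [← add_div, ← h6, div_self hpos.ne'])
      have h9 : (μ.real P / μ.real Q) • (⨍ y in P, |f y| ∂μ) +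
          (μ.real (Q \ P) / μ.real Q) • (⨍ y in Q \ P, |f y| ∂μ) = ⨍ y in Q, |f y| ∂μ := by
        rw [div_eq_inv_mul, div_eq_inv_mul, mul_smul, mul_smul, ← smul_add,
          measureReal_smul_average_abs hP, measureReal_smul_average_abs hC, ← h5, setAverage_eq]
      rw [h9] at h8
      have h10 := mul_le_mul_of_nonneg_left h8 hpos.le
      refine le_trans (le_of_eq ?_) h10
      field_simp
    rw [h4]
    linarith

theorem abs_smul_of_pos {c : ℝ} (hc : 0 < c) (x : E) : |c • x| = c • |x| := by
  refine le_antisymm (abs_le'.2 ⟨?_, ?_⟩) ?_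
  · exact smul_le_smul_of_nonneg_left (le_abs_self x) hc.le
  · rw [← smul_neg]
    exact smul_le_smul_of_nonneg_left (neg_le_abs x) hc.le
  · rw [← le_inv_smul_iff_of_pos hc]
    refine abs_le'.2 ⟨?_, ?_⟩
    · rw [le_inv_smul_iff_of_pos hc]
      exact le_abs_self _
    · rw [le_inv_smul_iff_of_pos hc, smul_neg]
      exact neg_le_abs _

theorem cubeAverage_smul {c : ℝ} (hc : 0 < c) (x : Fin d → ℝ) (Q : Set (Fin d → ℝ)) :
    cubeAverage μ (fun y => c • f y) x Q = c • cubeAverage μ f x Q := by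
  by_cases hx : x ∈ Q
  · rw [cubeAverage_of_mem hx, cubeAverage_of_mem hx]
    simp only [abs_smul_of_pos hc]
    rw [setAverage_eq, setAverage_eq, integral_smul, smul_comm]
  · rw [cubeAverage_of_notMem hx, cubeAverage_of_notMem hx, smul_zero]

/-- Rescaling f by 1/c brings the level to 1; with w = 0 the Bellman term is nonpositive and can be
dropped. -/
theorem weakType {A : ℝ} (hA : 0 ≤ A) (hB : ∀ e : E, BinTree.bellman A e 0 ≤ 0)
    {Q : Set (Fin d → ℝ)} (hQm : MeasurableSet Q) (hQ : μ Q ≠ ⊤) (hf : IntegrableOn f Q μ)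
    {D : Finset (Set (Fin d → ℝ))} (hD : ∀ R ∈ D, MeasurableSet R ∧ R ⊆ Q) (hlam : IsLaminar D)
    {c : ℝ} (hc : 0 < c) :
    c * μ.real {x | x ∈ Q ∧ c < ‖posSup D (cubeAverage μ f x)‖} ≤ A * ∫ y in Q, ‖f y‖ ∂μ := by
  have hc' : 0 < c⁻¹ := inv_pos.2 hc
  have h1 := measure_le_bellman (f := fun y => c⁻¹ • f y) hA D.card Q hQm hQ (hf.smul c⁻¹) D le_rfl
    hD hlam 0 le_rfl
  have h2 := mul_nonpos_of_nonneg_of_nonpos (measureReal_nonneg (μ := μ) (s := Q))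
    (hB (⨍ y in Q, |c⁻¹ • f y| ∂μ))
  have h3 : ∫ y in Q, ‖c⁻¹ • f y‖ ∂μ = c⁻¹ * ∫ y in Q, ‖f y‖ ∂μ := by
    simp only [norm_smul, Real.norm_of_nonneg hc'.le]
    rw [integral_const_mul]
  have h4 : {x | x ∈ Q ∧ c < ‖posSup D (cubeAverage μ f x)‖} ⊆
      {x | x ∈ Q ∧ 1 < ‖0 ⊔ posSup D (cubeAverage μ (fun y => c⁻¹ • f y) x)‖} := by
    rintro x ⟨hxQ, hx⟩
    refine ⟨hxQ, ?_⟩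
    rw [sup_of_le_right (posSup_nonneg _ _)]
    have h5 := posSup_smul_le D (cubeAverage μ (fun y => c⁻¹ • f y) x) hc.le
    have h6 : (fun R => c • cubeAverage μ (fun y => c⁻¹ • f y) x R) = cubeAverage μ f x := by
      ext1 R
      rw [cubeAverage_smul hc', smul_inv_smul₀ hc.ne']
    rw [h6] at h5
    have h7 := hx.trans_le (norm_le_norm_of_nonneg_of_le (posSup_nonneg _ _) h5)
    rw [norm_smul, Real.norm_of_nonneg hc.le] at h7
    exact lt_of_mul_lt_mul_left (by rwa [mul_one]) hc.le
  have h5 := measureReal_mono (μ := μ) h4 (measure_ne_top_of_subset (fun x hx => hx.1) hQ)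
  rw [h3] at h1
  have h6 : μ.real {x | x ∈ Q ∧ c < ‖posSup D (cubeAverage μ f x)‖} ≤
      c⁻¹ * (A * ∫ y in Q, ‖f y‖ ∂μ) := by linarith
  rwa [← le_inv_mul_iff₀ hc]

end WeakType

/-! ### Sparse domination -/

section Sparse

variable {d : ℕ} {E : Type*} [NormedAddCommGroup E] [NormedSpace ℝ E] [CompleteSpace E]
  [Lattice E] [IsOrderedAddMonoid E] [IsOrderedModule ℝ E] [HasSolidNorm E]
  {μ : Measure (Fin d → ℝ)} {f : (Fin d → ℝ) → E}

/-- The members of G containing x form a chain, so all of them contain the smallest one, R; the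
hypothesis for R controls their joint supremum. -/
theorem norm_posSup_chain_le {c : ℝ} (hc : 0 ≤ c) {G D : Finset (Set (Fin d → ℝ))}
    (hGD : G ⊆ D) (hlam : IsLaminar D)
    (hG : ∀ R ∈ G, ∀ D' : Finset (Set (Fin d → ℝ)), (∀ T ∈ D', T ∈ D ∧ R ⊆ T) →
      ‖posSup D' fun T => ⨍ y in T, |f y| ∂μ‖ ≤ c) (x : Fin d → ℝ) :
    ‖posSup G (cubeAverage μ f x)‖ ≤ c := by
  classical
  rcases (G.filter (x ∈ ·)).eq_empty_or_nonempty with h0 | hne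
  · have h1 := posSup_cubeAverage_le (μ := μ) (f := f) (D := G) (D' := ∅) (x := x)
      fun R hR hx => by
        rw [← h0]
        exact Finset.mem_filter.2 ⟨hR, hx⟩
    exact norm_le_of_nonneg_of_le (posSup_nonneg _ _) h1 (by simpa using hc)
  · obtain ⟨R, hR, hmin⟩ := exists_minimal_set hne
    obtain ⟨hRG, hxR⟩ := Finset.mem_filter.1 hR
    have hsub : ∀ T ∈ G.filter (x ∈ ·), R ⊆ T := by
      intro T hT
      obtain ⟨hTG, hxT⟩ := Finset.mem_filter.1 hT
      rcases hlam R (hGD hRG) T (hGD hTG) with h | h | h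
      · exact h
      · exact hmin T hT h
      · exact absurd hxT (Set.disjoint_left.1 h hxR)
    refine norm_le_of_nonneg_of_le (posSup_nonneg _ _) (posSup_le (posSup_nonneg _ _) ?_)
      (hG R hRG (G.filter (x ∈ ·)) fun T hT => ⟨hGD (Finset.mem_filter.1 hT).1, hsub T hT⟩)
    intro T hT
    by_cases hxT : x ∈ T
    · rw [cubeAverage_of_mem hxT]
      exact le_posSup (fun T => ⨍ y in T, |f y| ∂μ) (Finset.mem_filter.2 ⟨hT, hxT⟩)
    · rw [cubeAverage_of_notMem hxT]
      exact posSup_nonneg _ _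

theorem half_measure_le_sdiff {Q U : Set (Fin d → ℝ)} (hUm : MeasurableSet U) (hU : U ⊆ Q)
    (hQ : μ Q ≠ ⊤) (h : 2 * μ.real U ≤ μ.real Q) : μ Q / 2 ≤ μ (Q \ U) := by
  have h1 := measureReal_inter_add_sdiff (μ := μ) (s := Q) hUm hQ
  rw [Set.inter_eq_self_of_subset_right hU] at h1
  have h2 : (μ Q / 2).toReal ≤ (μ (Q \ U)).toReal := by
    rw [ENNReal.toReal_div]
    change μ.real Q / 2 ≤ μ.real (Q \ U)
    linarith
  exact (ENNReal.toReal_le_toReal (ENNReal.div_ne_top hQ (by norm_num))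
    (measure_ne_top_of_subset Set.sdiff_subset hQ)).1 h2

/-- The set where the maximal function exceeds `2A` times the average of the norm over `Q` fills at
most half of `Q`. -/
theorem two_mul_measure_stop_le {A : ℝ} (hA : 0 < A) (hB : ∀ e : E, BinTree.bellman A e 0 ≤ 0)
    {Q U : Set (Fin d → ℝ)} (hQm : MeasurableSet Q) (hQ : μ Q ≠ ⊤) (hf : IntegrableOn f Q μ)
    {D : Finset (Set (Fin d → ℝ))} (hD : ∀ R ∈ D, MeasurableSet R ∧ R ⊆ Q) (hlam : IsLaminar D)
    (hU : ∀ x ∈ U, x ∈ Q ∧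
      2 * A * (⨍ y in Q, ‖f y‖ ∂μ) < ‖posSup D (cubeAverage μ f x)‖) :
    2 * μ.real U ≤ μ.real Q := by
  set a := ⨍ y in Q, ‖f y‖ ∂μ with ha
  have ha0 : 0 ≤ a := by
    rw [ha, setAverage_eq]
    exact smul_nonneg (inv_nonneg.2 measureReal_nonneg)
      (integral_nonneg fun y => norm_nonneg _)
  have hint : ∫ y in Q, ‖f y‖ ∂μ = μ.real Q * a := by
    rw [ha, ← smul_eq_mul, measure_smul_setAverage _ hQ]
  rcases ha0.eq_or_lt with h0 | hpos
  -- The weak-type bound needs a positive level, so a = 0 is treated apart: f then has no mass on Q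
  -- and all averages vanish.
  · have hUe : U = ∅ := by
      by_contra hne
      obtain ⟨x, hx⟩ := Set.nonempty_iff_ne_empty.2 hne
      obtain ⟨hxQ, hlt⟩ := hU x hx
      rw [← h0, mul_zero] at hlt
      have hzero : posSup D (cubeAverage μ f x) ≤ 0 := by
        refine posSup_le le_rfl fun R hR => ?_
        by_cases hxR : x ∈ R
        · rw [cubeAverage_of_mem hxR]
          have h1 : ∫ y in R, ‖f y‖ ∂μ ≤ 0 := by
            have := setIntegral_mono_set hf.norm
              (Filter.Eventually.of_forall fun y => norm_nonneg (f y)) (hD R hR).2.eventuallyLE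
            rwa [hint, ← h0, mul_zero] at this
          have h2 := norm_average_abs_le (μ := μ) (f := f) R
          rw [setAverage_eq, setAverage_eq, smul_eq_mul] at h2
          have h3 : (μ.real R)⁻¹ * ∫ y in R, ‖f y‖ ∂μ ≤ 0 :=
            mul_nonpos_of_nonneg_of_nonpos (inv_nonneg.2 measureReal_nonneg) h1
          rw [setAverage_eq, norm_le_zero_iff.1 (h2.trans h3)]
        · rw [cubeAverage_of_notMem hxR]
      have := le_antisymm hzero (posSup_nonneg _ _)
      rw [this, norm_zero] at hlt
      exact lt_irrefl _ hlt
    rw [hUe]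
    simp [measureReal_nonneg]
  · have h1 := weakType hA.le hB hQm hQ hf hD hlam (by positivity : 0 < 2 * A * a)
    have h2 : μ.real U ≤ μ.real {x | x ∈ Q ∧ 2 * A * a < ‖posSup D (cubeAverage μ f x)‖} :=
      measureReal_mono hU (measure_ne_top_of_subset (fun x hx => hx.1) hQ)
    rw [hint] at h1
    have h3 := mul_le_mul_of_nonneg_left h2 (by positivity : 0 ≤ 2 * A * a)
    have h4 : A * a * (2 * μ.real U) ≤ A * a * μ.real Q := by linarith
    exact le_of_mul_le_mul_left h4 (by positivity)

/-- Take a maximal Q, let v_Q be the supremum over the subcubes before the stopping level 2A⟨‖f‖⟩_Q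
is exceeded, and recurse on all remaining cubes. The conclusion is a bound by a supremum of vectors
rather than a sum of norms; this is what lets an upper q-estimate act afterwards. -/
theorem exists_sparse_family {A : ℝ} (hA : 1 ≤ A) (hB : ∀ e : E, BinTree.bellman A e 0 ≤ 0)
    (D : Finset (Set (Fin d → ℝ)))
    (hD : ∀ R ∈ D, MeasurableSet R ∧ μ R ≠ ⊤ ∧ IntegrableOn f R μ) (hlam : IsLaminar D) :
    ∃ S ⊆ D, ∃ F : Set (Fin d → ℝ) → Set (Fin d → ℝ),
      (∀ Q ∈ S, MeasurableSet (F Q) ∧ F Q ⊆ Q ∧ μ Q / 2 ≤ μ (F Q)) ∧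
      (S : Set (Set (Fin d → ℝ))).PairwiseDisjoint F ∧
      ∃ v : Set (Fin d → ℝ) → (Fin d → ℝ) → E,
        (∀ Q ∈ S, ∀ x, 0 ≤ v Q x ∧
          ‖v Q x‖ ≤ Q.indicator (fun _ => 2 * A * ⨍ y in Q, ‖f y‖ ∂μ) x) ∧
        ∀ x, posSup D (cubeAverage μ f x) ≤ posSup S fun Q => v Q x := by
  classical
  induction D using Finset.strongInduction with
  | H D ih =>
  rcases D.eq_empty_or_nonempty with rfl | hne
  · exact ⟨∅, subset_rfl, id, by simp, by simp, fun _ _ => 0, by simp, fun x => le_rfl⟩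
  obtain ⟨Q, hQD, hmax⟩ := exists_maximal_set hne
  obtain ⟨hQm, hQ, hfQ⟩ := hD Q hQD
  set a := ⨍ y in Q, ‖f y‖ ∂μ with ha
  have ha0 : 0 ≤ a := by
    rw [ha, setAverage_eq]
    exact smul_nonneg (inv_nonneg.2 measureReal_nonneg) (integral_nonneg fun y => norm_nonneg _)
  set avg : Set (Fin d → ℝ) → E := fun T => ⨍ y in T, |f y| ∂μ with havg
  set DQ := D.filter (· ⊆ Q) with hDQ
  -- The stopped cubes: the maximal function restricted to Q exceeds the level throughout such an R.
  -- P contains all of them, not only the maximal ones; the recursion makes the selection.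
  set P := DQ.filter fun R => 2 * A * a < ‖posSup (DQ.filter (R ⊆ ·)) avg‖ with hP
  set G := DQ \ P with hG
  set rest := D \ G with hrest
  have hQDQ : Q ∈ DQ := Finset.mem_filter.2 ⟨hQD, subset_rfl⟩
  -- Here A ≥ 1 is used: Q is the only cube of DQ containing Q, and its average has norm at most a ≤
  -- 2Aa. Hence the recursion strictly shrinks the collection.
  have hQP : Q ∉ P := by
    intro h
    have h1 := (Finset.mem_filter.1 h).2
    have h2 : posSup (DQ.filter (Q ⊆ ·)) avg ≤ avg Q := by
      refine posSup_le (average_abs_nonneg μ f Q) fun T hT => ?_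
      obtain ⟨h3, h4⟩ := Finset.mem_filter.1 hT
      rw [Set.Subset.antisymm (Finset.mem_filter.1 h3).2 h4]
    have h3 := norm_le_of_nonneg_of_le (posSup_nonneg _ _) h2 (norm_average_abs_le Q)
    have h4 : a ≤ 2 * A * a := by nlinarith
    linarith
  have hQG : Q ∈ G := Finset.mem_sdiff.2 ⟨hQDQ, hQP⟩
  have hQrest : Q ∉ rest := fun h => (Finset.mem_sdiff.1 h).2 hQG
  have hGD : G ⊆ D := Finset.sdiff_subset.trans (Finset.filter_subset _ _)
  have hss : rest ⊂ D := Finset.ssubset_iff_subset_ne.2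
    ⟨Finset.sdiff_subset, fun h => hQrest (h ▸ hQD)⟩
  obtain ⟨S, hSr, F, hF, hFd, v, hv, hMv⟩ :=
    ih rest hss (fun R hR => hD R (hss.1 hR)) (hlam.subset hss.1)
  have hQS : Q ∉ S := fun h => hQrest (hSr h)
  have hneq : ∀ R ∈ S, R ≠ Q := fun R hR h => hQS (h ▸ hR)
  set U := ⋃ R ∈ P, R with hU
  have hPD : ∀ R ∈ P, R ∈ D ∧ R ⊆ Q := fun R hR =>
    Finset.mem_filter.1 (Finset.mem_filter.1 hR).1
  have hUm : MeasurableSet U := P.measurableSet_biUnion fun R hR => (hD R (hPD R hR).1).1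
  have hUQ : U ⊆ Q := Set.iUnion₂_subset fun R hR => (hPD R hR).2
  have hUhalf : 2 * μ.real U ≤ μ.real Q := by
    refine two_mul_measure_stop_le (by linarith) hB hQm hQ hfQ (D := DQ)
      (fun R hR => ⟨(hD R (Finset.mem_filter.1 hR).1).1, (Finset.mem_filter.1 hR).2⟩)
      (hlam.subset (Finset.filter_subset _ _)) fun x hx => ⟨hUQ hx, ?_⟩
    obtain ⟨R, hR, hxR⟩ := Set.mem_iUnion₂.1 hx
    refine (Finset.mem_filter.1 hR).2.trans_le (norm_le_norm_of_nonneg_of_le (posSup_nonneg _ _)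
      (posSup_le (posSup_nonneg _ _) fun T hT => ?_))
    obtain ⟨h1, h2⟩ := Finset.mem_filter.1 hT
    have h3 := le_posSup (cubeAverage μ f x) h1
    rwa [cubeAverage_of_mem (h2 hxR)] at h3
  refine ⟨insert Q S, Finset.insert_subset hQD (hSr.trans hss.1),
    Function.update F Q (Q \ U), ?_, ?_,
    Function.update v Q fun x => posSup G (cubeAverage μ f x), ?_, ?_⟩
  · intro R hR
    rcases Finset.mem_insert.1 hR with rfl | hR
    · rw [Function.update_self]
      exact ⟨hQm.diff hUm, Set.sdiff_subset, half_measure_le_sdiff hUm hUQ hQ hUhalf⟩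
    · rw [Function.update_of_ne (hneq R hR)]
      exact hF R hR
  -- A cube selected later either is a stopped cube, hence inside U, or is disjoint from Q by
  -- maximality.
  · have hdis : ∀ R ∈ S, Disjoint (Q \ U) (F R) := by
      intro R hR
      refine Set.disjoint_of_subset_right (hF R hR).2.1 ?_
      have hRr := Finset.mem_sdiff.1 (hSr hR)
      by_cases hRQ : R ⊆ Q
      · have hRP : R ∈ P := by
          by_contra hnot
          exact hRr.2 (Finset.mem_sdiff.2 ⟨Finset.mem_filter.2 ⟨hRr.1, hRQ⟩, hnot⟩)
        exact Set.disjoint_of_subset_right (Set.subset_biUnion_of_mem (u := fun R => R) hRP)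
          Set.disjoint_sdiff_left
      · exact (Set.disjoint_of_subset_right Set.sdiff_subset
          (hlam.disjoint_of_maximal hQD hmax hRr.1 hRQ)).symm
    intro R hR T hT hRT
    rw [Finset.mem_coe, Finset.mem_insert] at hR hT
    rcases hR with rfl | hR <;> rcases hT with rfl | hT
    · exact absurd rfl hRT
    · rw [Function.onFun, Function.update_self, Function.update_of_ne (hneq T hT)]
      exact hdis T hT
    · rw [Function.onFun, Function.update_self, Function.update_of_ne (hneq R hR)]
      exact (hdis R hR).symm
    · rw [Function.onFun, Function.update_of_ne (hneq R hR), Function.update_of_ne (hneq T hT)]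
      exact hFd hR hT hRT
  · intro R hR x
    rcases Finset.mem_insert.1 hR with rfl | hR
    · rw [Function.update_self]
      refine ⟨posSup_nonneg _ _, ?_⟩
      by_cases hx : x ∈ R
      · rw [Set.indicator_of_mem hx]
        refine norm_posSup_chain_le (D := DQ) (by positivity) Finset.sdiff_subset
          (hlam.subset (Finset.filter_subset _ _)) (fun T hT D' hD' => ?_) x
        obtain ⟨hT1, hT2⟩ := Finset.mem_sdiff.1 hT
        have h1 : ‖posSup (DQ.filter (T ⊆ ·)) avg‖ ≤ 2 * A * a := by
          by_contra hnot
          exact hT2 (Finset.mem_filter.2 ⟨hT1, not_le.1 hnot⟩)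
        exact norm_le_of_nonneg_of_le (posSup_nonneg _ _)
          (posSup_subset avg fun T' hT' => Finset.mem_filter.2 (hD' T' hT')) h1
      · rw [Set.indicator_of_notMem hx]
        have h1 := posSup_cubeAverage_le (μ := μ) (f := f) (D := G) (D' := ∅) (x := x)
          fun T hT hxT => absurd
            ((Finset.mem_filter.1 (Finset.mem_sdiff.1 hT).1).2 hxT) hx
        exact norm_le_of_nonneg_of_le (posSup_nonneg _ _) h1 (by simp)
    · rw [Function.update_of_ne (hneq R hR)]
      exact hv R hR x
  · intro x
    have hself : Function.update v Q (fun x => posSup G (cubeAverage μ f x)) Q x =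
        posSup G (cubeAverage μ f x) := by rw [Function.update_self]
    have h1 : posSup G (cubeAverage μ f x) ≤ posSup (insert Q S) fun R =>
        Function.update v Q (fun x => posSup G (cubeAverage μ f x)) R x := by
      rw [← hself]
      exact le_posSup (fun R => Function.update v Q (fun x => posSup G (cubeAverage μ f x)) R x)
        (Finset.mem_insert_self Q S)
    have h2 : posSup rest (cubeAverage μ f x) ≤ posSup (insert Q S) fun R =>
        Function.update v Q (fun x => posSup G (cubeAverage μ f x)) R x := by
      refine (hMv x).trans ((posSup_mono fun R hR => ?_).trans
        (posSup_subset _ (Finset.subset_insert Q S)))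
      rw [Function.update_of_ne (hneq R hR)]
    refine posSup_le (posSup_nonneg _ _) fun R hR => ?_
    by_cases hRG : R ∈ G
    · exact (le_posSup (cubeAverage μ f x) hRG).trans h1
    · exact (le_posSup (cubeAverage μ f x) (Finset.mem_sdiff.2 ⟨hR, hRG⟩)).trans h2

/-- Each b i is at most the ℓ^r norm T, so b i ^ q ≤ b i ^ r * T^(q-r). -/
theorem sum_rpow_rpow_le {ι : Type*} (s : Finset ι) (b : ι → ℝ) (hb : ∀ i ∈ s, 0 ≤ b i) {q r : ℝ}
    (hr : 0 < r) (hrq : r ≤ q) :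
    (∑ i ∈ s, b i ^ q) ^ (1 / q) ≤ (∑ i ∈ s, b i ^ r) ^ (1 / r) := by
  have hq : 0 < q := hr.trans_le hrq
  have hX0 : 0 ≤ ∑ i ∈ s, b i ^ r := Finset.sum_nonneg fun i hi => Real.rpow_nonneg (hb i hi) _
  set T := (∑ i ∈ s, b i ^ r) ^ (1 / r) with hT
  have hT0 : 0 ≤ T := Real.rpow_nonneg hX0 _
  have hTr : T ^ r = ∑ i ∈ s, b i ^ r := by
    rw [hT, ← Real.rpow_mul hX0, one_div_mul_cancel hr.ne', Real.rpow_one]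
  have hle : ∀ i ∈ s, b i ≤ T := by
    intro i hi
    have h1 : b i ^ r ≤ T ^ r := by
      rw [hTr]
      exact Finset.single_le_sum (f := fun i => b i ^ r)
        (fun i hi => Real.rpow_nonneg (hb i hi) _) hi
    exact (Real.rpow_le_rpow_iff (hb i hi) hT0 hr).1 h1
  have hsum : ∑ i ∈ s, b i ^ q ≤ T ^ q := by
    have h1 : ∀ i ∈ s, b i ^ q ≤ b i ^ r * T ^ (q - r) := by
      intro i hi
      have h2 : b i ^ q = b i ^ r * b i ^ (q - r) := by
        rw [← Real.rpow_add' (hb i hi) (by rw [add_sub_cancel]; exact hq.ne'), add_sub_cancel]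
      rw [h2]
      exact mul_le_mul_of_nonneg_left
        (Real.rpow_le_rpow (hb i hi) (hle i hi) (by linarith)) (Real.rpow_nonneg (hb i hi) _)
    refine (Finset.sum_le_sum h1).trans ?_
    rw [← Finset.sum_mul, ← hTr, ← Real.rpow_add' hT0 (by rw [add_sub_cancel]; exact hq.ne'),
      add_sub_cancel]
  have h3 := Real.rpow_le_rpow (Finset.sum_nonneg fun i hi => Real.rpow_nonneg (hb i hi) _) hsum
    (by positivity : 0 ≤ 1 / q)
  rwa [← Real.rpow_mul hT0, mul_one_div_cancel hq.ne', Real.rpow_one] at h3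

theorem sparseOperator_eq {q : ℝ} (hq : 0 < q) (S : Finset (Set (Fin d → ℝ)))
    (g : (Fin d → ℝ) → ℝ) (x : Fin d → ℝ) : sparseOperator μ q S g x =
      (∑ Q ∈ S, (Q.indicator (fun _ => ⨍ y in Q, |g y| ∂μ) x) ^ q) ^ (1 / q) := by
  rw [sparseOperator]
  congr 1
  refine Finset.sum_congr rfl fun Q _ => ?_
  by_cases hx : x ∈ Q
  · rw [Set.indicator_of_mem hx, Set.indicator_of_mem hx]
  · rw [Set.indicator_of_notMem hx, Set.indicator_of_notMem hx, Real.zero_rpow hq.ne']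

/-- Induction on the scale through the parent cube, whose index is m' / 2 with integer division. -/
theorem dyadicCube_subset_or_disjoint {k k' : ℤ} (hk : k ≤ k') (m m' : Fin d → ℤ) :
    dyadicCube k' m' ⊆ dyadicCube k m ∨ Disjoint (dyadicCube k' m') (dyadicCube k m) := by
  induction k', hk using Int.leInduction generalizing m' with
  | base =>
    by_cases h : m' = m
    · exact Or.inl (by rw [h])
    · refine Or.inr (Set.disjoint_left.2 fun x hx hx' => h (funext fun i => ?_))
      exact (mem_dyadicCube_iff.1 hx i).symm.trans (mem_dyadicCube_iff.1 hx' i)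
  | succ k' _ ih =>
    have hsub : dyadicCube (k' + 1) m' ⊆ dyadicCube k' fun i => m' i / 2 := by
      intro x hx
      rw [mem_dyadicCube_iff] at hx ⊢
      intro i
      rw [← floor_succ_ediv, hx i]
    rcases ih fun i => m' i / 2 with h | h
    · exact Or.inl (hsub.trans h)
    · exact Or.inr (Set.disjoint_of_subset_left hsub h)

theorem isLaminar_of_isDyadicCube {D : Finset (Set (Fin d → ℝ))} (hD : ∀ Q ∈ D, IsDyadicCube Q) :
    IsLaminar D := by
  intro P hP R hR
  obtain ⟨k, m, hPk⟩ := hD P hP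
  obtain ⟨k', m', hRk⟩ := hD R hR
  change P = dyadicCube k m at hPk
  change R = dyadicCube k' m' at hRk
  subst hPk hRk
  rcases le_total k k' with h | h
  · rcases dyadicCube_subset_or_disjoint h m m' with h1 | h1
    · exact Or.inr (Or.inl h1)
    · exact Or.inr (Or.inr h1.symm)
  · rcases dyadicCube_subset_or_disjoint h m' m with h1 | h1
    · exact Or.inl h1
    · exact Or.inr (Or.inr h1)

theorem dyadicCube_subset_Icc (k : ℤ) (m : Fin d → ℤ) :
    dyadicCube k m ⊆ Set.Icc (fun i => (2 : ℝ) ^ (-k) * m i) fun i => (2 : ℝ) ^ (-k) * (m i + 1) :=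
  fun _ hx => ⟨fun i => (hx i).1, fun i => (hx i).2.le⟩

theorem measure_dyadicCube_ne_top [IsLocallyFiniteMeasure μ] (k : ℤ) (m : Fin d → ℤ) :
    μ (dyadicCube k m) ≠ ⊤ :=
  measure_ne_top_of_subset (dyadicCube_subset_Icc k m) isCompact_Icc.measure_lt_top.ne

/-- The upper q-estimate is applied pointwise to the vectors v_Q, and the ℓ^q sum is then enlarged
to an ℓ^r sum. The constant depends on neither μ nor f. -/
theorem sparseDomination_of_upperEstimate {A : ℝ} (hA : 1 ≤ A)
    (hB : ∀ e : E, BinTree.bellman A e 0 ≤ 0) {q r C : ℝ} (hC : 0 ≤ C) (h : UpperEstimate E q C)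
    (hr : 0 < r) (hrq : r ≤ q) [IsLocallyFiniteMeasure μ] :
    SparseDomination E μ r (C * (2 * A)) := by
  intro D hD f hf
  have hq : 0 < q := hr.trans_le hrq
  obtain ⟨S, hSD, F, hF, hFd, v, hv, hM⟩ := exists_sparse_family (μ := μ) (f := f) hA hB D
    (fun R hR => by
      obtain ⟨k, m, rfl⟩ := hD R hR
      exact ⟨measurableSet_dyadicCube k m, measure_dyadicCube_ne_top k m,
        (hf.integrableOn_isCompact isCompact_Icc).mono_set (dyadicCube_subset_Icc k m)⟩)
    (isLaminar_of_isDyadicCube hD)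
  refine ⟨S, hSD, ⟨F, hF, hFd⟩, Filter.Eventually.of_forall fun x => ?_⟩
  rw [latticeMaximal_eq_posSup, sparseOperator_eq hr]
  simp only [abs_norm]
  have hnn : ∀ Q : Set (Fin d → ℝ), 0 ≤ Q.indicator (fun _ => ⨍ y in Q, ‖f y‖ ∂μ) x := fun Q =>
    Set.indicator_apply_nonneg fun _ => by
      rw [setAverage_eq]
      exact smul_nonneg (inv_nonneg.2 measureReal_nonneg) (integral_nonneg fun y => norm_nonneg _)
  have h1 : ∑ Q ∈ S, ‖v Q x‖ ^ q ≤
      (2 * A) ^ q * ∑ Q ∈ S, (Q.indicator (fun _ => ⨍ y in Q, ‖f y‖ ∂μ) x) ^ q := by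
    rw [Finset.mul_sum]
    refine Finset.sum_le_sum fun Q hQ => ?_
    rw [← Real.mul_rpow (by positivity) (hnn Q)]
    refine Real.rpow_le_rpow (norm_nonneg _) (((hv Q hQ x).2).trans (le_of_eq ?_)) hq.le
    by_cases hx : x ∈ Q
    · rw [Set.indicator_of_mem hx, Set.indicator_of_mem hx]
    · rw [Set.indicator_of_notMem hx, Set.indicator_of_notMem hx, mul_zero]
  have hX : 0 ≤ ∑ Q ∈ S, (Q.indicator (fun _ => ⨍ y in Q, ‖f y‖ ∂μ) x) ^ q :=
    Finset.sum_nonneg fun Q _ => Real.rpow_nonneg (hnn Q) _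
  calc ‖posSup D (cubeAverage μ f x)‖ ≤ ‖posSup S fun Q => v Q x‖ :=
        norm_le_norm_of_nonneg_of_le (posSup_nonneg _ _) (hM x)
    _ ≤ C * (∑ Q ∈ S, ‖v Q x‖ ^ q) ^ (1 / q) := h.norm_posSup_le hq S _ fun Q hQ => (hv Q hQ x).1
    _ ≤ C * ((2 * A) ^ q * ∑ Q ∈ S, (Q.indicator (fun _ => ⨍ y in Q, ‖f y‖ ∂μ) x) ^ q) ^ (1 / q) :=
        mul_le_mul_of_nonneg_left (Real.rpow_le_rpow (Finset.sum_nonneg fun Q _ =>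
          Real.rpow_nonneg (norm_nonneg _) _) h1 (by positivity)) hC
    _ = C * (2 * A) * (∑ Q ∈ S, (Q.indicator (fun _ => ⨍ y in Q, ‖f y‖ ∂μ) x) ^ q) ^ (1 / q) := by
        rw [Real.mul_rpow (by positivity) hX, ← Real.rpow_mul (by positivity),
          mul_one_div_cancel hq.ne', Real.rpow_one]
        ring
    _ ≤ _ := mul_le_mul_of_nonneg_left (sum_rpow_rpow_le S _ (fun Q _ => hnn Q) hr hrq)
        (by positivity)

end Sparse

/-! ### Sparse domination implies an upper estimate -/

section LowerBound

variable {d : ℕ} {E : Type*} [NormedAddCommGroup E] [NormedSpace ℝ E] [CompleteSpace E]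
  [Lattice E] [IsOrderedAddMonoid E] [IsOrderedModule ℝ E] [HasSolidNorm E]
  {μ : Measure (Fin d → ℝ)}

/-- The dyadic cubes of side length `2ʲ` with a corner at the origin. -/
def cornerCube (s : Fin d → Bool) (j : ℕ) : Set (Fin d → ℝ) :=
  dyadicCube (-(j : ℤ)) fun i => if s i then 0 else -1

theorem cornerCube_mono (s : Fin d → Bool) : Monotone (cornerCube s) := by
  refine monotone_nat_of_le_succ fun j x hx => ?_
  rw [cornerCube, mem_dyadicCube_iff] at hx ⊢
  intro i
  have h := floor_succ_ediv (-((j + 1 : ℕ) : ℤ)) (x i)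
  have h1 : -((j + 1 : ℕ) : ℤ) + 1 = -(j : ℤ) := by push_cast; ring
  rw [h1, hx i] at h
  rw [← h]
  split_ifs <;> rfl

theorem iUnion_cornerCube : ⋃ s : Fin d → Bool, ⋃ j, cornerCube s j = Set.univ := by
  refine Set.eq_univ_of_forall fun x => ?_
  obtain ⟨j, hj⟩ := pow_unbounded_of_one_lt ‖x‖ (one_lt_two : (1 : ℝ) < 2)
  refine Set.mem_iUnion.2 ⟨fun i => decide (0 ≤ x i), Set.mem_iUnion.2 ⟨j, fun i => ?_⟩⟩
  have h1 := abs_lt.1 ((norm_le_pi_norm x i).trans_lt hj)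
  rw [neg_neg, zpow_natCast]
  by_cases h : 0 ≤ x i
  · simp [h, h1.2]
  · simp [h, h1.1.le, not_le.1 h]

/-- The space is a finite union of orthants, each exhausted by corner cubes, so one orthant has
infinite measure. -/
theorem exists_cornerCube_tendsto (h : μ Set.univ = ⊤) : ∃ s : Fin d → Bool,
    Filter.Tendsto (fun j => μ (cornerCube s j)) Filter.atTop (nhds ⊤) := by
  obtain ⟨s, hs⟩ : ∃ s : Fin d → Bool, μ (⋃ j, cornerCube s j) = ⊤ := by
    by_contra! hne
    have h1 := measure_iUnion_fintype_le μ fun s : Fin d → Bool => ⋃ j, cornerCube s j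
    rw [iUnion_cornerCube, h, top_le_iff] at h1
    exact (ENNReal.sum_ne_top.2 fun s _ => hne s) h1
  refine ⟨s, ?_⟩
  rw [← hs]
  exact tendsto_measure_iUnion_atTop (cornerCube_mono s)

theorem exists_lacunary {a : ℕ → ℝ} (ha : ∀ M : ℝ, ∃ j₀, ∀ j, j₀ ≤ j → M < a j) (R : ℝ) :
    ∃ c : ℕ → ℕ, StrictMono c ∧ 0 < a (c 0) ∧ ∀ k, R * a (c k) < a (c (k + 1)) := by
  have hstep : ∀ j, ∃ j', j < j' ∧ R * a j < a j' := by
    intro j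
    obtain ⟨j₀, hj₀⟩ := ha (R * a j)
    exact ⟨max j₀ (j + 1), lt_of_lt_of_le (Nat.lt_succ_self j) (le_max_right _ _),
      hj₀ _ (le_max_left _ _)⟩
  choose g hg1 hg2 using hstep
  obtain ⟨j₀, hj₀⟩ := ha 0
  refine ⟨fun k => g^[k] j₀, strictMono_nat_of_lt_succ fun k => ?_, hj₀ _ le_rfl, fun k => ?_⟩
  · simp only [Function.iterate_succ_apply']
    exact hg1 _
  · simp only [Function.iterate_succ_apply']
    exact hg2 _

theorem exists_lacunary_cubes [IsLocallyFiniteMeasure μ] (h : μ Set.univ = ⊤) (R : ℝ) :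
    ∃ Q : ℕ → Set (Fin d → ℝ), (∀ k, IsDyadicCube (Q k)) ∧ (∀ k, MeasurableSet (Q k)) ∧
      (∀ k, μ (Q k) ≠ ⊤) ∧ Monotone Q ∧ 0 < μ.real (Q 0) ∧
      ∀ k, R * μ.real (Q k) < μ.real (Q (k + 1)) := by
  obtain ⟨s, hs⟩ := exists_cornerCube_tendsto h
  have hfin : ∀ j, μ (cornerCube s j) ≠ ⊤ := fun j => measure_dyadicCube_ne_top _ _
  obtain ⟨c, hc, hc0, hcR⟩ := exists_lacunary (a := fun j => μ.real (cornerCube s j)) (fun M => by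
    obtain ⟨j₀, hj₀⟩ := Filter.eventually_atTop.1
      (hs.eventually (lt_mem_nhds (ENNReal.ofReal_lt_top (r := M))))
    refine ⟨j₀, fun j hj => not_le.1 fun hle => (hj₀ j hj).not_ge ?_⟩
    rw [← ENNReal.ofReal_toReal (hfin j)]
    exact ENNReal.ofReal_le_ofReal hle) R
  exact ⟨fun k => cornerCube s (c k), fun k => isDyadicCube_dyadicCube _ _,
    fun k => measurableSet_dyadicCube _ _, fun k => hfin _,
    (cornerCube_mono s).comp hc.monotone, hc0, hcR⟩

theorem integral_indicator_const_restrict (e : E) {s Q : Set (Fin d → ℝ)} (hs : MeasurableSet s) :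
    ∫ y in Q, s.indicator (fun _ => e) y ∂μ = μ.real (s ∩ Q) • e := by
  rw [integral_indicator_const e hs, measureReal_restrict_apply hs]

/-- The test function equals e k on the k-th shell of a lacunary sequence of nested cubes. Around a
point of the smallest cube the maximal function sees every e k, while the sparse operator sees only
the numbers b k. Disjointness of the sets in the sparse family plays no role; S ⊆ D suffices. -/
theorem upperEstimate_of_sparseDomination [IsLocallyFiniteMeasure μ] (h : μ Set.univ = ⊤)
    {q C : ℝ} (hq : 0 < q) (hS : SparseDomination E μ q C) :
    UpperEstimate E q (4 * max C 0) := by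
  classical
  intro n e b he hb heb
  rcases Nat.eq_zero_or_pos n with rfl | hn
  · have h0 : posSup (Finset.univ : Finset (Fin 0)) e = 0 := rfl
    rw [h0, norm_zero]
    positivity
  obtain ⟨β, hβ0, hβ⟩ : ∃ β : ℝ, 0 < β ∧ ∀ k, β ≤ b k := by
    obtain ⟨k₀, -, hk₀⟩ := Finset.exists_min_image Finset.univ b ⟨⟨0, hn⟩, Finset.mem_univ _⟩
    exact ⟨b k₀, hb k₀, fun k => hk₀ k (Finset.mem_univ k)⟩
  set N := ∑ k, ‖e k‖ with hN
  have hN0 : 0 ≤ N := Finset.sum_nonneg fun k _ => norm_nonneg _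
  -- The summand 2 makes each shell at least half of its cube; N / β makes the smaller shells
  -- contribute at most β ≤ b k to the average of ‖f‖. Dividing by β is why majorants are required
  -- to be positive.
  set R := 2 + N / β with hR
  have hR2 : 2 ≤ R := by
    have : 0 ≤ N / β := by positivity
    linarith
  obtain ⟨Q, hQd, hQm, hQfin, hQmono, hQ0, hQR⟩ := exists_lacunary_cubes h R
  have hQpos : ∀ k, 0 < μ.real (Q k) := fun k =>
    hQ0.trans_le (measureReal_mono (hQmono (Nat.zero_le k)) (hQfin k))
  -- W k is the preceding cube Q (k - 1), and W 0 is empty.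
  obtain ⟨W, hWm, hWQ, hWR, hWlt⟩ : ∃ W : ℕ → Set (Fin d → ℝ), (∀ k, MeasurableSet (W k)) ∧
      (∀ k, W k ⊆ Q k) ∧ (∀ k, R * μ.real (W k) ≤ μ.real (Q k)) ∧ ∀ j k, j < k → Q j ⊆ W k := by
    refine ⟨fun k => Nat.casesOn k ∅ Q, fun k => ?_, fun k => ?_, fun k => ?_, fun j k hjk => ?_⟩
    · cases k
      · exact MeasurableSet.empty
      · exact hQm _
    · cases k with
      | zero => exact Set.empty_subset _
      | succ k => exact hQmono (Nat.le_succ k)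
    · cases k with
      | zero => simp [measureReal_nonneg]
      | succ k => exact (hQR k).le
    · cases k with
      | zero => exact absurd hjk (Nat.not_lt_zero _)
      | succ k => exact hQmono (Nat.le_of_lt_succ hjk)
  have hAm : ∀ k, MeasurableSet (Q k \ W k) := fun k => (hQm k).diff (hWm k)
  set g : Fin n → (Fin d → ℝ) → E := fun k => (Q k \ W k).indicator fun _ => e k with hg
  have hg0 : ∀ k x, 0 ≤ g k x := fun k x => Set.indicator_apply_nonneg fun _ => he k
  have hgint : ∀ k, Integrable (g k) μ := fun k =>
    (integrable_indicator_iff (hAm k)).2 (integrableOn_const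
      (measure_ne_top_of_subset Set.sdiff_subset (hQfin k)))
  set f : (Fin d → ℝ) → E := fun x => ∑ k, g k x with hf
  have hfint : Integrable f μ := integrable_finsetSum _ fun k _ => hgint k
  have hlow : ∀ k : Fin n, (1 / 2 : ℝ) • e k ≤ ⨍ y in Q k, |f y| ∂μ := by
    intro k
    have h1 : ∫ y in Q k, g k y ∂μ ≤ ∫ y in Q k, |f y| ∂μ :=
      integral_mono (hgint k).integrableOn (Integrable.abs hfint.integrableOn) fun y =>
        (Finset.single_le_sum (f := fun k => g k y) (fun k _ => hg0 k y)
          (Finset.mem_univ k)).trans (le_abs_self _)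
    rw [hg, integral_indicator_const_restrict _ (hAm k),
      Set.inter_eq_self_of_subset_left Set.sdiff_subset] at h1
    have h2 : μ.real (Q k) / 2 ≤ μ.real (Q k \ W k) := by
      have h3 := measureReal_inter_add_sdiff (μ := μ) (s := Q k) (hWm k) (hQfin k)
      rw [Set.inter_eq_self_of_subset_right (hWQ k)] at h3
      have h4 := hWR k
      have h5 := mul_le_mul_of_nonneg_right hR2 (measureReal_nonneg (μ := μ) (s := W k))
      linarith
    rw [setAverage_eq, le_inv_smul_iff_of_pos (hQpos k), smul_smul, mul_one_div]
    exact (smul_le_smul_of_nonneg_right h2 (he k)).trans h1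
  have hup : ∀ k : Fin n, ⨍ y in Q k, ‖f y‖ ∂μ ≤ 2 * b k := by
    intro k
    have h1 : ∫ y in Q k, ‖f y‖ ∂μ ≤ ∑ j : Fin n, μ.real ((Q j \ W j) ∩ Q k) * ‖e j‖ := by
      have h2 : ∫ y in Q k, ‖f y‖ ∂μ ≤ ∫ y in Q k, ∑ j, ‖g j y‖ ∂μ :=
        integral_mono hfint.norm.integrableOn
          (integrable_finsetSum _ fun j _ => (hgint j).norm.integrableOn) fun y => norm_sum_le _ _
      rw [integral_finsetSum _ fun j _ => (hgint j).norm.integrableOn] at h2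
      refine h2.trans (le_of_eq (Finset.sum_congr rfl fun j _ => ?_))
      simp only [hg, norm_indicator_eq_indicator_norm]
      exact integral_indicator_const_restrict ‖e j‖ (hAm j)
    have h2 : ∀ j : Fin n, μ.real ((Q j \ W j) ∩ Q k) * ‖e j‖ ≤
        (if j = k then μ.real (Q k) * ‖e k‖ else 0) + μ.real (Q k) / R * ‖e j‖ := by
      intro j
      have hnn : 0 ≤ μ.real (Q k) / R * ‖e j‖ :=
        mul_nonneg (div_nonneg measureReal_nonneg (by linarith)) (norm_nonneg _)
      rcases lt_trichotomy j k with hjk | rfl | hjk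
      · rw [if_neg hjk.ne, zero_add]
        refine mul_le_mul_of_nonneg_right ?_ (norm_nonneg _)
        rw [le_div_iff₀ (by linarith), mul_comm]
        refine le_trans ?_ (hWR k)
        refine mul_le_mul_of_nonneg_left ?_ (by linarith)
        exact measureReal_mono ((Set.inter_subset_left.trans Set.sdiff_subset).trans
          (hWlt j k hjk)) (measure_ne_top_of_subset (hWQ k) (hQfin k))
      · rw [if_pos rfl]
        have : μ.real ((Q j \ W j) ∩ Q j) * ‖e j‖ ≤ μ.real (Q j) * ‖e j‖ :=
          mul_le_mul_of_nonneg_right (measureReal_mono Set.inter_subset_right (hQfin j))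
            (norm_nonneg _)
        linarith
      · have hempty : (Q j \ W j) ∩ Q k = ∅ := by
          refine Set.eq_empty_of_forall_notMem fun x hx => hx.1.2 (hWlt k j hjk hx.2)
        rw [hempty, measureReal_empty, zero_mul, if_neg hjk.ne', zero_add]
        exact hnn
    have h3 := h1.trans (Finset.sum_le_sum fun j _ => h2 j)
    rw [Finset.sum_add_distrib, ← Finset.mul_sum, Finset.sum_ite_eq' Finset.univ k,
      if_pos (Finset.mem_univ k), ← hN] at h3
    rw [setAverage_eq, smul_eq_mul, inv_mul_le_iff₀ (hQpos k)]
    have h4 : μ.real (Q k) / R * N ≤ μ.real (Q k) * b k := by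
      rw [div_mul_eq_mul_div, mul_div_assoc]
      refine mul_le_mul_of_nonneg_left ?_ (hQpos k).le
      rw [div_le_iff₀ (by linarith)]
      have h5 : N ≤ β * R := by
        rw [hR, mul_add, mul_div_cancel₀ _ hβ0.ne']
        linarith
      exact h5.trans (mul_le_mul_of_nonneg_right (hβ k) (by linarith))
    have h5 := mul_le_mul_of_nonneg_left (heb k) (hQpos k).le
    linarith
  set D := Finset.univ.image fun k : Fin n => Q k with hD
  obtain ⟨S, hSD, -, hae⟩ := hS D (fun P hP => by
    obtain ⟨k, -, rfl⟩ := Finset.mem_image.1 hP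
    exact hQd k) f hfint.locallyIntegrable
  -- The almost everywhere bound holds somewhere in Q 0, which has positive measure; such an x lies
  -- in all the cubes.
  obtain ⟨x, hx0, hx⟩ : ∃ x ∈ Q 0, ‖latticeMaximal μ D f x‖ ≤
      C * sparseOperator μ q S (fun y => ‖f y‖) x := by
    by_contra! hne
    have h1 : μ (Q 0) = 0 := measure_mono_null (fun x hx => not_le.2 (hne x hx)) hae
    rw [Measure.real, h1] at hQ0
    simp at hQ0
  have hxQ : ∀ k, x ∈ Q k := fun k => hQmono (Nat.zero_le k) hx0
  have hinj : Function.Injective fun k : Fin n => Q k := by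
    have hsm : StrictMono fun k : ℕ => μ.real (Q k) := by
      refine strictMono_nat_of_lt_succ fun k => lt_of_le_of_lt ?_ (hQR k)
      nlinarith [hQpos k]
    intro j k hjk
    exact Fin.ext (hsm.injective (congrArg μ.real hjk))
  have hmax : posSup Finset.univ e ≤ (2 : ℝ) • latticeMaximal μ D f x := by
    rw [latticeMaximal_eq_posSup]
    refine posSup_le (smul_nonneg zero_le_two (posSup_nonneg _ _)) fun k _ => ?_
    have h1 := (hlow k).trans_eq (cubeAverage_of_mem (hxQ k)).symm
    have h2 := h1.trans (le_posSup (cubeAverage μ f x)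
      (Finset.mem_image_of_mem (fun k : Fin n => Q k) (Finset.mem_univ k)))
    have h3 := smul_le_smul_of_nonneg_left h2 (zero_le_two (α := ℝ))
    rwa [smul_smul, show (2 : ℝ) * (1 / 2) = 1 by norm_num, one_smul] at h3
  have havg0 : ∀ P : Set (Fin d → ℝ), 0 ≤ ⨍ y in P, ‖f y‖ ∂μ := fun P => by
    rw [setAverage_eq]
    exact smul_nonneg (inv_nonneg.2 measureReal_nonneg) (integral_nonneg fun y => norm_nonneg _)
  have hind : ∀ P : Set (Fin d → ℝ), 0 ≤ P.indicator (fun _ => ⨍ y in P, ‖f y‖ ∂μ) x :=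
    fun P => Set.indicator_apply_nonneg fun _ => havg0 P
  have hb0 : 0 ≤ ∑ k, b k ^ q := Finset.sum_nonneg fun k _ => Real.rpow_nonneg (hb k).le _
  have hsp0 : 0 ≤ sparseOperator μ q S (fun y => ‖f y‖) x := by
    rw [sparseOperator_eq hq]
    simp only [abs_norm]
    exact Real.rpow_nonneg (Finset.sum_nonneg fun P _ => Real.rpow_nonneg (hind P) _) _
  have hsp : sparseOperator μ q S (fun y => ‖f y‖) x ≤ 2 * (∑ k, b k ^ q) ^ (1 / q) := by
    have h1 : ∑ P ∈ S, (P.indicator (fun _ => ⨍ y in P, ‖f y‖ ∂μ) x) ^ q ≤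
        2 ^ q * ∑ k, b k ^ q := by
      calc _ ≤ ∑ P ∈ D, (P.indicator (fun _ => ⨍ y in P, ‖f y‖ ∂μ) x) ^ q :=
            Finset.sum_le_sum_of_subset_of_nonneg hSD fun P _ _ => Real.rpow_nonneg
              (hind P) _
        _ = ∑ k : Fin n, (⨍ y in Q k, ‖f y‖ ∂μ) ^ q := by
            rw [hD, Finset.sum_image hinj.injOn]
            exact Finset.sum_congr rfl fun k _ => by rw [Set.indicator_of_mem (hxQ k)]
        _ ≤ ∑ k, (2 * b k) ^ q := Finset.sum_le_sum fun k _ =>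
            Real.rpow_le_rpow (havg0 _) (hup k) hq.le
        _ = 2 ^ q * ∑ k, b k ^ q := by
            rw [Finset.mul_sum]
            exact Finset.sum_congr rfl fun k _ => Real.mul_rpow zero_le_two (hb k).le
    rw [sparseOperator_eq hq]
    simp only [abs_norm]
    have h2 := Real.rpow_le_rpow (Finset.sum_nonneg fun P _ => Real.rpow_nonneg
      (hind P) _) h1 (by positivity : 0 ≤ 1 / q)
    rwa [Real.mul_rpow (by positivity) hb0, ← Real.rpow_mul zero_le_two,
      mul_one_div_cancel hq.ne', Real.rpow_one] at h2
  calc ‖posSup Finset.univ e‖ ≤ ‖(2 : ℝ) • latticeMaximal μ D f x‖ :=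
        norm_le_norm_of_nonneg_of_le (posSup_nonneg _ _) hmax
    _ = 2 * ‖latticeMaximal μ D f x‖ := by rw [norm_smul, Real.norm_of_nonneg zero_le_two]
    _ ≤ 2 * (max C 0 * (2 * (∑ k, b k ^ q) ^ (1 / q))) := by
        refine mul_le_mul_of_nonneg_left (hx.trans ?_) zero_le_two
        exact (mul_le_mul_of_nonneg_right (le_max_left _ _) hsp0).trans
          (mul_le_mul_of_nonneg_left hsp (le_max_right _ _))
    _ = 4 * max C 0 * (∑ k, b k ^ q) ^ (1 / q) := by ring

end LowerBound

/-! ### Upper estimates and the critical exponent -/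

section Critical

variable {E : Type*} [NormedAddCommGroup E] [NormedSpace ℝ E] [CompleteSpace E]
  [Lattice E] [IsOrderedAddMonoid E] [IsOrderedModule ℝ E] [HasSolidNorm E]

theorem le_criticalExponent_of_upperEstimate {q C : ℝ} (hq : 1 < q) (hC : 0 ≤ C)
    (h : UpperEstimate E q C) : (q : EReal) ≤ criticalExponent E := by
  refine le_of_forall_lt fun c hc => ?_
  -- An exponent strictly below q is needed, as the upper estimate loses the endpoint; the maximum
  -- with 1 keeps r admissible even when c is small or -∞.
  obtain ⟨r, hr1, hr2⟩ := EReal.lt_iff_exists_real_btwn.1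
    (max_lt hc (show ((1 : ℝ) : EReal) < q from EReal.coe_lt_coe_iff.2 hq))
  have hr1' : 1 < r := EReal.coe_lt_coe_iff.1 ((le_max_right _ _).trans_lt hr1)
  have hrq : r < q := EReal.coe_lt_coe_iff.1 hr2
  exact ((le_max_left _ _).trans_lt hr1).trans_le
    (le_sSup ⟨r, ⟨hr1', isQConvex_of_upperEstimate hC h hr1' hrq⟩, rfl⟩)

end Critical

end SparseLattice

end

/-! ### Proof of the theorem -/

theorem mainTheorem3 (d : ℕ) (E : Type*) [NormedAddCommGroup E] [NormedSpace ℝ E]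
    [CompleteSpace E] [Lattice E] [IsOrderedAddMonoid E] [IsOrderedModule ℝ E] [HasSolidNorm E]
    (hE : SparseLattice.HardyLittlewoodProperty d E) :
    (∀ q : ℝ, 1 ≤ q → (q : EReal) < SparseLattice.criticalExponent E →
      ∃ C : ℝ, ∀ μ : Measure (Fin d → ℝ), IsLocallyFiniteMeasure μ → μ Set.univ = ⊤ →
        SparseLattice.SparseDomination E μ q C) ∧
    (∀ q : ℝ, 1 ≤ q → SparseLattice.criticalExponent E < (q : EReal) →
      ∀ μ : Measure (Fin d → ℝ), IsLocallyFiniteMeasure μ → μ Set.univ = ⊤ →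
        ¬ ∃ C : ℝ, SparseLattice.SparseDomination E μ q C) := by
  open SparseLattice in
  rcases Nat.eq_zero_or_pos d with rfl | hd
  -- In dimension 0 the space is a point, so locally finite measures are finite and both claims are
  -- vacuous.
  · have hne : ∀ μ : Measure (Fin 0 → ℝ), IsLocallyFiniteMeasure μ → μ Set.univ ≠ ⊤ :=
      fun μ _ => isCompact_univ.measure_lt_top.ne
    exact ⟨fun q _ _ => ⟨0, fun μ hμ h => absurd h (hne μ hμ)⟩,
      fun q _ _ μ hμ h => absurd h (hne μ hμ)⟩
  obtain ⟨p, K, hp, hK, hmax⟩ := hE.exists_maximalBound ⟨0, hd⟩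
  constructor
  · intro q hq hlt
    -- Some r > q with E r-convex exists by definition of the supremum; nothing is needed about
    -- exponents between q and r.
    obtain ⟨_, ⟨r, ⟨-, hr⟩, rfl⟩, hqr⟩ := lt_sSup_iff.1 hlt
    have hqr' : q < r := EReal.coe_lt_coe_iff.1 hqr
    obtain ⟨C, hC, hup⟩ := upperEstimate_of_isQConvex hr
    refine ⟨C * (2 * (K * 2 ^ (p - 1) + 1)), fun μ hμ _ => ?_⟩
    have hA : 1 ≤ K * 2 ^ (p - 1) + 1 := by
      have : 0 ≤ K * 2 ^ (p - 1) := by positivity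
      linarith
    exact sparseDomination_of_upperEstimate hA (hmax.bellman_zero_le hp hK) hC hup
      (by linarith) hqr'.le
  · rintro q hq hlt μ hμ htop ⟨C, hS⟩
    -- For q = 1 the estimate extracted from sparse domination says nothing, and the
    -- Hardy–Littlewood property excludes q* < 1 directly. For q > 1 sparse domination alone forces
    -- q ≤ q*.
    rcases hq.eq_or_lt with rfl | hq1
    · obtain ⟨r, C', hr, hC', hup⟩ := hmax.exists_upperEstimate hp.le hK
      have h1 := le_criticalExponent_of_upperEstimate hr hC' hup
      exact absurd (EReal.coe_lt_coe_iff.1 (h1.trans_lt hlt)) (not_lt.2 hr.le)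
    · exact absurd (le_criticalExponent_of_upperEstimate hq1 (by positivity)
        (upperEstimate_of_sparseDomination htop (by linarith) hS)) (not_le.2 hlt)
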